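/- Let $0\le k\le n$ be integers and let $\Bbbk$ be a field. Write $R=\mathbb Z[U_1,\dots,U_n]=\mathbb Z[x_1,\dots,x_n]$ ($U_i=x_i$, of degree $2$). **The algebra $B_l(n,k)$.** For $\mathbf x\subset\{0,\dots,n\}$ with $|\mathbf x|=k$ let $v_i^{\mathbf x}=|\mathbf x\cap\{i,\dots,n\}|$ for $1\le i\le n$. Let $B_0(n,k)$ be the path algebra over $R$ of the quiver whose vertices are these $\mathbf x$, with one arrow $f_{\mathbf x,\mathbf y}$ for each pair, the arrow $f_{\mathbf x,\mathbf x}=:I_{\mathbf x}$ being the trivial path, modulo $f_{\mathbf x,\mathbf y}f_{\mathbf y,\mathbf z}=\prod_i U_i^{g_i}f_{\mathbf x,\mathbf z}$ with $g_i=\tfrac12(|v_i^{\mathbf y}-v_i^{\mathbf z}|-|v_i^{\mathbf x}-v_i^{\mathbf z}|+|v_i^{\mathbf x}-v_i^{\mathbf y}|)$. Let $R_i$ (resp. $L_i$) be the sum of the $f_{\mathbf x,\mathbf y}$ with $\mathbf x\cap\{i-1,i\}=\{i-1\}$, $\mathbf y=\mathbf x\setminus\{i-1\}\cup\{i\}$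 (resp. $\mathbf x\cap\{i-1,i\}=\{i\}$, $\mathbf y=\mathbf x\setminus\{i\}\cup\{i-1\}$). Let $B(n,k)$ be the quotient of $B_0(n,k)$ by the ideal generated by all $R_{i-1}R_i$, all $L_iL_{i-1}$, and all $U_iI_{\mathbf x}$ with $\mathbf x\cap\{i-1,i\}=\varnothing$. Put $B_l(n,k)=eB(n,k)e$, where $e$ is the sum of the $I_{\mathbf x}$ over the set $V_l(n,k)$ of those $\mathbf x$ with $n\notin\mathbf x$. It is graded by $\deg U_i=2$, $\deg f_{\mathbf x,\mathbf y}=\sum_i|v_i^{\mathbf x}-v_i^{\mathbf y}|$. **The algebra $\mathcal A_{n,k}$.** Let $D_{n,k}$ be the set of sequences of $k$ symbols $\wedge$ and $n-k$ symbols $\vee$; identify it with $V_l(n,k)$ by letting $\mathbf x$ correspond to the sequence with $\wedge$ in the positions $a+1$, $a\in\mathbf x$. For $\mu\in D_{n,k}$ let $b_i^\mu-1$ be the number of $\wedge$'s strictly to the right of position $i$, let $\vee_j^\mu$ be the position of the $j$-th $\vee$, and let $R_\mu=R/(h_{b_1^\mu}(x_1),h_{b_2^\mu}(x_1,x_2),\dots,h_{b_n^\mu}(x_1,\dots,x_n))$,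 where the $h_d$ are complete homogeneous symmetric polynomials. Call $\lambda,\mu$ too far if $\vee_j^\mu\ge\vee_{j+1}^\lambda$ or $\vee_j^\lambda\ge\vee_{j+1}^\mu$ for some $1\le j\le n-k-1$. Let $c_i=\max(b_i^\mu-b_i^\lambda,0)$. Let $W_{\lambda,\mu}\subset\mathrm{Hom}_R(R_\lambda,R_\mu)$ be everything if $\lambda,\mu$ are too far, and otherwise the $R$-submodule generated by the maps $1\mapsto x_{\alpha(j)}x_{\alpha(j)+1}\cdots x_{\beta(j)}\cdot x_1^{c_1}\cdots x_n^{c_n}$ for $1\le j\le n-k$, with $\alpha(j)=\max(\vee_j^\lambda,\vee_j^\mu)$ and $\beta(j)=\min(\vee_{j+1}^\lambda,\vee_{j+1}^\mu)-1$ ($\beta(n-k)=n$). Then $\mathcal A_{n,k}=\bigoplus_{\lambda,\mu}\mathrm{Hom}_R(R_\lambda,R_\mu)/W_{\lambda,\mu}$, with composition as product; it is graded by giving $1\mapsto p$ in $\mathrm{Hom}_R(R_\lambda,R_\mu)$, for $p$ a homogeneous polynomial of polynomial degree $m$, the degree $2m+\sum_i(b_i^\lambda-b_i^\mu)$. **The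 quotient map.** There is a unique $R$-linear ring homomorphism $\Xi:B_l(n,k)\to\mathcal A_{n,k}$ such that, for $\mathbf x,\mathbf y$ corresponding to $\mu,\lambda$, $\Xi(f_{\mathbf x,\mathbf y})=0$ if $\lambda,\mu$ are too far, and otherwise $\Xi(f_{\mathbf x,\mathbf y})$ is the class of $R_\lambda\to R_\mu$, $1\mapsto x_1^{c_1}\cdots x_n^{c_n}$. **Grothendieck groups.** Put $B=B_l(n,k)\otimes_{\mathbb Z}\Bbbk$ and $A=\mathcal A_{n,k}\otimes_{\mathbb Z}\Bbbk$. For $C\in\{B,A\}$ let $K_0(C)$ be the Grothendieck group of finitely generated projective graded left $C$-modules; it is a $\mathbb Z[q,q^{-1}]$-module by $q^i[M]=[q^iM]$, where $q^iM$ is $M$ with degrees shifted upwards by $i$. Let $P(\mathbf x)=BI_{\mathbf x}$ and $P(\lambda)=A\mathbf 1_\lambda$, where $\mathbf 1_\lambda$ is the class of the identity of $R_\lambda$. For a finitely generated projective graded $B$-module $P$ let $\mathrm{pr}(P)=A\otimes_BP$, where $B$ acts on $A$ on the right through $\Xi$. **The weight space.** Let $V=\mathbb C(q)\langle v_0,v_1\rangle$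 be the vector representation of $U_q(\mathfrak{gl}(1|1))$, in which $K_1v_0=qv_0$, $K_1v_1=v_1$, $K_2v_0=v_0$, $K_2v_1=qv_1$, and let $(V^{\otimes n})_k=\{v: K_1v=q^kv,\ K_2v=q^{n-k}v\}$, where $K_1,K_2$ act diagonally. Write $e_{i_k}\wedge\cdots\wedge e_{i_1}$ ($i_k>\dots>i_1$) for the standard basis vector with $v_0$ in positions $i_1,\dots,i_k$ and $v_1$ elsewhere, let $\ell_1=e_1$ and $\ell_i=e_i+qe_{i-1}$ for $i\ge2$. For $\mathbf x\in V_l(n,k)$, corresponding to the sequence with $\wedge$ in positions $i_1<\dots<i_k$, let $v_{\mathbf x}^{\diamondsuit}=\ell_{i_k}\wedge\cdots\wedge\ell_{i_1}$ (expanded without signs, with a product having a repeated factor equal to zero) be the corresponding canonical basis element. **Theorem.** The modules $P(\mathbf x)$ and $P(\lambda)$ are finitely generated projective graded modules, and so is $\mathrm{pr}(P)$ for every finitely generated projective graded $B$-module $P$. There is an isomorphism of $\mathbb Z[q,q^{-1}]$-modules $\Phi:K_0(B)\to K_0(A)$ with $\Phi([P])=[\mathrm{pr}(P)]$ for all $P$.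 There are a unique $\mathbb C(q)$-linear isomorphism $\beta:K_0(B)\otimes_{\mathbb Z[q,q^{-1}]}\mathbb C(q)\to(V^{\otimes n})_k$ with $\beta([P(\mathbf x)])=v_{\mathbf x}^{\diamondsuit}$ for all $\mathbf x\in V_l(n,k)$, and a unique $\mathbb C(q)$-linear isomorphism $\alpha:K_0(A)\otimes_{\mathbb Z[q,q^{-1}]}\mathbb C(q)\to(V^{\otimes n})_k$ with $\alpha([P(\lambda)])=v_\lambda^{\diamondsuit}$ for all $\lambda\in D_{n,k}$, and they satisfy $\alpha\circ(\Phi\otimes\mathrm{id}_{\mathbb C(q)})=\beta$. -/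

import Mathlib

open scoped TensorProduct LaurentPolynomial

namespace OSzSar

noncomputable section

/-! ### I-states and their weights -/

/-- The ring `ℤ[U₁,…,Uₙ] = ℤ[x₁,…,xₙ]`. The variable with (1-based) number `i` is `X j` with
`j : Fin n`, `i = j + 1`. -/
abbrev PolyR (n : ℕ) : Type := MvPolynomial (Fin n) ℤ

/-- I-states: the subsets of `{0,…,n}` with `k` elements. -/
abbrev IState (n k : ℕ) : Type := {x : Finset (Fin (n + 1)) // x.card = k}

/-- Left I-states: the subsets of `{0,…,n-1}` with `k` elements. The same type serves as the set
`D_{n,k}` of `∧∨`-sequences of length `n` with `k` symbols `∧`: the left I-state `x` is the sequence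
with symbols `∧` in the (1-based) positions `a + 1`, `a ∈ x`, that is, in the 0-based positions
`a ∈ x`. -/
abbrev LState (n k : ℕ) : Type := {x : Finset (Fin n) // x.card = k}

/-- A left I-state, seen as an I-state. -/
def toI {n k : ℕ} (x : LState n k) : IState n k :=
  ⟨x.1.map Fin.castSuccEmb, by rw [Finset.card_map, x.2]⟩

theorem toI_injective {n k : ℕ} : Function.Injective (toI : LState n k → IState n k) := by
  intro x y h
  exact Subtype.ext (Finset.map_injective _ (congrArg Subtype.val h))

/-- `v_i^x = |x ∩ {i, i+1, …, n}|` for `i = j + 1`. -/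
def wt {n k : ℕ} (x : IState n k) (j : Fin n) : ℕ :=
  (x.1.filter (fun a : Fin (n + 1) => (j : ℕ) + 1 ≤ (a : ℕ))).card

/-- `2 w_i^{x,y} = |v_i^x - v_i^y|`. -/
def wtDist {n k : ℕ} (x y : IState n k) (j : Fin n) : ℕ :=
  ((wt x j : ℤ) - (wt y j : ℤ)).natAbs

/-- `g_i^{x,y,z} = w_i^{y,z} - w_i^{x,z} + w_i^{x,y}`. By the triangle inequality and for parity
reasons neither the subtraction nor the division is ever truncated. -/
def gExp {n k : ℕ} (x y z : IState n k) (j : Fin n) : ℕ :=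
  (wtDist y z j + wtDist x y j - wtDist x z j) / 2

/-! ### The algebras `B₀(n,k)`, `B(n,k)` and `B_l(n,k)` over `ℤ` -/

/-- The defining relations of `B₀(n,k)` as a quotient of the free `ℤ[U]`-algebra on the symbols
`f_{x,y}`. The first, third and fourth say that the `f_{x,y}` are arrows of a quiver (arrows that do
not meet have product zero) with `f_{x,x}` the trivial path at `x`; the second is the relation
`f_{x,y} f_{y,z} = ∏ U_i^{g_i} f_{x,z}`. -/
inductive B0Rel (n k : ℕ) : FreeAlgebra (PolyR n) (IState n k × IState n k) →
    FreeAlgebra (PolyR n) (IState n k × IState n k) → Prop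
  | ortho (x y z w : IState n k) (h : y ≠ z) :
      B0Rel n k (FreeAlgebra.ι (PolyR n) (x, y) * FreeAlgebra.ι (PolyR n) (z, w)) 0
  | mul (x y z : IState n k) :
      B0Rel n k (FreeAlgebra.ι (PolyR n) (x, y) * FreeAlgebra.ι (PolyR n) (y, z))
        ((∏ j : Fin n, (MvPolynomial.X j : PolyR n) ^ gExp x y z j) •
          FreeAlgebra.ι (PolyR n) (x, z))
  | one : B0Rel n k 1 (∑ x : IState n k, FreeAlgebra.ι (PolyR n) (x, x))

/-- The algebra `B₀(n,k)`. -/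
def B0 (n k : ℕ) : Type := (ringConGen (B0Rel n k)).Quotient

instance (n k : ℕ) : Ring (B0 n k) := inferInstanceAs (Ring (ringConGen (B0Rel n k)).Quotient)

instance (n k : ℕ) : Algebra (PolyR n) (B0 n k) :=
  inferInstanceAs (Algebra (PolyR n) (ringConGen (B0Rel n k)).Quotient)

/-- The quotient map onto `B₀(n,k)`. -/
def B0.mk (n k : ℕ) : FreeAlgebra (PolyR n) (IState n k × IState n k) →ₐ[PolyR n] B0 n k :=
  RingCon.mkₐ (PolyR n) (ringConGen (B0Rel n k))

theorem B0.mk_rel {n k : ℕ} {a b : FreeAlgebra (PolyR n) (IState n k × IState n k)}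
    (h : B0Rel n k a b) : B0.mk n k a = B0.mk n k b :=
  (RingCon.eq _).mpr (RingConGen.Rel.of _ _ h)

/-- The arrow `f_{x,y}` in `B₀(n,k)`. -/
def f0 {n k : ℕ} (x y : IState n k) : B0 n k :=
  B0.mk n k (FreeAlgebra.ι (PolyR n) (x, y))

/-- `x ∩ {i-1,i} = {i-1}` and `y = x \ {i-1} ∪ {i}`, where `i = j + 1`. -/
def IsStep {n k : ℕ} (j : Fin n) (x y : IState n k) : Prop :=
  j.castSucc ∈ x.1 ∧ j.succ ∉ x.1 ∧ y.1 = insert j.succ (x.1.erase j.castSucc)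

open Classical in
/-- `R_i`, the sum of the `f_{x,y}` with `x ∩ {i-1,i} = {i-1}` and `y = x \ {i-1} ∪ {i}`. -/
def Rgen {n k : ℕ} (j : Fin n) : B0 n k :=
  ∑ x : IState n k, ∑ y : IState n k, if IsStep j x y then f0 x y else 0

open Classical in
/-- `L_i`, the sum of the `f_{x,y}` with `x ∩ {i-1,i} = {i}` and `y = x \ {i} ∪ {i-1}`; equivalently
`x` arises from `y` by a step as in `R_i`. -/
def Lgen {n k : ℕ} (j : Fin n) : B0 n k :=
  ∑ x : IState n k, ∑ y : IState n k, if IsStep j y x then f0 x y else 0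

/-- The relations that cut out `B(n,k)` from `B₀(n,k)`: `R_{i-1} R_i = 0`, `L_i L_{i-1} = 0`, and
`U_i I_x = 0` when `x ∩ {i-1,i} = ∅`. -/
inductive BRel (n k : ℕ) : B0 n k → B0 n k → Prop
  | RR (i j : Fin n) (h : (i : ℕ) + 1 = j) : BRel n k (Rgen i * Rgen j) 0
  | LL (i j : Fin n) (h : (i : ℕ) + 1 = j) : BRel n k (Lgen j * Lgen i) 0
  | U (j : Fin n) (x : IState n k) (h₁ : j.castSucc ∉ x.1) (h₂ : j.succ ∉ x.1) :
      BRel n k ((MvPolynomial.X j : PolyR n) • f0 x x) 0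

/-- The algebra `B(n,k)`. -/
def BFull (n k : ℕ) : Type := (ringConGen (BRel n k)).Quotient

instance (n k : ℕ) : Ring (BFull n k) := inferInstanceAs (Ring (ringConGen (BRel n k)).Quotient)

instance (n k : ℕ) : Algebra (PolyR n) (BFull n k) :=
  inferInstanceAs (Algebra (PolyR n) (ringConGen (BRel n k)).Quotient)

/-- The quotient map from `B₀(n,k)` onto `B(n,k)`. -/
def BFull.mk (n k : ℕ) : B0 n k →ₐ[PolyR n] BFull n k := RingCon.mkₐ (PolyR n) (ringConGen (BRel n k))

/-- The element `f_{x,y}` of `B(n,k)`. -/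
def f {n k : ℕ} (x y : IState n k) : BFull n k :=
  BFull.mk n k (f0 x y)

theorem f_mul_of_ne {n k : ℕ} (x y z w : IState n k) (h : y ≠ z) : f x y * f z w = 0 := by
  have h0 : f0 x y * f0 z w = 0 := by
    simp only [f0, ← map_mul]
    rw [B0.mk_rel (B0Rel.ortho x y z w h), map_zero]
  simp only [f, ← map_mul, h0, map_zero]

theorem f_mul {n k : ℕ} (x y z : IState n k) : f x y * f y z =
    (∏ j : Fin n, (MvPolynomial.X j : PolyR n) ^ gExp x y z j) • f x z := by
  have h0 : f0 x y * f0 y z =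
      (∏ j : Fin n, (MvPolynomial.X j : PolyR n) ^ gExp x y z j) • f0 x z := by
    simp only [f0, ← map_mul]
    rw [B0.mk_rel (B0Rel.mul x y z), map_smul]
  simp only [f, ← map_mul, h0, map_smul]

theorem f_left {n k : ℕ} (x y : IState n k) : f x x * f x y = f x y := by
  rw [f_mul, Finset.prod_eq_one, one_smul]
  intro j _
  simp [gExp, wtDist]

theorem f_right {n k : ℕ} (x y : IState n k) : f x y * f y y = f x y := by
  rw [f_mul, Finset.prod_eq_one, one_smul]
  intro j _
  simp [gExp, wtDist]

/-- The sum of the idempotents `I_x = f_{x,x}` over the left I-states `x`. -/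
def eLeft (n k : ℕ) : BFull n k := ∑ x : LState n k, f (toI x) (toI x)

theorem eLeft_mul {n k : ℕ} (x : LState n k) (y : IState n k) :
    eLeft n k * f (toI x) y = f (toI x) y := by
  rw [eLeft, Finset.sum_mul, Finset.sum_eq_single x, f_left]
  · intro z _ hz
    exact f_mul_of_ne _ _ _ _ fun h => hz (toI_injective h)
  · intro h
    exact absurd (Finset.mem_univ x) h

theorem mul_eLeft {n k : ℕ} (x : IState n k) (y : LState n k) :
    f x (toI y) * eLeft n k = f x (toI y) := by
  rw [eLeft, Finset.mul_sum, Finset.sum_eq_single y, f_right]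
  · intro z _ hz
    exact f_mul_of_ne _ _ _ _ fun h => hz (toI_injective h).symm
  · intro h
    exact absurd (Finset.mem_univ y) h

theorem eLeft_idem (n k : ℕ) : IsIdempotentElem (eLeft n k) := by
  change eLeft n k * eLeft n k = eLeft n k
  conv_lhs => rw [eLeft, Finset.sum_mul]
  rw [eLeft]
  exact Finset.sum_congr rfl fun x _ => mul_eLeft _ x

/-- `B_l(n,k) = e B(n,k) e` where `e` is the sum of the `I_x` over left I-states `x`. -/
def BlZ (n k : ℕ) : Type := (eLeft_idem n k).Corner

instance (n k : ℕ) : Ring (BlZ n k) := inferInstanceAs (Ring (eLeft_idem n k).Corner)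

/-- The element `p · f_{x,y}` of `B_l(n,k)`, for `p ∈ ℤ[U₁,…,Uₙ]` and left I-states `x`, `y`. -/
def fl {n k : ℕ} (p : PolyR n) (x y : LState n k) : BlZ n k :=
  ⟨p • f (toI x) (toI y), (Subsemigroup.mem_corner_iff (eLeft_idem n k)).mpr
    ⟨by rw [mul_smul_comm, eLeft_mul], by rw [smul_mul_assoc, mul_eLeft]⟩⟩

/-- The component of degree `d` of `B_l(n,k)`: the `U_i` have degree `2`, and `f_{x,y}` has degree
`2 ∑ w_i^{x,y}` (so `R_i` and `L_i` have degree `1`). -/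
def blZGr (n k : ℕ) (d : ℤ) : AddSubgroup (BlZ n k) :=
  AddSubgroup.closure {b | ∃ (x y : LState n k) (p : PolyR n) (m : ℕ), p.IsHomogeneous m ∧
    2 * (m : ℤ) + ∑ j : Fin n, (wtDist (toI x) (toI y) j : ℤ) = d ∧ b = fl p x y}

/-! ### Sartori's algebra over `ℤ` -/

/-- `b_i^μ`: one plus the number of symbols `∧` of `μ` strictly to the right of position `i`. -/
def bSeq {n k : ℕ} (μ : LState n k) (i : Fin n) : ℕ := 1 + (μ.1.filter (fun a => i < a)).card

/-- `h_d(x_1,…,x_i)`, the complete homogeneous symmetric polynomial in the first variables up to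
and including the one with index `i`. -/
def hPoly {n : ℕ} (i : Fin n) (d : ℕ) : PolyR n :=
  MvPolynomial.rename (Fin.castLE (Nat.succ_le_of_lt i.isLt))
    (MvPolynomial.hsymm (Fin ((i : ℕ) + 1)) ℤ d)

/-- The ideal `I_b` for `b = b^μ`. -/
def sIdeal {n k : ℕ} (μ : LState n k) : Ideal (PolyR n) :=
  Ideal.span (Set.range fun i : Fin n => hPoly i (bSeq μ i))

/-- `R_b = R / I_b` for `b = b^μ`. -/
abbrev SMod {n k : ℕ} (μ : LState n k) : Type := PolyR n ⧸ sIdeal μ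

/-- The position of the `j`-th symbol `∨` of `μ` (everything counted from `0`). -/
def vee {n k : ℕ} (μ : LState n k) (j : Fin (n - k)) : Fin n :=
  (μ.1)ᶜ.orderEmbOfFin (by rw [Finset.card_compl, μ.2, Fintype.card_fin]) j

/-- Two `∧∨`-sequences are too far if `∨_j^μ ≥ ∨_{j+1}^l` or `∨_j^l ≥ ∨_{j+1}^μ` for some `j`. -/
def TooFar {n k : ℕ} (l μ : LState n k) : Prop :=
  ∃ j j' : Fin (n - k), (j : ℕ) + 1 = j' ∧ (vee l j' ≤ vee μ j ∨ vee μ j' ≤ vee l j)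

/-- The monomial `x_1^{c_1} ⋯ x_n^{c_n}`, `c_i = max (b_i^μ - b_i^l, 0)` (truncated subtraction). -/
def cMono {n k : ℕ} (l μ : LState n k) : PolyR n :=
  ∏ i : Fin n, (MvPolynomial.X i : PolyR n) ^ (bSeq μ i - bSeq l i)

open Classical in
/-- The monomial `x_{α(j)} x_{α(j)+1} ⋯ x_{β(j)}`, where `α(j) = max (∨_j^l, ∨_j^μ)`, and
`β(j) = min (∨_{j+1}^μ, ∨_{j+1}^l) - 1`, or the last index if there is no `j + 1`. -/
def intervalMono {n k : ℕ} (l μ : LState n k) (j : Fin (n - k)) : PolyR n :=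
  ∏ i ∈ Finset.univ.filter (fun i : Fin n => max (vee l j) (vee μ j) ≤ i ∧
    ∀ j' : Fin (n - k), (j : ℕ) + 1 = j' → i < min (vee μ j') (vee l j')),
      (MvPolynomial.X i : PolyR n)

open Classical in
/-- The submodule `W_{l,μ}` of `Hom_R(R_{b^l}, R_{b^μ})`: everything if `l` and `μ` are too far, and
otherwise generated by the maps `1 ↦ (x_{α(j)} ⋯ x_{β(j)}) (x_1^{c_1} ⋯ x_n^{c_n})`. -/
def Wsub {n k : ℕ} (l μ : LState n k) : Submodule (PolyR n) (SMod l →ₗ[PolyR n] SMod μ) :=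
  if TooFar l μ then ⊤
  else Submodule.span (PolyR n) {φ | ∃ j : Fin (n - k),
    φ 1 = Ideal.Quotient.mk (sIdeal μ) (intervalMono l μ j * cMono l μ)}

/-- `⨁_{l,μ} Hom_R(R_{b^l}, R_{b^μ})` as a ring: the endomorphisms of the (finite) sum of the
`R_{b^μ}`, with composition as product. -/
abbrev SEnd (n k : ℕ) : Type := Module.End (PolyR n) ((μ : LState n k) → SMod μ)

/-- The element of `SEnd n k` given by a map `R_{b^l} → R_{b^μ}`. -/
def sHom {n k : ℕ} (l μ : LState n k) (φ : SMod l →ₗ[PolyR n] SMod μ) : SEnd n k :=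
  LinearMap.single (PolyR n) (fun ν : LState n k => SMod ν) μ ∘ₗ φ ∘ₗ LinearMap.proj l

/-- The two-sided ideal `⨁ W_{l,μ}` of `⨁ Hom_R(R_{b^l}, R_{b^μ})`. (The `W_{l,μ}` are stable under
composition with arbitrary maps, so the sum is an ideal; it is presented here as the ideal that the
`W_{l,μ}` generate.) -/
def WIdeal (n k : ℕ) : TwoSidedIdeal (SEnd n k) :=
  TwoSidedIdeal.span {S | ∃ (l μ : LState n k), ∃ φ ∈ Wsub l μ, S = sHom l μ φ}

/-- The algebra `A_{n,k}` over `ℤ`, the quotient of `⨁ Hom_R(R_{b^l}, R_{b^μ})` by `⨁ W_{l,μ}`. -/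
def AZ (n k : ℕ) : Type := (WIdeal n k).ringCon.Quotient

instance (n k : ℕ) : Ring (AZ n k) := inferInstanceAs (Ring (WIdeal n k).ringCon.Quotient)

instance (n k : ℕ) : Algebra (PolyR n) (AZ n k) :=
  inferInstanceAs (Algebra (PolyR n) (WIdeal n k).ringCon.Quotient)

/-- The quotient map onto `A_{n,k}`. -/
def AZ.mk (n k : ℕ) : SEnd n k →ₐ[PolyR n] AZ n k := RingCon.mkₐ (PolyR n) (WIdeal n k).ringCon

/-- The class in `A_{n,k}` of a map `R_{b^l} → R_{b^μ}`. -/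
def aCls {n k : ℕ} (l μ : LState n k) (φ : SMod l →ₗ[PolyR n] SMod μ) : AZ n k :=
  AZ.mk n k (sHom l μ φ)

/-- The component of degree `d` of `A_{n,k}`. The `x_i` have degree `2`; the generator `1` of
`R_{b^μ}` is placed in degree `-∑ b_i^μ`, so that the map `1 ↦ p` from `R_{b^l}` to `R_{b^μ}` has degree
`2 deg p + ∑ b_i^l - ∑ b_i^μ`, and `1 ↦ x_1^{c_1} ⋯ x_n^{c_n}` has degree `∑ |b_i^l - b_i^μ|`. -/
def aZGr (n k : ℕ) (d : ℤ) : AddSubgroup (AZ n k) :=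
  AddSubgroup.closure {a | ∃ (l μ : LState n k) (φ : SMod l →ₗ[PolyR n] SMod μ) (p : PolyR n)
    (m : ℕ), p.IsHomogeneous m ∧ φ 1 = Ideal.Quotient.mk (sIdeal μ) p ∧
    2 * (m : ℤ) + ∑ i : Fin n, ((bSeq l i : ℤ) - (bSeq μ i : ℤ)) = d ∧ a = aCls l μ φ}

/-! ### The homomorphism `Ξ` -/

/-- `Ξ : B_l(n,k) → A_{n,k}` is the `ℤ[U₁,…,Uₙ]`-linear ring homomorphism that sends `f_{x,y}` to zero
if `x` and `y` are too far and to (the class of) the map `R_{b^y} → R_{b^x}`,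
`1 ↦ x_1^{c_1} ⋯ x_n^{c_n}`, otherwise; here `U_i` acts on `A_{n,k}` as `x_i`. As the elements
`p · f_{x,y}` span `B_l(n,k)`, these values determine `Ξ`. -/
def IsXi {n k : ℕ} (Ξ : BlZ n k →+* AZ n k) : Prop :=
  ∀ (p : PolyR n) (x y : LState n k),
    (TooFar y x → Ξ (fl p x y) = 0) ∧
    (¬ TooFar y x → ∃ φ : SMod y →ₗ[PolyR n] SMod x,
      φ 1 = Ideal.Quotient.mk (sIdeal x) (cMono y x) ∧ Ξ (fl p x y) = p • aCls y x φ)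

/-! ### Graded modules, graded projectives, Grothendieck groups -/

universe u

/-- A left `A`-module with a family of additive subgroups indexed by the integers (the candidates
for its homogeneous components). -/
structure GrMod (A : Type u) [Ring A] where
  carrier : Type u
  [grp : AddCommGroup carrier]
  [mod : Module A carrier]
  deg : ℤ → AddSubgroup carrier

attribute [instance] GrMod.grp GrMod.mod

variable {A : Type u} [Ring A]

/-- `M` is a finitely generated projective graded left module over the ring `A` with homogeneous
components `𝒜 d`. -/
structure GrMod.IsProj (𝒜 : ℤ → AddSubgroup A) (M : GrMod A) : Prop where
  internal : DirectSum.IsInternal M.deg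
  smul_mem : ∀ (i j : ℤ) (a : A) (m : M.carrier), a ∈ 𝒜 i → m ∈ M.deg j → a • m ∈ M.deg (i + j)
  finite : Module.Finite A M.carrier
  projective : Module.Projective A M.carrier

/-- `q^i M`: the module `M` with degrees shifted upwards by `i`. -/
def GrMod.shift (i : ℤ) (M : GrMod A) : GrMod A where
  carrier := M.carrier
  deg d := M.deg (d - i)

theorem isInternal_reindex {M : Type*} [AddCommGroup M] (D : ℤ → AddSubgroup M)
    (h : DirectSum.IsInternal D) (e : ℤ ≃ ℤ) :
    DirectSum.IsInternal fun d => D (e.symm d) := by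
  have key : ∀ x : DirectSum ℤ fun d => D d,
      DirectSum.coeAddMonoidHom (fun d => D (e.symm d))
        (DirectSum.equivCongrLeft (β := fun d => D d) e x) = DirectSum.coeAddMonoidHom D x := by
    intro x
    induction x using DirectSum.induction_on with
    | zero => simp
    | of d y =>
      obtain ⟨d, rfl⟩ := e.symm.surjective d
      rw [DirectSum.equivCongrLeft_of]
      exact (DirectSum.coeAddMonoidHom_of (fun d => D (e.symm d)) d y).trans
        (DirectSum.coeAddMonoidHom_of D (e.symm d) y).symm
    | add x y hx hy => simp only [map_add, hx, hy]
  refine (Function.Bijective.of_comp_iff _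
    (DirectSum.equivCongrLeft (β := fun d => D d) e).bijective).mp ?_
  have : (DirectSum.coeAddMonoidHom (fun d => D (e.symm d)) : _ → M) ∘
      (DirectSum.equivCongrLeft (β := fun d => D d) e) = DirectSum.coeAddMonoidHom D := funext key
  rw [this]
  exact h

theorem GrMod.IsProj.shift {𝒜 : ℤ → AddSubgroup A} {M : GrMod A} (h : M.IsProj 𝒜) (i : ℤ) :
    (M.shift i).IsProj 𝒜 where
  internal := isInternal_reindex M.deg h.internal (Equiv.subRight i).symm
  smul_mem a b r m hr hm := by
    have := h.smul_mem a (b - i) r m hr hm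
    change r • m ∈ M.deg (a + b - i)
    rwa [add_sub_assoc]
  finite := h.finite
  projective := h.projective

/-- The objects of the category of finitely generated projective graded left modules. -/
abbrev GrProj (𝒜 : ℤ → AddSubgroup A) : Type (u + 1) := {M : GrMod A // M.IsProj 𝒜}

/-- There is an exact sequence `0 → M' → M → M'' → 0` of graded modules and maps of degree zero. -/
def ShortExact (M' M M'' : GrMod A) : Prop :=
  ∃ (ι : M'.carrier →ₗ[A] M.carrier) (π : M.carrier →ₗ[A] M''.carrier),
    (∀ d, ∀ m ∈ M'.deg d, ι m ∈ M.deg d) ∧ (∀ d, ∀ m ∈ M.deg d, π m ∈ M''.deg d) ∧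
    Function.Injective ι ∧ Function.Exact ι π ∧ Function.Surjective π

/-- The relations of the Grothendieck group: `[M] = [M'] + [M'']` for short exact sequences, and
`[q^i M] = q^i [M]`. -/
def K0Rels (𝒜 : ℤ → AddSubgroup A) : Set (GrProj 𝒜 →₀ ℤ[T;T⁻¹]) :=
  {r | ∃ M' M M'' : GrProj 𝒜, ShortExact M'.1 M.1 M''.1 ∧
    r = Finsupp.single M 1 - Finsupp.single M' 1 - Finsupp.single M'' 1} ∪
  {r | ∃ (i : ℤ) (M : GrProj 𝒜), r = Finsupp.single ⟨M.1.shift i, M.2.shift i⟩ 1 -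
    Finsupp.single M (LaurentPolynomial.T i)}

/-- The Grothendieck group `K₀` of finitely generated projective graded left modules, as a
`ℤ[q,q⁻¹]`-module with `q^i [M] = [q^i M]`: generators are the objects, relations as above. -/
abbrev K0 (𝒜 : ℤ → AddSubgroup A) : Type (u + 1) :=
  (GrProj 𝒜 →₀ ℤ[T;T⁻¹]) ⧸ Submodule.span ℤ[T;T⁻¹] (K0Rels 𝒜)

/-- The class `[M]` in `K₀`. -/
def K0.cls {𝒜 : ℤ → AddSubgroup A} (M : GrProj 𝒜) : K0 𝒜 :=
  Submodule.Quotient.mk (Finsupp.single M 1)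

/-- The graded left module `A e`. -/
def leftIdealMod (𝒜 : ℤ → AddSubgroup A) (e : A) : GrMod A where
  carrier := (Ideal.span {e} : Ideal A)
  deg d := (𝒜 d).comap (Ideal.span {e} : Ideal A).subtype.toAddMonoidHom

/-- The submodule of `A ⊗_ℤ M` whose quotient is `A ⊗_B M`, where `A` is a right `B`-module through
the ring homomorphism `g : B → A`. -/
def balanced {B : Type u} [Ring B] (g : B →+* A) (M : GrMod B) :
    Submodule A (A ⊗[ℤ] M.carrier) :=
  Submodule.span A {t | ∃ (a : A) (b : B) (m : M.carrier), t = (a * g b) ⊗ₜ m - a ⊗ₜ (b • m)}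

/-- `A ⊗_B M` with its grading: its part of degree `d` is spanned by the classes of the `a ⊗ m`, where
`a` and `m` are homogeneous and their degrees add up to `d`. -/
def induced {B : Type u} [Ring B] (𝒜 : ℤ → AddSubgroup A) (g : B →+* A) (M : GrMod B) :
    GrMod A where
  carrier := (A ⊗[ℤ] M.carrier) ⧸ balanced g M
  deg d := AddSubgroup.closure {t | ∃ (i j : ℤ) (a : A) (m : M.carrier), i + j = d ∧ a ∈ 𝒜 i ∧
    m ∈ M.deg j ∧ t = Submodule.Quotient.mk (a ⊗ₜ[ℤ] m)}

/-! ### Base change to a field -/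

/-- The grading of `𝕜 ⊗_ℤ A₀` that comes from a grading of the ring `A₀`. -/
def baseGr (𝕜 : Type u) [Field 𝕜] {A₀ : Type} [Ring A₀] (𝒜 : ℤ → AddSubgroup A₀) (d : ℤ) :
    AddSubgroup (𝕜 ⊗[ℤ] A₀) :=
  AddSubgroup.closure {t | ∃ (c : 𝕜) (a : A₀), a ∈ 𝒜 d ∧ t = c ⊗ₜ a}

/-- `B_l(n,k) ⊗ 𝕜`. -/
abbrev Bl (𝕜 : Type u) [Field 𝕜] (n k : ℕ) : Type u := 𝕜 ⊗[ℤ] BlZ n k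

/-- `A_{n,k} ⊗ 𝕜`. -/
abbrev Sar (𝕜 : Type u) [Field 𝕜] (n k : ℕ) : Type u := 𝕜 ⊗[ℤ] AZ n k

/-- The grading of `B_l(n,k) ⊗ 𝕜`. -/
abbrev blGr (𝕜 : Type u) [Field 𝕜] (n k : ℕ) : ℤ → AddSubgroup (Bl 𝕜 n k) :=
  baseGr 𝕜 (blZGr n k)

/-- The grading of `A_{n,k} ⊗ 𝕜`. -/
abbrev sarGr (𝕜 : Type u) [Field 𝕜] (n k : ℕ) : ℤ → AddSubgroup (Sar 𝕜 n k) :=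
  baseGr 𝕜 (aZGr n k)

/-- The projective module `P(x)` over `B_l(n,k) ⊗ 𝕜` generated by the idempotent `I_x`. -/
def PB (𝕜 : Type u) [Field 𝕜] {n k : ℕ} (x : LState n k) : GrMod (Bl 𝕜 n k) :=
  leftIdealMod (blGr 𝕜 n k) (1 ⊗ₜ fl 1 x x)

/-- The projective module `P(l)` over `A_{n,k} ⊗ 𝕜` generated by the idempotent `1_l`. -/
def PA (𝕜 : Type u) [Field 𝕜] {n k : ℕ} (l : LState n k) : GrMod (Sar 𝕜 n k) :=
  leftIdealMod (sarGr 𝕜 n k) (1 ⊗ₜ aCls l l LinearMap.id)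

/-- The extension of scalars of `Ξ` to `𝕜`. -/
def xiBase (𝕜 : Type u) [Field 𝕜] {n k : ℕ} (Ξ : BlZ n k →+* AZ n k) : Bl 𝕜 n k →+* Sar 𝕜 n k :=
  (Algebra.TensorProduct.map (AlgHom.id ℤ 𝕜) Ξ.toIntAlgHom).toRingHom

/-- The projection `pr(P) = A_{n,k} ⊗_{B_l(n,k)} P` (over `𝕜`), with its grading. -/
def pr (𝕜 : Type u) [Field 𝕜] {n k : ℕ} (Ξ : BlZ n k →+* AZ n k) (P : GrMod (Bl 𝕜 n k)) :
    GrMod (Sar 𝕜 n k) :=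
  induced (sarGr 𝕜 n k) (xiBase 𝕜 Ξ) P

/-! ### The weight spaces of `V^{⊗n}` and the canonical basis -/

/-- The field `ℂ(q)`. -/
abbrev Cq : Type := RatFunc ℂ

/-- `ℂ(q)` as an algebra over `ℤ[q,q⁻¹]`, with `q ↦ q`. -/
instance : Algebra ℤ[T;T⁻¹] Cq :=
  (LaurentPolynomial.eval₂ (Int.castRingHom Cq)
    (Units.mk0 (RatFunc.X : Cq) RatFunc.X_ne_zero)).toAlgebra

/-- The vector representation `V` with its basis `v₀`, `v₁`. -/
abbrev VRep : Type := Fin 2 → Cq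

/-- The basis vector `v_i` of `V`. -/
def vBasis (i : Fin 2) : VRep := Pi.single i 1

/-- The action of `K₁` (for `i = 0`) and of `K₂` (for `i = 1`) on `V`: since `v₀` has weight `ε₁` and
`v₁` has weight `ε₂`, `K₁ v₀ = q v₀`, `K₁ v₁ = v₁`, `K₂ v₀ = v₀`, `K₂ v₁ = q v₁`. -/
def Kact (i : Fin 2) : VRep →ₗ[Cq] VRep :=
  LinearMap.pi fun j => (if j = i then (RatFunc.X : Cq) else 1) • LinearMap.proj j

/-- `V^{⊗n}`. -/
abbrev VTensor (n : ℕ) : Type := PiTensorProduct Cq (fun _ : Fin n => VRep)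

/-- The action of `K₁`, `K₂` on `V^{⊗n}`; they are group-like. -/
def KactTensor (n : ℕ) (i : Fin 2) : VTensor n →ₗ[Cq] VTensor n :=
  PiTensorProduct.map fun _ => Kact i

/-- `(V^{⊗n})_k`, the space of vectors of weight `k ε₁ + (n - k) ε₂`. -/
def weightSpace (n k : ℕ) : Submodule Cq (VTensor n) where
  carrier := {v | KactTensor n 0 v = (RatFunc.X : Cq) ^ k • v ∧
    KactTensor n 1 v = (RatFunc.X : Cq) ^ ((n : ℤ) - (k : ℤ)) • v}
  add_mem' := by
    rintro v w ⟨h₁, h₂⟩ ⟨h₃, h₄⟩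
    exact ⟨by rw [map_add, h₁, h₃, smul_add], by rw [map_add, h₂, h₄, smul_add]⟩
  zero_mem' := ⟨by rw [map_zero, smul_zero], by rw [map_zero, smul_zero]⟩
  smul_mem' := by
    rintro c v ⟨h₁, h₂⟩
    exact ⟨by rw [map_smul, h₁, smul_comm], by rw [map_smul, h₂, smul_comm]⟩

/-- The standard basis vector of `V^{⊗n}` with `v₀` in the positions in `s` and `v₁` in the others. -/
def stdVec {n : ℕ} (s : Finset (Fin n)) : VTensor n :=
  PiTensorProduct.tprod Cq fun i => if i ∈ s then vBasis 0 else vBasis 1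

open Classical in
/-- The wedge product of the `e_{g i}`, `i ∈ s`, without signs: zero if an index is repeated. -/
def wedge {n : ℕ} (s : Finset (Fin n)) (g : Fin n → Fin n) : VTensor n :=
  if Set.InjOn g s then stdVec (s.image g) else 0

/-- The canonical basis element of the `∧∨`-sequence `x` with symbols `∧` in positions
`i_1 < ⋯ < i_k`: the product `ℓ_{i_k} ∧ ⋯ ∧ ℓ_{i_1}`, where `ℓ_i = e_i + q e_{i-1}`, and `ℓ_i = e_i` for the
first position `i`. It is expanded over the set `t` of the factors in which the second summand is
chosen. -/
def canon {n k : ℕ} (x : LState n k) : VTensor n :=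
  ∑ t ∈ (x.1.filter (fun i : Fin n => 0 < (i : ℕ))).powerset, (RatFunc.X : Cq) ^ t.card •
    wedge x.1 (fun i => if i ∈ t then ⟨(i : ℕ) - 1, (Nat.sub_le _ _).trans_lt i.isLt⟩ else i)

end

end OSzSar

open OSzSar

namespace OSzSar

noncomputable section

/-! Why it is true. After base change to the field, both algebras are nonnegatively graded, and
their part of degree zero is a product of copies of the field whose idempotents are indexed by the
same set of left states (`IsBasicGr`). Over such an algebra `C` the graded Nakayama lemma shows that
a finitely generated projective graded module is a finite sum of shifts of the modules `C e_l`
(`projective_graded_classification`). The number of summands of a given label and shift is the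
dimension of a space of functionals on which `C` acts through a character, and this dimension is
additive on short exact sequences (`finrank_charHom_add`). Hence `K₀` is free over `ℤ[q,q⁻¹]` on the
classes `[C e_l]` (`K0.basis`). A degree-preserving ring homomorphism that matches the idempotents
turns `B e_l` into `A e_l` under induction (`induced_iso`), so it carries basis to basis.

What remains is to see that both algebras have this form and that `Ξ` exists. Both are rings spanned
by multiples of arrows that multiply by one cocycle of monomials (`ArrowFamily`). For `A_{n,k}` this
rests on the fact that `Hom(R_λ, R_μ)` is cyclic, generated by `1 ↦ x^c` (`exists_smul_cHom`). That
is a computation of colon ideals (`hIdeal_colon`): the generators of `I_b` form a triangular system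
of monic polynomials, so the quotients are free over `ℤ` of known rank, and comparing ranks shows
that multiplication by `x_i` or by `h_{b_i}` has no unexpected kernel. For `B₀(n,k)` a matrix
representation shows that the arrows are linearly independent (`b0Coef_b0Arrow`). All further
relations of the two algebras are generated by homogeneous ones, so the gradings survive in the
quotients.

`Ξ` is compatible with the relations of `B(n,k)` because each of them factors through a state with
two adjacent holes. A path through such a state picks up a monomial divisible by one of the interval
monomials that generate `W` (`exists_intervalMono_dvd`). The interval monomials on the diagonal have
positive degree, so evaluation at `x = 0` on diagonal entries gives a character of `A_{n,k}` for
each state. Pulled back along `Ξ`, these show that the idempotents of `B_l(n,k)` also stay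
independent.

Finally, the canonical elements are unitriangular in the standard basis of the weight space
(`stdVec_mem_span_canon`), so they form a basis indexed by the same set. The maps `α`, `β` and `Φ`
all match bases, hence they are compatible. -/

/-! ### Internal gradings of abelian groups -/

section Gradings

variable {M : Type*} [AddCommGroup M] {D : ℤ → AddSubgroup M}

/-- A family of subgroups that generates is an internal grading if its members can be separated by
additive maps. -/
theorem isInternal_of_separating (hD : ⨆ d, D d = ⊤) {N : ℤ → Type*} [∀ d, AddCommGroup (N d)]
    (π : ∀ d, M →+ N d) (h0 : ∀ d j, j ≠ d → ∀ m ∈ D j, π d m = 0)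
    (hinj : ∀ d, ∀ m ∈ D d, π d m = 0 → m = 0) : DirectSum.IsInternal D := by
  constructor
  · rw [injective_iff_map_eq_zero]
    intro x hx
    have key : ∀ d (y : DirectSum ℤ fun d => D d),
        π d (DirectSum.coeAddMonoidHom D y) = π d (y d) := by
      intro d y
      induction y using DirectSum.induction_on with
      | zero => simp
      | of j y =>
        rw [DirectSum.coeAddMonoidHom_of]
        by_cases hj : j = d
        · subst hj; rw [DirectSum.of_eq_same]
        · rw [h0 d j hj y y.2, DirectSum.of_eq_of_ne _ _ _ (Ne.symm hj)]; simp
      | add x y hx hy => simp only [map_add, hx, hy, DirectSum.add_apply, AddSubgroup.coe_add]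
    ext d
    have := key d x
    rw [hx, map_zero] at this
    simpa using hinj d _ (x d).2 this.symm
  · rw [← AddMonoidHom.range_eq_top, eq_top_iff, ← hD, iSup_le_iff]
    intro d m hm
    exact ⟨DirectSum.of (fun d => D d) d ⟨m, hm⟩, DirectSum.coeAddMonoidHom_of D d ⟨m, hm⟩⟩

/-- The projection to the component of degree `d`. -/
def gproj (h : DirectSum.IsInternal D) (d : ℤ) : M →+ M :=
  (D d).subtype.comp ((DFinsupp.evalAddMonoidHom d).comp
    (AddEquiv.ofBijective (DirectSum.coeAddMonoidHom D) h).symm.toAddMonoidHom)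

variable (h : DirectSum.IsInternal D)

include h in
theorem iSup_of_isInternal : ⨆ d, D d = ⊤ := by
  rw [eq_top_iff]
  intro m _
  obtain ⟨x, rfl⟩ := h.2 m
  induction x using DirectSum.induction_on with
  | zero => simp
  | of j y =>
    rw [DirectSum.coeAddMonoidHom_of]
    exact (le_iSup D j) y.2
  | add x y hx hy => rw [map_add]; exact add_mem (hx trivial) (hy trivial)

include h in
@[elab_as_elim]
theorem isInternal_induction {p : M → Prop} (m : M) (h0 : p 0) (hadd : ∀ x y, p x → p y → p (x + y))
    (hom : ∀ d, ∀ m ∈ D d, p m) : p m := by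
  have : m ∈ ⨆ d, D d := by rw [iSup_of_isInternal h]; trivial
  exact AddSubgroup.iSup_induction D (C := p) this hom h0 hadd

theorem gproj_mem (d : ℤ) (m : M) : gproj h d m ∈ D d := SetLike.coe_mem _

theorem gproj_coe (x : DirectSum ℤ fun d => D d) (d : ℤ) :
    gproj h d (DirectSum.coeAddMonoidHom D x) = x d := by
  have : (AddEquiv.ofBijective (DirectSum.coeAddMonoidHom D) h).symm
      (DirectSum.coeAddMonoidHom D x) = x :=
    (AddEquiv.ofBijective (DirectSum.coeAddMonoidHom D) h).symm_apply_apply x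
  exact congrArg (fun y : DirectSum ℤ fun d => D d => ((y d : D d) : M)) this

theorem gproj_of_mem {d : ℤ} {m : M} (hm : m ∈ D d) : gproj h d m = m := by
  have := gproj_coe h (DirectSum.of (fun d => D d) d ⟨m, hm⟩) d
  rwa [DirectSum.coeAddMonoidHom_of, DirectSum.of_eq_same] at this

theorem gproj_of_mem_ne {d j : ℤ} {m : M} (hm : m ∈ D j) (hj : j ≠ d) : gproj h d m = 0 := by
  have := gproj_coe h (DirectSum.of (fun d => D d) j ⟨m, hm⟩) d
  rwa [DirectSum.coeAddMonoidHom_of, DirectSum.of_eq_of_ne _ _ _ (Ne.symm hj),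
    ZeroMemClass.coe_zero] at this

/-- An element is the sum of its components; for convenience over any sufficiently large set. -/
theorem exists_sum_gproj (m : M) : ∃ s : Finset ℤ, (∀ t : Finset ℤ, s ⊆ t →
    ∑ d ∈ t, gproj h d m = m) ∧ ∀ d ∉ s, gproj h d m = 0 := by
  classical
  refine isInternal_induction h m ⟨∅, by simp, by simp⟩ ?_ ?_
  · rintro x y ⟨s, hs, hs'⟩ ⟨t, ht, ht'⟩
    refine ⟨s ∪ t, fun u hu => ?_, fun d hd => ?_⟩
    · simp only [map_add, Finset.sum_add_distrib]
      rw [hs u (Finset.union_subset_left hu), ht u (Finset.union_subset_right hu)]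
    · rw [Finset.mem_union, not_or] at hd
      rw [map_add, hs' d hd.1, ht' d hd.2, add_zero]
  · intro d m hm
    refine ⟨{d}, fun t ht => ?_, fun j hj => ?_⟩
    · rw [Finset.sum_eq_single d, gproj_of_mem h hm]
      · exact fun j _ hj => gproj_of_mem_ne h hm (Ne.symm hj)
      · intro h; exact absurd (ht (Finset.mem_singleton_self d)) h
    · exact gproj_of_mem_ne h hm (fun e => hj (by simp [e]))

theorem mem_of_gproj_mem {K : AddSubgroup M} {m : M} (hm : ∀ d, gproj h d m ∈ K) : m ∈ K := by
  obtain ⟨s, hs, -⟩ := exists_sum_gproj h m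
  rw [← hs s subset_rfl]
  exact sum_mem fun d _ => hm d

theorem gproj_smul {A : Type*} [Ring A] [Module A M] {𝒜 : ℤ → AddSubgroup A}
    (hsm : ∀ (i j : ℤ) (a : A) (m : M), a ∈ 𝒜 i → m ∈ D j → a • m ∈ D (i + j))
    {i : ℤ} {a : A} (ha : a ∈ 𝒜 i) (d : ℤ) (m : M) :
    gproj h d (a • m) = a • gproj h (d - i) m := by
  refine isInternal_induction h m (by simp) ?_ ?_
  · intro x y hx hy; simp only [smul_add, map_add, hx, hy]
  · intro j m hm
    have := hsm i j a m ha hm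
    by_cases hd : i + j = d
    · subst hd
      rw [gproj_of_mem h this, add_sub_cancel_left, gproj_of_mem h hm]
    · rw [gproj_of_mem_ne h this hd, gproj_of_mem_ne h hm (fun e => hd (by omega)), smul_zero]

include h in
/-- A quotient of a graded group by a subgroup that is stable under projections is graded. -/
theorem isInternal_quotient {Q : Type*} [AddCommGroup Q] (g : M →+ Q) (hg : Function.Surjective g)
    (hk : ∀ d m, g m = 0 → g (gproj h d m) = 0) {E : ℤ → AddSubgroup Q}
    (hE : ∀ d, E d = (D d).map g) : DirectSum.IsInternal E := by
  let π : ∀ d : ℤ, Q →+ Q := fun d => (g.liftOfSurjective hg) ⟨g.comp (gproj h d), fun m hm => by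
    simpa using hk d m (by simpa using hm)⟩
  have hπ : ∀ d m, π d (g m) = g (gproj h d m) := fun d m =>
    AddMonoidHom.liftOfRightInverse_comp_apply g _ (Function.rightInverse_surjInv hg) _ m
  refine isInternal_of_separating ?_ π ?_ ?_
  · rw [eq_top_iff]
    intro q _
    obtain ⟨m, rfl⟩ := hg q
    refine isInternal_induction h m (by simp) ?_ ?_
    · intro x y hx hy; rw [map_add]; exact add_mem hx hy
    · intro d m hm
      exact (le_iSup E d) (by rw [hE]; exact ⟨m, hm, rfl⟩)
  · intro d j hj m hm
    rw [hE] at hm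
    obtain ⟨m, hm, rfl⟩ := hm
    rw [hπ, gproj_of_mem_ne h hm hj, map_zero]
  · intro d m hm h0
    rw [hE] at hm
    obtain ⟨m, hm, rfl⟩ := hm
    rwa [hπ, gproj_of_mem h hm] at h0

/-- The maps `𝕜 ⊗ gproj d` are the identity on the piece of degree `d` and zero on the others, so
they separate the pieces. Flatness plays no role. -/
theorem isInternal_baseGr (𝕜 : Type*) [Field 𝕜] {A₀ : Type} [Ring A₀] {𝒜 : ℤ → AddSubgroup A₀}
    (h𝒜 : DirectSum.IsInternal 𝒜) : DirectSum.IsInternal (baseGr 𝕜 𝒜) := by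
  let π : ∀ d : ℤ, 𝕜 ⊗[ℤ] A₀ →+ 𝕜 ⊗[ℤ] A₀ := fun d =>
    ((gproj h𝒜 d).toIntLinearMap.lTensor 𝕜).toAddMonoidHom
  have hπ : ∀ d c a, π d (c ⊗ₜ a) = c ⊗ₜ gproj h𝒜 d a := fun d c a => rfl
  have hπ' : ∀ d, ∀ t ∈ baseGr 𝕜 𝒜 d, π d t = t := by
    intro d t ht
    refine AddSubgroup.closure_induction ?_ (by simp) ?_ ?_ ht
    · rintro _ ⟨c, a, ha, rfl⟩
      rw [hπ, gproj_of_mem h𝒜 ha]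
    · intro x y _ _ hx hy; rw [map_add, hx, hy]
    · intro x _ hx; rw [map_neg, hx]
  refine isInternal_of_separating ?_ π ?_ ?_
  · rw [eq_top_iff]
    intro t _
    induction t using TensorProduct.induction_on with
    | zero => exact zero_mem _
    | add x y hx hy => exact add_mem (hx trivial) (hy trivial)
    | tmul c a =>
      refine isInternal_induction h𝒜 a (by simp) ?_ ?_
      · intro x y hx hy; rw [TensorProduct.tmul_add]; exact add_mem hx hy
      · intro d a ha
        exact (le_iSup (baseGr 𝕜 𝒜) d) (AddSubgroup.subset_closure ⟨c, a, ha, rfl⟩)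
  · intro d j hj t ht
    refine AddSubgroup.closure_induction ?_ (by simp) ?_ ?_ ht
    · rintro _ ⟨c, a, ha, rfl⟩
      rw [hπ, gproj_of_mem_ne h𝒜 ha hj, TensorProduct.tmul_zero]
    · intro x y _ _ hx hy; rw [map_add, hx, hy, add_zero]
    · intro x _ hx; rw [map_neg, hx, neg_zero]
  · intro d t ht h0
    rwa [hπ' d t ht] at h0

theorem isInternal_pi {ι : Type*} [Finite ι] {N : ι → Type*} [∀ i, AddCommGroup (N i)]
    {E : ∀ i, ℤ → AddSubgroup (N i)} (hE : ∀ i, DirectSum.IsInternal (E i)) :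
    DirectSum.IsInternal fun d => AddSubgroup.pi Set.univ fun i => E i d := by
  classical
  cases nonempty_fintype ι
  let π : ∀ d : ℤ, (∀ i, N i) →+ (∀ i, N i) := fun d =>
    AddMonoidHom.piMap fun i => gproj (hE i) d
  have hπ : ∀ d x i, π d x i = gproj (hE i) d (x i) := fun _ _ _ => rfl
  refine isInternal_of_separating ?_ π ?_ ?_
  · rw [eq_top_iff]
    intro x _
    rw [← Finset.univ_sum_single x]
    refine sum_mem fun i _ => ?_
    refine isInternal_induction (hE i) (x i) (by simp) ?_ ?_
    · intro a b ha hb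
      rw [Pi.single_add]
      exact add_mem ha hb
    · intro d m hm
      refine (le_iSup (fun d => AddSubgroup.pi Set.univ fun i => E i d) d) ?_
      intro j _
      by_cases hj : j = i
      · subst hj; simpa using hm
      · rw [Pi.single_eq_of_ne hj]; exact zero_mem (E j d)
  · intro d j hj x hx
    funext i
    exact gproj_of_mem_ne (hE i) (hx i trivial) hj
  · intro d x hx h0
    funext i
    rw [← gproj_of_mem (hE i) (hx i trivial)]
    exact congrFun h0 i

end Gradings

/-- Gradings descend along quotients of graded rings by ideals with homogeneous generators. -/
theorem gproj_mem_of_generators {S Q : Type*} [Ring S] [Ring Q] {𝒜 : ℤ → AddSubgroup S}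
    (h𝒜 : DirectSum.IsInternal 𝒜) (hmul : ∀ i j a b, a ∈ 𝒜 i → b ∈ 𝒜 j → a * b ∈ 𝒜 (i + j))
    (g : S →+* Q) {r : S} (hr : g r = 0) {i : ℤ} (hri : r ∈ 𝒜 i) (d : ℤ) (u v : S) :
    g (gproj h𝒜 d (u * r * v)) = 0 := by
  refine isInternal_induction h𝒜 u (by simp) ?_ fun j u hu => ?_
  · intro x y hx hy
    simp only [add_mul, map_add, hx, hy, add_zero]
  refine isInternal_induction h𝒜 v (by simp) ?_ fun l v hv => ?_
  · intro x y hx hy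
    simp only [mul_add, map_add, hx, hy, add_zero]
  have hm := hmul _ _ _ _ (hmul _ _ _ _ hu hri) hv
  by_cases hd : j + i + l = d
  · subst hd
    rw [gproj_of_mem h𝒜 hm, map_mul, map_mul, hr, mul_zero, zero_mul]
  · rw [gproj_of_mem_ne h𝒜 hm hd, map_zero]

end

end OSzSar

namespace OSzSar

noncomputable section

/-! ### Nonnegatively graded algebras with split semisimple part of degree zero -/

universe u v

/-- A nonnegatively graded algebra over a field whose part of degree zero is spanned by orthogonal
idempotents `e l`; the characters `ε l` witness that these are linearly independent. -/
structure IsBasicGr (𝕜 : Type u) [Field 𝕜] {C : Type u} [Ring C] [Algebra 𝕜 C]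
    (𝒜 : ℤ → AddSubgroup C) {Λ : Type v} [Fintype Λ] (e : Λ → C) (ε : Λ → C →+* 𝕜) : Prop where
  internal : DirectSum.IsInternal 𝒜
  mul_mem : ∀ i j a b, a ∈ 𝒜 i → b ∈ 𝒜 j → a * b ∈ 𝒜 (i + j)
  neg : ∀ d < 0, ∀ a ∈ 𝒜 d, a = 0
  zero : ∀ a ∈ 𝒜 0, ∃ c : Λ → 𝕜, a = ∑ l, c l • e l
  e_mem : ∀ l, e l ∈ 𝒜 0
  e_idem : ∀ l, e l * e l = e l
  e_orth : ∀ l m, l ≠ m → e l * e m = 0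
  sum_e : ∑ l, e l = 1
  aug_e : ∀ l, ε l (e l) = 1
  aug_e_ne : ∀ l m, l ≠ m → ε l (e m) = 0
  aug_ne : ∀ l d a, d ≠ 0 → a ∈ 𝒜 d → ε l a = 0

section GradedModules

variable {𝕜 : Type u} [Field 𝕜] {C : Type u} [Ring C] [Algebra 𝕜 C]
  {𝒜 : ℤ → AddSubgroup C} {Λ : Type v} [Fintype Λ] {e : Λ → C} {ε : Λ → C →+* 𝕜}
  {M : Type*} [AddCommGroup M] [Module C M] {D : ℤ → AddSubgroup M}

variable (𝕜 𝒜) in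
/-- The `𝕜`-span of the products of ring elements of positive degree with elements of `K`. -/
def posSpan [Module 𝕜 M] (K : Submodule C M) : Submodule 𝕜 M :=
  Submodule.span 𝕜 {x | ∃ d : ℤ, 0 < d ∧ ∃ a ∈ 𝒜 d, ∃ m ∈ K, x = a • m}

omit [Algebra 𝕜 C] in
theorem smul_mem_posSpan [Module 𝕜 M] {K : Submodule C M} {d : ℤ} (hd : 0 < d) {a : C}
    (ha : a ∈ 𝒜 d) {m : M} (hm : m ∈ K) : a • m ∈ posSpan 𝕜 𝒜 K :=
  Submodule.subset_span ⟨d, hd, a, ha, m, hm, rfl⟩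

variable (hC : IsBasicGr 𝕜 𝒜 e ε) (hD : DirectSum.IsInternal D)
  (hsm : ∀ (i j : ℤ) (a : C) (m : M), a ∈ 𝒜 i → m ∈ D j → a • m ∈ D (i + j))

include hC hsm in
/-- A submodule with homogeneous generators contains the components of its elements. -/
theorem gproj_mem_span {S : Set M} (hS : ∀ m ∈ S, ∃ d, m ∈ D d) {m : M}
    (hm : m ∈ Submodule.span C S) (d : ℤ) : gproj hD d m ∈ Submodule.span C S := by
  induction hm using Submodule.span_induction generalizing d with
  | mem x hx =>
    obtain ⟨j, hj⟩ := hS x hx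
    by_cases h : j = d
    · rw [← h, gproj_of_mem hD hj]; exact Submodule.subset_span hx
    · rw [gproj_of_mem_ne hD hj h]; exact zero_mem _
  | zero => simp
  | add x y _ _ hx hy => rw [map_add]; exact add_mem (hx d) (hy d)
  | smul a x _ hx =>
    refine isInternal_induction hC.internal a (by simp) ?_ ?_
    · intro a b ha hb; rw [add_smul, map_add]; exact add_mem ha hb
    · intro i a ha
      rw [gproj_smul hD hsm ha]
      exact Submodule.smul_mem _ _ (hx _)

include hC hsm in
/-- Finitely generated graded modules are bounded below. -/
theorem exists_gproj_eq_zero [Module.Finite C M] :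
    ∃ d₀ : ℤ, ∀ d < d₀, ∀ m, gproj hD d m = 0 := by
  classical
  obtain ⟨s, hs⟩ := Module.finite_def.mp (inferInstance : Module.Finite C M)
  choose t ht ht' using fun m => exists_sum_gproj hD m
  obtain ⟨d₀, hd₀⟩ := (s.biUnion t).bddBelow
  refine ⟨d₀, fun d hd m => ?_⟩
  have hm : m ∈ Submodule.span C (s : Set M) := by rw [hs]; trivial
  induction hm using Submodule.span_induction generalizing d with
  | mem x hx =>
    refine ht' x d fun hdx => ?_
    have := hd₀ (Finset.mem_coe.mpr (Finset.mem_biUnion.mpr ⟨x, hx, hdx⟩))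
    omega
  | zero => simp
  | add x y _ _ hx hy => rw [map_add, hx d hd, hy d hd, add_zero]
  | smul a x _ hx =>
    refine isInternal_induction hC.internal a (by simp) ?_ ?_
    · intro a b ha hb; rw [add_smul, map_add, ha, hb, add_zero]
    · intro i a ha
      by_cases hi : i < 0
      · rw [hC.neg i hi a ha, zero_smul, map_zero]
      · rw [gproj_smul hD hsm ha, hx _ (by omega), smul_zero]

include hC hsm in
/-- The graded Nakayama lemma. -/
theorem graded_nakayama [Module 𝕜 M] [IsScalarTower 𝕜 C M] [Module.Finite C M]
    {K L : Submodule C M} (hL : ∀ m ∈ L, ∀ d, gproj hD d m ∈ L)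
    (hKL : ∀ m ∈ K, m ∈ L.restrictScalars 𝕜 ⊔ posSpan 𝕜 𝒜 K) : K ≤ L := by
  obtain ⟨d₀, hd₀⟩ := exists_gproj_eq_zero hC hD hsm
  -- Induction on the degree: below `d₀` all components vanish, and a scalar of positive degree
  -- reaches degree `d` only from components of smaller degree. `K` need be neither graded nor
  -- finitely generated.
  have key : ∀ N : ℕ, ∀ d < d₀ + N, ∀ m ∈ K, gproj hD d m ∈ L := by
    intro N
    induction N with
    | zero => intro d hd m _; rw [hd₀ d (by simpa using hd)]; exact zero_mem _
    | succ N ih =>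
      intro d hd m hm
      obtain ⟨y, hy, z, hz, hyz⟩ := Submodule.mem_sup.mp (hKL m hm)
      clear hm
      rw [← hyz, map_add]
      clear hyz
      refine add_mem (hL y hy d) ?_
      -- The extra factor `b` absorbs the scalars of the `𝕜`-span: `IsBasicGr` does not say that `𝕜`
      -- sits in degree zero, but multiplication by any `b` never lowers degrees.
      have h1 : ∀ b : C, gproj hD d (b • z) ∈ L := by
        induction hz using Submodule.span_induction with
        | mem x hx =>
          obtain ⟨j, hj, a, ha, m, hm, rfl⟩ := hx
          intro b
          rw [← mul_smul]
          refine isInternal_induction hC.internal b (by simp) ?_ ?_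
          · intro a b ha hb; rw [add_mul, add_smul, map_add]; exact add_mem ha hb
          · intro i b hb
            by_cases hi : i < 0
            · rw [hC.neg i hi b hb]; simp
            · rw [gproj_smul hD hsm (hC.mul_mem _ _ _ _ hb ha)]
              refine Submodule.smul_mem _ _ (ih _ ?_ m hm)
              push_cast at hd
              omega
        | zero => simp
        | add x y _ _ hx hy =>
          intro b
          rw [smul_add, map_add]
          exact add_mem (hx b) (hy b)
        | smul c x _ hx =>
          intro b
          rw [← algebraMap_smul C c x, ← mul_smul]
          exact hx _
      simpa using h1 1
  intro m hm
  refine mem_of_gproj_mem hD (K := L.toAddSubgroup) fun d => ?_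
  exact key (d - d₀ + 1).toNat d (by have := Int.self_le_toNat (d - d₀ + 1); omega) m hm

end GradedModules

end

end OSzSar

namespace OSzSar

noncomputable section

universe u v

/-! ### Structure of finitely generated projective graded modules -/

section GradedModules

variable {𝕜 : Type u} [Field 𝕜] {C : Type u} [Ring C] [Algebra 𝕜 C]
  {𝒜 : ℤ → AddSubgroup C} {Λ : Type v} [Fintype Λ] {e : Λ → C} {ε : Λ → C →+* 𝕜}
  {M : Type*} [AddCommGroup M] [Module C M] {D : ℤ → AddSubgroup M}

theorem mul_of_mem_span_idem {R : Type*} [Ring R] {e x : R} (he : e * e = e)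
    (hx : x ∈ (Ideal.span {e} : Ideal R)) : x * e = x := by
  obtain ⟨a, rfl⟩ := Ideal.mem_span_singleton'.mp hx
  rw [mul_assoc, he]

/-- The projection of a ring onto the left ideal generated by an idempotent. -/
def toLeftIdeal {R : Type*} [Ring R] (e : R) : R →ₗ[R] (Ideal.span {e} : Ideal R) :=
  (LinearMap.toSpanSingleton R R e).codRestrict _ fun a =>
    Ideal.mul_mem_left _ a (Ideal.mem_span_singleton_self e)

theorem toLeftIdeal_comp_subtype {R : Type*} [Ring R] {e : R} (he : e * e = e) :
    toLeftIdeal e ∘ₗ (Ideal.span {e} : Ideal R).subtype = LinearMap.id := by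
  ext x
  exact mul_of_mem_span_idem he x.2

variable (hC : IsBasicGr 𝕜 𝒜 e ε)

-- Right multiplication by `e l` retracts `C` onto the left ideal. It preserves degrees because `e
-- l` has degree zero, so projectivity and the grading are inherited from `C`.
include hC in
theorem leftIdealMod_isProj (l : Λ) : (leftIdealMod 𝒜 (e l)).IsProj 𝒜 where
  internal := by
    refine isInternal_of_separating (N := fun _ => C) (D := (leftIdealMod 𝒜 (e l)).deg) ?_
      (fun d => (gproj hC.internal d).comp (Ideal.span {e l} : Ideal C).subtype.toAddMonoidHom)
      ?_ ?_
    · rw [eq_top_iff]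
      have h1 : ∀ a : C, toLeftIdeal (e l) a ∈ ⨆ d, (leftIdealMod 𝒜 (e l)).deg d := by
        intro a
        refine isInternal_induction hC.internal a (by rw [map_zero]; exact zero_mem _) ?_ ?_
        · intro a b ha hb; rw [map_add]; exact add_mem ha hb
        · intro d a ha
          refine (le_iSup (leftIdealMod 𝒜 (e l)).deg d) ?_
          change a * e l ∈ 𝒜 d
          simpa using hC.mul_mem _ _ _ _ ha (hC.e_mem l)
      intro (x : (Ideal.span {e l} : Ideal C)) _
      have : toLeftIdeal (e l) (x : C) = x :=
        LinearMap.congr_fun (toLeftIdeal_comp_subtype (hC.e_idem l)) x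
      rw [← this]
      exact h1 _
    · intro d j hj m hm
      exact gproj_of_mem_ne hC.internal hm hj
    · intro d m hm h0
      refine Subtype.ext ?_
      exact (gproj_of_mem hC.internal (show m.1 ∈ 𝒜 d from hm)).symm.trans h0
  smul_mem := fun i j a m ha hm => hC.mul_mem i j a m.1 ha hm
  finite := Module.Finite.iff_fg.mpr (Submodule.fg_span_singleton _)
  projective := Module.Projective.of_split _ _ (toLeftIdeal_comp_subtype (hC.e_idem l))

/-- A finite direct sum of graded modules. -/
def piMod {r : ℕ} (P : Fin r → GrMod C) : GrMod C where
  carrier := ∀ i, (P i).carrier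
  deg d := AddSubgroup.pi Set.univ fun i => (P i).deg d

omit [Fintype Λ] in
theorem piMod_isProj {r : ℕ} {P : Fin r → GrMod C} (hP : ∀ i, (P i).IsProj 𝒜) :
    (piMod P).IsProj 𝒜 where
  internal := isInternal_pi fun i => (hP i).internal
  smul_mem := fun i j a m ha hm t _ => (hP t).smul_mem i j a (m t) ha (hm t trivial)
  finite := by
    have := fun i => (hP i).finite
    exact inferInstanceAs (Module.Finite C (∀ i, (P i).carrier))
  projective := by
    have := fun i => (hP i).projective
    have : Module.Projective C (Π₀ i, (P i).carrier) := inferInstance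
    exact Module.Projective.of_equiv (DFinsupp.linearEquivFunOnFintype (R := C))

variable (𝒜 e) in
/-- The graded module `⨁ q^{d i} C e_{l i}`. -/
def stdMod {r : ℕ} (l : Fin r → Λ) (d : Fin r → ℤ) : GrMod C :=
  piMod fun i => (leftIdealMod 𝒜 (e (l i))).shift (d i)

include hC in
theorem stdMod_isProj {r : ℕ} (l : Fin r → Λ) (d : Fin r → ℤ) : (stdMod 𝒜 e l d).IsProj 𝒜 :=
  piMod_isProj fun i => (leftIdealMod_isProj hC (l i)).shift (d i)

/-- An isomorphism of graded modules. -/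
def GrIso (P Q : GrMod C) : Prop :=
  ∃ φ : P.carrier ≃ₗ[C] Q.carrier, ∀ d m, m ∈ P.deg d ↔ φ m ∈ Q.deg d

/-- For an equivalence of graded modules it is enough to preserve degrees in one direction. -/
theorem GrIso.of_map_deg {P Q : GrMod C} (hP : DirectSum.IsInternal P.deg)
    (hQ : DirectSum.IsInternal Q.deg) (φ : P.carrier ≃ₗ[C] Q.carrier)
    (h : ∀ d, ∀ m ∈ P.deg d, φ m ∈ Q.deg d) : GrIso P Q := by
  refine ⟨φ, fun d m => ⟨h d m, fun hm => ?_⟩⟩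
  have key : φ (gproj hP d m) = gproj hQ d (φ m) := by
    clear hm
    refine isInternal_induction hP m (by simp) ?_ ?_
    · intro x y hx hy; simp only [map_add, hx, hy]
    · intro j m hm
      by_cases hj : j = d
      · subst hj; rw [gproj_of_mem hP hm, gproj_of_mem hQ (h _ _ hm)]
      · rw [gproj_of_mem_ne hP hm hj, gproj_of_mem_ne hQ (h _ _ hm) hj, map_zero]
  rw [gproj_of_mem hQ hm] at key
  rw [← φ.injective key]
  exact gproj_mem hP d m

/-- The map from `⨁ C e_{l i}` given by a family of elements. -/
def stdLift {r : ℕ} (l : Fin r → Λ) (p : Fin r → M) :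
    (∀ i, (Ideal.span {e (l i)} : Ideal C)) →ₗ[C] M :=
  LinearMap.lsum C (fun i => (Ideal.span {e (l i)} : Ideal C)) ℕ fun i =>
    LinearMap.toSpanSingleton C M (p i) ∘ₗ (Ideal.span {e (l i)} : Ideal C).subtype

omit [Fintype Λ] in
theorem stdLift_apply {r : ℕ} (l : Fin r → Λ) (p : Fin r → M)
    (x : ∀ i, (Ideal.span {e (l i)} : Ideal C)) :
    stdLift l p x = ∑ i, (x i : C) • p i := by
  simp [stdLift, LinearMap.lsum_apply]

/-- The generator of the `i`-th summand of `⨁ C e_{l i}`. -/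
def stdGen {r : ℕ} (l : Fin r → Λ) (i : Fin r) : ∀ i, (Ideal.span {e (l i)} : Ideal C) :=
  Pi.single i ⟨e (l i), Ideal.mem_span_singleton_self _⟩

omit [Fintype Λ] in
theorem stdLift_gen {r : ℕ} (l : Fin r → Λ) (p : Fin r → M) (i : Fin r) :
    stdLift l p (stdGen (e := e) l i) = e (l i) • p i := by
  rw [stdLift_apply, Finset.sum_eq_single i, stdGen, Pi.single_eq_same]
  · intro j _ hj
    rw [stdGen, Pi.single_eq_of_ne hj, ZeroMemClass.coe_zero, zero_smul]
  · intro h; exact absurd (Finset.mem_univ i) h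

omit [Fintype Λ] in
theorem eq_sum_stdGen {r : ℕ} (l : Fin r → Λ) (x : ∀ i, (Ideal.span {e (l i)} : Ideal C))
    (y : Fin r → C) (h : ∀ i, (x i : C) = y i * e (l i)) : x = ∑ i, y i • stdGen l i := by
  funext j
  refine Subtype.ext ?_
  rw [h, Finset.sum_apply, Finset.sum_eq_single j]
  · rw [Pi.smul_apply, stdGen, Pi.single_eq_same]; rfl
  · intro i _ hi
    rw [Pi.smul_apply, stdGen, Pi.single_eq_of_ne (Ne.symm hi), smul_zero]
  · intro h; exact absurd (Finset.mem_univ _) h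

-- Modulo `posSpan`, scalars of positive degree act by zero, and those of degree zero are
-- combinations of the idempotents. The products of idempotents with module generators therefore
-- span over `𝕜`.
include hC in
theorem finite_quotient_posSpan [Module 𝕜 M] [IsScalarTower 𝕜 C M] [Module.Finite C M] :
    Module.Finite 𝕜 (M ⧸ posSpan 𝕜 𝒜 (⊤ : Submodule C M)) := by
  classical
  obtain ⟨s, hs⟩ := Module.finite_def.mp (inferInstance : Module.Finite C M)
  let q := (posSpan 𝕜 𝒜 (⊤ : Submodule C M)).mkQ
  let t : Finset (M ⧸ posSpan 𝕜 𝒜 (⊤ : Submodule C M)) :=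
    (Finset.univ ×ˢ s).image fun z : Λ × M => q (e z.1 • z.2)
  refine ⟨⟨t, ?_⟩⟩
  rw [eq_top_iff]
  intro y _
  obtain ⟨m, rfl⟩ := Submodule.mkQ_surjective _ y
  have hm : m ∈ Submodule.span C (s : Set M) := by rw [hs]; trivial
  obtain ⟨c, -, rfl⟩ := Submodule.mem_span_finset.mp hm
  rw [map_sum]
  refine sum_mem fun p hp => ?_
  refine isInternal_induction hC.internal (c p) (by simp) ?_ ?_
  · intro a b ha hb; rw [add_smul, map_add]; exact add_mem ha hb
  · intro d a ha
    rcases lt_trichotomy d 0 with hd | rfl | hd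
    · rw [hC.neg d hd a ha]; simp
    · obtain ⟨c, rfl⟩ := hC.zero a ha
      rw [Finset.sum_smul, map_sum]
      refine sum_mem fun l _ => ?_
      rw [smul_assoc, map_smul]
      refine Submodule.smul_mem _ _ (Submodule.subset_span ?_)
      exact Finset.mem_coe.mpr (Finset.mem_image.mpr ⟨(l, p), by simp [hp], rfl⟩)
    · have : (posSpan 𝕜 𝒜 (⊤ : Submodule C M)).mkQ (a • p) = 0 := by
        rw [Submodule.mkQ_apply, Submodule.Quotient.mk_eq_zero]
        exact smul_mem_posSpan hd ha trivial
      rw [this]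
      exact zero_mem _

-- These are homogeneous lifts of a basis of the head `M / C_{>0} M`. Such a basis can be selected
-- from the classes of homogeneous elements fixed by some idempotent, which span because the
-- idempotents have degree zero and sum to `1`.
include hC in
theorem exists_homogeneous_basis [Module 𝕜 M] [IsScalarTower 𝕜 C M] [Module.Finite C M]
    (hD : DirectSum.IsInternal D)
    (hsm : ∀ (i j : ℤ) (a : C) (m : M), a ∈ 𝒜 i → m ∈ D j → a • m ∈ D (i + j)) :
    ∃ (r : ℕ) (l : Fin r → Λ) (d : Fin r → ℤ) (p : Fin r → M),
      (∀ i, p i ∈ D (d i)) ∧ (∀ i, e (l i) • p i = p i) ∧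
      LinearIndependent 𝕜 (fun i => (posSpan 𝕜 𝒜 (⊤ : Submodule C M)).mkQ (p i)) ∧
      Submodule.span 𝕜 (Set.range p) ⊔ posSpan 𝕜 𝒜 (⊤ : Submodule C M) = ⊤ := by
  classical
  have := finite_quotient_posSpan (M := M) hC
  let q := (posSpan 𝕜 𝒜 (⊤ : Submodule C M)).mkQ
  let S : Set (M ⧸ posSpan 𝕜 𝒜 (⊤ : Submodule C M)) :=
    {x | ∃ (l : Λ) (d : ℤ) (p : M), p ∈ D d ∧ e l • p = p ∧ q p = x}
  have hS : Submodule.span 𝕜 S = ⊤ := by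
    rw [eq_top_iff]
    intro y _
    obtain ⟨m, rfl⟩ := Submodule.mkQ_surjective _ y
    refine isInternal_induction hD m (by simp) ?_ ?_
    · intro a b ha hb; rw [map_add]; exact add_mem ha hb
    · intro d m hm
      rw [← one_smul C m, ← hC.sum_e, Finset.sum_smul, map_sum]
      refine sum_mem fun l _ => Submodule.subset_span ⟨l, d, e l • m, ?_, ?_, rfl⟩
      · simpa using hsm _ _ _ _ (hC.e_mem l) hm
      · rw [← mul_smul, hC.e_idem]
  obtain ⟨b, hbS, hb, hli⟩ := exists_linearIndependent 𝕜 S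
  have hfin : b.Finite := hli.setFinite
  have := hfin.to_subtype
  obtain ⟨r, ⟨f⟩⟩ := Finite.exists_equiv_fin b
  choose l d p hp he hq using fun i : Fin r => hbS (f.symm i).2
  refine ⟨r, l, d, p, hp, he, ?_, ?_⟩
  · have : (fun i => (posSpan 𝕜 𝒜 (⊤ : Submodule C M)).mkQ (p i)) = (fun x : b => x.1) ∘ f.symm :=
      funext hq
    rw [this]
    exact hli.comp _ f.symm.injective
  · rw [eq_top_iff]
    intro m _
    have hm : q m ∈ Submodule.span 𝕜 (Set.range fun i => q (p i)) := by
      have : (Set.range fun i => q (p i)) = b := by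
        ext x
        constructor
        · rintro ⟨i, rfl⟩; change q (p i) ∈ b; rw [hq]; exact (f.symm i).2
        · intro hx; exact ⟨f ⟨x, hx⟩, (hq _).trans (by rw [f.symm_apply_apply])⟩
      rw [this, hb, hS]
      trivial
    have hr : (Set.range fun i => q (p i)) = q '' Set.range p := (Set.range_comp q p)
    rw [hr, Submodule.span_image] at hm
    obtain ⟨z, hz, hzm⟩ := hm
    refine Submodule.mem_sup.mpr ⟨z, hz, m - z, ?_, by abel⟩
    exact (Submodule.Quotient.eq _).mp hzm.symm

include hC in
/-- Finitely generated projective graded modules are sums of shifts of the modules `C e_l`. -/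
theorem projective_graded_classification (P : GrMod C) (hP : P.IsProj 𝒜) :
    ∃ (r : ℕ) (l : Fin r → Λ) (d : Fin r → ℤ) (p : Fin r → P.carrier),
      (∀ i, p i ∈ P.deg (d i)) ∧ (∀ i, e (l i) • p i = p i) ∧
      Function.Bijective (stdLift (e := e) l p) := by
  classical
  let : Module 𝕜 P.carrier := Module.compHom _ (algebraMap 𝕜 C)
  have : IsScalarTower 𝕜 C P.carrier := IsScalarTower.of_algebraMap_smul fun _ _ => rfl
  have := hP.finite
  have := hP.projective
  obtain ⟨r, l, d, p, hp, he, hli, hspan⟩ := exists_homogeneous_basis hC hP.internal hP.smul_mem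
  refine ⟨r, l, d, p, hp, he, ?_⟩
  let F := ∀ i, (Ideal.span {e (l i)} : Ideal C)
  let DF : ℤ → AddSubgroup F := (stdMod 𝒜 e l d).deg
  have hFint : DirectSum.IsInternal DF := (stdMod_isProj hC l d).internal
  have hFsm : ∀ (i j : ℤ) (a : C) (m : F), a ∈ 𝒜 i → m ∈ DF j → a • m ∈ DF (i + j) :=
    (stdMod_isProj hC l d).smul_mem
  have : Module.Finite C F := (stdMod_isProj hC l d).finite
  let φ : F →ₗ[C] P.carrier := stdLift l p
  have hφ : ∀ x : F, φ x = ∑ i, (x i).1 • p i := stdLift_apply l p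
  have hrange : ∀ i, p i ∈ LinearMap.range φ := fun i =>
    ⟨stdGen l i, (stdLift_gen l p i).trans (he i)⟩
  have hsurj : Function.Surjective φ := by
    have hle : (⊤ : Submodule C P.carrier) ≤ Submodule.span C (Set.range p) := by
      refine graded_nakayama hC hP.internal hP.smul_mem ?_ ?_
      · intro m hm d
        refine gproj_mem_span hC hP.internal hP.smul_mem ?_ hm d
        rintro _ ⟨i, rfl⟩
        exact ⟨_, hp i⟩
      · intro m _
        have : m ∈ (⊤ : Submodule 𝕜 P.carrier) := trivial
        rw [← hspan] at this
        exact sup_le_sup_right (Submodule.span_le_restrictScalars 𝕜 C (Set.range p)) (posSpan 𝕜 𝒜 ⊤) this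
    rw [← LinearMap.range_eq_top, eq_top_iff]
    refine hle.trans (Submodule.span_le.mpr ?_)
    rintro _ ⟨i, rfl⟩
    exact hrange i
  refine ⟨?_, hsurj⟩
  -- The section `σ` need not preserve degrees, and this is not needed below.
  obtain ⟨σ, hσ⟩ := Module.projective_lifting_property φ LinearMap.id hsurj
  have hσ' : ∀ m, φ (σ m) = m := fun m => LinearMap.congr_fun hσ m
  have hdecomp : ∀ x : F, ∃ c : Fin r → 𝕜, ∀ i, ∃ y ∈ (posSpan 𝕜 𝒜 (⊤ : Submodule C C)),
      (x i).1 = c i • e (l i) + y * e (l i) := by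
    intro x
    have h1 : ∀ a : C, ∀ i, ∃ c : 𝕜, ∃ y ∈ (posSpan 𝕜 𝒜 (⊤ : Submodule C C)),
        a * e (l i) = c • e (l i) + y * e (l i) := by
      intro a i
      refine isInternal_induction hC.internal a ⟨0, 0, zero_mem _, by simp⟩ ?_ ?_
      · rintro a b ⟨c, y, hy, h⟩ ⟨c', y', hy', h'⟩
        refine ⟨c + c', y + y', add_mem hy hy', ?_⟩
        rw [add_mul, h, h', add_smul, add_mul]
        abel
      · intro d a ha
        rcases lt_trichotomy d 0 with hd | rfl | hd
        · exact ⟨0, 0, zero_mem _, by rw [hC.neg d hd a ha]; simp⟩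
        · obtain ⟨c, rfl⟩ := hC.zero a ha
          refine ⟨c (l i), 0, zero_mem _, ?_⟩
          rw [Finset.sum_mul, Finset.sum_eq_single (l i), smul_mul_assoc, hC.e_idem, zero_mul,
            add_zero]
          · intro j _ hj
            rw [smul_mul_assoc, hC.e_orth _ _ hj, smul_zero]
          · intro h; exact absurd (Finset.mem_univ _) h
        · refine ⟨0, a, ?_, by simp⟩
          simpa using smul_mem_posSpan (𝕜 := 𝕜) (K := (⊤ : Submodule C C)) (m := 1) hd ha trivial
    choose c y hy h using fun i => h1 (x i).1 i
    refine ⟨c, fun i => ⟨y i, hy i, ?_⟩⟩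
    rw [← h, mul_of_mem_span_idem (hC.e_idem (l i)) (x i).2]
  have hpos : ∀ y ∈ (posSpan 𝕜 𝒜 (⊤ : Submodule C C)), ∀ {N : Type u} [AddCommGroup N] [Module C N]
      [Module 𝕜 N] [IsScalarTower 𝕜 C N] (m : N), y • m ∈ posSpan 𝕜 𝒜 (⊤ : Submodule C N) := by
    intro y hy N _ _ _ _ m
    induction hy using Submodule.span_induction with
    | mem x hx =>
      obtain ⟨d, hd, a, ha, b, -, rfl⟩ := hx
      rw [smul_assoc]
      exact smul_mem_posSpan hd ha trivial
    | zero => rw [zero_smul]; exact zero_mem _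
    | add x y _ _ hx hy => rw [add_smul]; exact add_mem hx hy
    | smul c x _ hx => rw [smul_assoc]; exact Submodule.smul_mem _ _ hx
  -- Minimality of the generators: the degree zero coefficients of an element of the kernel give a
  -- linear relation in the head of `P`, hence vanish.
  have hker : ∀ x ∈ LinearMap.ker φ, x ∈ posSpan 𝕜 𝒜 (⊤ : Submodule C F) := by
    intro x hx
    obtain ⟨c, hc⟩ := hdecomp x
    choose y hy hxy using hc
    have h1 : ∑ i, c i • (posSpan 𝕜 𝒜 (⊤ : Submodule C P.carrier)).mkQ (p i) = 0 := by
      have : φ x = ∑ i, c i • p i + ∑ i, y i • p i := by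
        rw [hφ, ← Finset.sum_add_distrib]
        refine Finset.sum_congr rfl fun i _ => ?_
        rw [hxy, add_smul, mul_smul, smul_assoc, he]
      have h2 := congrArg (posSpan 𝕜 𝒜 (⊤ : Submodule C P.carrier)).mkQ this
      rw [LinearMap.mem_ker.mp hx, map_zero, map_add, map_sum] at h2
      have h3 : (posSpan 𝕜 𝒜 (⊤ : Submodule C P.carrier)).mkQ (∑ i, y i • p i) = 0 := by
        rw [Submodule.mkQ_apply, Submodule.Quotient.mk_eq_zero]
        exact sum_mem fun i _ => hpos _ (hy i) _
      rw [h3, add_zero] at h2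
      simpa only [map_smul] using h2.symm
    have h2 := Fintype.linearIndependent_iff.mp hli c h1
    have h3 : x = ∑ i, y i • stdGen l i :=
      eq_sum_stdGen l x y fun i => by rw [hxy, h2, zero_smul, zero_add]
    rw [h3]
    exact sum_mem fun i _ => hpos _ (hy i) _
  -- The projection onto the kernel along `σ`. Applied to an expression `∑ a • m` with `a` of
  -- positive degree it moves every `m` into the kernel, so that `ker φ` lies in `C_{>0} ker φ` and
  -- Nakayama applies.
  let ρ : F →ₗ[C] F := LinearMap.id - σ ∘ₗ φ
  have hρ : ∀ x, ρ x = x - σ (φ x) := fun _ => rfl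
  have hρker : ∀ x, ρ x ∈ LinearMap.ker φ := by
    intro x
    rw [LinearMap.mem_ker, hρ, map_sub, hσ', sub_self]
  have hKbot : LinearMap.ker φ ≤ ⊥ := by
    refine graded_nakayama hC hFint hFsm ?_ ?_
    · intro m hm d
      rw [Submodule.mem_bot] at hm ⊢
      rw [hm, map_zero]
    · intro x hx
      refine Submodule.mem_sup_right ?_
      have h1 : ρ x = x := by rw [hρ, LinearMap.mem_ker.mp hx, map_zero, sub_zero]
      rw [← h1]
      have := hker x hx
      clear h1 hx
      induction this using Submodule.span_induction with
      | mem x hx =>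
        obtain ⟨d, hd, a, ha, m, -, rfl⟩ := hx
        rw [map_smul]
        exact smul_mem_posSpan hd ha (hρker m)
      | zero => rw [map_zero]; exact zero_mem _
      | add x y _ _ hx hy => rw [map_add]; exact add_mem hx hy
      | smul c x _ hx =>
        rw [← algebraMap_smul C c x, map_smul, algebraMap_smul]
        exact Submodule.smul_mem _ _ hx
  exact LinearMap.ker_eq_bot.mp (le_bot_iff.mp hKbot)

end GradedModules

end

end OSzSar

namespace OSzSar

noncomputable section

universe u v

section GradedModules

variable {𝕜 : Type u} [Field 𝕜] {C : Type u} [Ring C] [Algebra 𝕜 C]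
  {𝒜 : ℤ → AddSubgroup C} {Λ : Type v} [Fintype Λ] {e : Λ → C} {ε : Λ → C →+* 𝕜}

/-! ### Classes in the Grothendieck group -/

theorem K0.cls_eq_add {M' M M'' : GrProj 𝒜} (h : ShortExact M'.1 M.1 M''.1) :
    K0.cls M = K0.cls M' + K0.cls M'' := by
  have : K0.cls M - K0.cls M' - K0.cls M'' = 0 :=
    (Submodule.Quotient.mk_eq_zero _).mpr (Submodule.subset_span (Or.inl ⟨M', M, M'', h, rfl⟩))
  rw [sub_sub, sub_eq_zero] at this
  exact this

theorem K0.cls_shift (i : ℤ) (M : GrProj 𝒜) :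
    K0.cls ⟨M.1.shift i, M.2.shift i⟩ = (LaurentPolynomial.T i : ℤ[T;T⁻¹]) • K0.cls M := by
  have h : K0.cls ⟨M.1.shift i, M.2.shift i⟩ -
      (Submodule.Quotient.mk (Finsupp.single M (LaurentPolynomial.T i)) : K0 𝒜) = 0 :=
    (Submodule.Quotient.mk_eq_zero _).mpr (Submodule.subset_span (Or.inr ⟨i, M, rfl⟩))
  rw [sub_eq_zero.mp h, K0.cls, ← Submodule.Quotient.mk_smul, Finsupp.smul_single, smul_eq_mul,
    mul_one]

theorem K0.cls_of_subsingleton (M : GrProj 𝒜) [Subsingleton M.1.carrier] : K0.cls M = 0 := by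
  have : K0.cls M = K0.cls M + K0.cls M := K0.cls_eq_add
    ⟨0, 0, fun _ _ _ => zero_mem _, fun _ _ _ => zero_mem _, fun _ _ _ => Subsingleton.elim _ _,
      fun y => ⟨fun _ => ⟨0, Subsingleton.elim _ _⟩, fun _ => rfl⟩, fun y => ⟨0, Subsingleton.elim _ _⟩⟩
  simpa using this

/-- An isomorphism is a short exact sequence whose third term is zero; the empty direct sum serves
as zero module. -/
theorem K0.cls_congr {M N : GrProj 𝒜} (h : GrIso M.1 N.1) : K0.cls M = K0.cls N := by
  obtain ⟨φ, hφ⟩ := h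
  let Z : GrProj 𝒜 := ⟨piMod (r := 0) fun i => i.elim0, piMod_isProj fun i => i.elim0⟩
  have : Subsingleton Z.1.carrier := inferInstanceAs (Subsingleton (∀ i : Fin 0, _))
  have : K0.cls N = K0.cls M + K0.cls Z := K0.cls_eq_add
    ⟨φ.toLinearMap, 0, fun d m hm => (hφ d m).mp hm, fun _ _ _ => zero_mem _, φ.injective,
      fun y => ⟨fun _ => φ.surjective y, fun _ => rfl⟩, fun y => ⟨0, Subsingleton.elim _ _⟩⟩
  rw [this, K0.cls_of_subsingleton Z, add_zero]

theorem K0.cls_piMod {r : ℕ} (P : Fin r → GrMod C) (hP : ∀ i, (P i).IsProj 𝒜) :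
    K0.cls ⟨piMod P, piMod_isProj hP⟩ = ∑ i, K0.cls ⟨P i, hP i⟩ := by
  induction r with
  | zero =>
    have : Subsingleton (⟨piMod P, piMod_isProj hP⟩ : GrProj 𝒜).1.carrier :=
      inferInstanceAs (Subsingleton (∀ i : Fin 0, (P i).carrier))
    rw [K0.cls_of_subsingleton, Finset.univ_eq_empty, Finset.sum_empty]
  | succ r ih =>
    rw [Fin.sum_univ_succ, ← ih (fun i => P i.succ) fun i => hP i.succ,
      add_comm (K0.cls ⟨P 0, _⟩)]
    let ι : (∀ i : Fin r, (P i.succ).carrier) →ₗ[C] (∀ i, (P i).carrier) :=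
      { toFun := fun x => Fin.cons 0 x
        map_add' := fun x y => by
          funext i; refine Fin.cases ?_ (fun i => ?_) i <;> simp
        map_smul' := fun a x => by
          funext i; refine Fin.cases ?_ (fun i => ?_) i <;> simp }
    let π : (∀ i, (P i).carrier) →ₗ[C] (P 0).carrier := LinearMap.proj 0
    have hι0 : ∀ x, ι x 0 = 0 := fun x => rfl
    have hιs : ∀ x i, ι x (Fin.succ i) = x i := fun x i => rfl
    refine K0.cls_eq_add ⟨ι, π, ?_, ?_, ?_, ?_, ?_⟩
    · intro d m hm i _
      refine Fin.cases ?_ (fun i => ?_) i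
      · exact zero_mem ((P 0).deg d)
      · exact hm i trivial
    · exact fun d m hm => hm 0 trivial
    · intro x y h
      funext i
      exact congrFun h i.succ
    · intro y
      constructor
      · intro hy
        refine ⟨fun i => y i.succ, ?_⟩
        funext i
        refine Fin.cases ?_ (fun i => ?_) i
        · exact hy.symm
        · rfl
      · rintro ⟨x, rfl⟩; rfl
    · intro y
      exact ⟨Fin.cons y 0, rfl⟩

variable (hC : IsBasicGr 𝕜 𝒜 e ε)

include hC in
theorem exists_stdMod_iso (P : GrMod C) (hP : P.IsProj 𝒜) :
    ∃ (r : ℕ) (l : Fin r → Λ) (d : Fin r → ℤ), GrIso (stdMod 𝒜 e l d) P := by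
  obtain ⟨r, l, d, p, hp, he, hbij⟩ := projective_graded_classification hC P hP
  refine ⟨r, l, d, GrIso.of_map_deg (stdMod_isProj hC l d).internal hP.internal
    (LinearEquiv.ofBijective _ hbij) fun j (x : ∀ i, (Ideal.span {e (l i)} : Ideal C)) hx => ?_⟩
  change stdLift l p x ∈ P.deg j
  rw [stdLift_apply]
  refine sum_mem fun i _ => ?_
  have := hP.smul_mem _ _ _ _ (show (x i).1 ∈ 𝒜 (j - d i) from hx i trivial) (hp i)
  rwa [sub_add_cancel] at this

theorem cls_stdMod {r : ℕ} (l : Fin r → Λ) (d : Fin r → ℤ) :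
    K0.cls ⟨stdMod 𝒜 e l d, stdMod_isProj hC l d⟩ = ∑ i, (LaurentPolynomial.T (d i) : ℤ[T;T⁻¹]) •
      K0.cls ⟨leftIdealMod 𝒜 (e (l i)), leftIdealMod_isProj hC (l i)⟩ := by
  refine (K0.cls_piMod _ fun i => (leftIdealMod_isProj hC (l i)).shift (d i)).trans ?_
  exact Finset.sum_congr rfl fun i _ => K0.cls_shift (d i) ⟨_, leftIdealMod_isProj hC (l i)⟩

/-! ### Multiplicities -/

variable (ε) in
/-- The functionals of degree `d` on which `C` acts through the character `ε l`. -/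
def charHom (P : GrMod C) (l : Λ) (d : ℤ) : Submodule 𝕜 (P.carrier → 𝕜) where
  carrier := {ψ | (∀ m n, ψ (m + n) = ψ m + ψ n) ∧ (∀ (a : C) m, ψ (a • m) = ε l a * ψ m) ∧
    ∀ j, j ≠ d → ∀ m ∈ P.deg j, ψ m = 0}
  add_mem' := by
    rintro ψ χ ⟨h1, h2, h3⟩ ⟨h4, h5, h6⟩
    refine ⟨fun m n => ?_, fun a m => ?_, fun j hj m hm => ?_⟩
    · simp only [Pi.add_apply, h1, h4]; ring
    · simp only [Pi.add_apply, h2, h5]; ring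
    · simp only [Pi.add_apply, h3 j hj m hm, h6 j hj m hm, add_zero]
  zero_mem' := ⟨fun _ _ => by simp, fun _ _ => by simp, fun _ _ _ _ => rfl⟩
  smul_mem' := by
    rintro c ψ ⟨h1, h2, h3⟩
    refine ⟨fun m n => ?_, fun a m => ?_, fun j hj m hm => ?_⟩
    · simp only [Pi.smul_apply, h1, smul_eq_mul]; ring
    · simp only [Pi.smul_apply, h2, smul_eq_mul]; ring
    · simp only [Pi.smul_apply, h3 j hj m hm, smul_zero]

omit [Algebra 𝕜 C] [Fintype Λ] in
theorem charHom_zero {P : GrMod C} {l : Λ} {d : ℤ} {ψ : P.carrier → 𝕜} (h : ψ ∈ charHom ε P l d) :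
    ψ 0 = 0 := by
  simpa using h.1 0 0

omit [Algebra 𝕜 C] [Fintype Λ] in
theorem charHom_shift (P : GrMod C) (i : ℤ) (l : Λ) (d : ℤ) :
    charHom ε (P.shift i) l d = charHom ε P l (d - i) := by
  ext ψ
  refine ⟨fun h => ⟨h.1, h.2.1, fun j hj m hm => h.2.2 (j + i) (by omega) m ?_⟩,
    fun h => ⟨h.1, h.2.1, fun j hj m hm => h.2.2 (j - i) (by omega) m hm⟩⟩
  change m ∈ P.deg (j + i - i)
  rwa [add_sub_cancel_right]

/-- Restriction along a map of graded modules. -/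
def charHomMap {P Q : GrMod C} (φ : P.carrier →ₗ[C] Q.carrier)
    (hφ : ∀ d, ∀ m ∈ P.deg d, φ m ∈ Q.deg d) (l : Λ) (d : ℤ) :
    charHom ε Q l d →ₗ[𝕜] charHom ε P l d :=
  (LinearMap.funLeft 𝕜 𝕜 φ).restrict fun ψ h =>
    ⟨fun m n => by simp only [LinearMap.funLeft_apply, map_add, h.1],
      fun a m => by simp only [LinearMap.funLeft_apply, map_smul, h.2.1],
      fun j hj m hm => h.2.2 j hj _ (hφ j m hm)⟩

omit [Algebra 𝕜 C] [Fintype Λ] in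
theorem finrank_charHom_congr {P Q : GrMod C} (h : GrIso P Q) (l : Λ) (d : ℤ) :
    Nonempty (charHom ε P l d ≃ₗ[𝕜] charHom ε Q l d) := by
  obtain ⟨φ, hφ⟩ := h
  refine ⟨LinearEquiv.ofLinearMap
    (charHomMap φ.symm.toLinearMap (fun d m hm => (hφ d _).mpr (by simpa using hm)) l d)
    (charHomMap φ.toLinearMap (fun d m hm => (hφ d m).mp hm) l d) ?_ ?_⟩
  · ext ψ m
    exact congrArg ψ.1 (φ.apply_symm_apply m)
  · ext ψ m
    exact congrArg ψ.1 (φ.symm_apply_apply m)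

-- A functional is determined by its values on the generators. On a generator of another degree it
-- vanishes by definition. On one of another label `l i` it vanishes because the generator equals `e
-- (l i)` times itself and `ε m` kills `e (l i)`. The remaining values are arbitrary, realised by `x
-- ↦ ∑ c i * ε m (x i)`.
include hC in
open Classical in
theorem charHom_stdMod {r : ℕ} (l : Fin r → Λ) (d : Fin r → ℤ) (m : Λ) (j : ℤ) :
    Nonempty (charHom ε (stdMod 𝒜 e l d) m j ≃ₗ[𝕜] ({i // l i = m ∧ d i = j} → 𝕜)) := by
  let toF : charHom ε (stdMod 𝒜 e l d) m j →ₗ[𝕜] ({i // l i = m ∧ d i = j} → 𝕜) :=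
    { toFun := fun ψ i => ψ.1 (stdGen l i.1)
      map_add' := fun _ _ => rfl
      map_smul' := fun _ _ => rfl }
  refine ⟨LinearEquiv.ofBijective toF ⟨?_, ?_⟩⟩
  · rw [injective_iff_map_eq_zero]
    rintro ⟨ψ, hψ⟩ h0
    have hgen : ∀ i, ψ (stdGen l i) = 0 := by
      intro i
      by_cases h1 : l i = m
      · by_cases h2 : d i = j
        · exact congrFun h0 ⟨i, h1, h2⟩
        · refine hψ.2.2 (d i) h2 _ fun t _ => ?_
          change ((stdGen l i) t).1 ∈ 𝒜 (d i - d t)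
          by_cases ht : t = i
          · subst ht
            rw [stdGen, Pi.single_eq_same, sub_self]
            exact hC.e_mem _
          · rw [stdGen, Pi.single_eq_of_ne ht]
            exact zero_mem (𝒜 (d i - d t))
      · have h2 : (stdGen l i : ∀ i, (Ideal.span {e (l i)} : Ideal C)) = e (l i) • stdGen l i := by
          funext t
          refine Subtype.ext ?_
          rw [Pi.smul_apply]
          by_cases ht : t = i
          · subst ht
            rw [stdGen, Pi.single_eq_same]
            exact (hC.e_idem _).symm
          · rw [stdGen, Pi.single_eq_of_ne ht, smul_zero]
        rw [h2]
        refine (hψ.2.1 (e (l i)) _).trans ?_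
        rw [hC.aug_e_ne _ _ (Ne.symm h1), zero_mul]
    refine Subtype.ext (funext fun x => ?_)
    have hx := eq_sum_stdGen l x (fun i => (x i).1) fun i =>
      (mul_of_mem_span_idem (hC.e_idem (l i)) (x i).2).symm
    let Ψ : (∀ i, (Ideal.span {e (l i)} : Ideal C)) →+ 𝕜 := AddMonoidHom.mk' ψ hψ.1
    change Ψ x = 0
    rw [hx, map_sum]
    refine Finset.sum_eq_zero fun i _ => ?_
    refine (hψ.2.1 _ _).trans ?_
    rw [hgen, mul_zero]
  · intro c
    let ψ : (∀ i, (Ideal.span {e (l i)} : Ideal C)) → 𝕜 := fun x =>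
      ∑ i : {i // l i = m ∧ d i = j}, c i * ε m (x i.1).1
    have hψ : ψ ∈ charHom ε (stdMod 𝒜 e l d) m j := by
      refine ⟨fun x y => ?_, fun a x => ?_, fun t ht x hx => ?_⟩
      · simp only [ψ, ← Finset.sum_add_distrib, ← mul_add, ← map_add]
        rfl
      · simp only [ψ, Finset.mul_sum]
        refine Finset.sum_congr rfl fun i _ => ?_
        rw [mul_left_comm, ← map_mul]
        rfl
      · refine Finset.sum_eq_zero fun i _ => ?_
        have h1 : (x i.1).1 ∈ 𝒜 (t - d i.1) := hx i.1 trivial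
        rw [hC.aug_ne m (t - d i.1) _ (by have := i.2.2; omega) h1, mul_zero]
    refine ⟨⟨ψ, hψ⟩, ?_⟩
    funext i
    change ∑ t : {i // l i = m ∧ d i = j}, c t * ε m (stdGen (e := e) l i.1 t.1).1 = c i
    rw [Finset.sum_eq_single i]
    · rw [stdGen, Pi.single_eq_same]
      change c i * ε m (e (l i.1)) = c i
      rw [i.2.1, hC.aug_e, mul_one]
    · intro t _ ht
      rw [stdGen, Pi.single_eq_of_ne (fun h => ht (Subtype.ext h)), ZeroMemClass.coe_zero, map_zero,
        mul_zero]
    · intro h; exact absurd (Finset.mem_univ _) h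

open Classical in
include hC in
theorem finrank_charHom_of_iso {P : GrMod C} {r : ℕ} {l : Fin r → Λ} {d : Fin r → ℤ}
    (h : GrIso (stdMod 𝒜 e l d) P) (m : Λ) (j : ℤ) :
    Module.Finite 𝕜 (charHom ε P m j) ∧
    Module.finrank 𝕜 (charHom ε P m j) = Fintype.card {i // l i = m ∧ d i = j} := by
  obtain ⟨f⟩ := charHom_stdMod hC l d m j
  obtain ⟨g⟩ := finrank_charHom_congr (ε := ε) h m j
  exact ⟨Module.Finite.equiv (f.symm.trans g),
    ((f.symm.trans g).finrank_eq.symm).trans (Module.finrank_pi 𝕜)⟩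

include hC in
theorem finite_charHom {P : GrMod C} (hP : P.IsProj 𝒜) (m : Λ) (j : ℤ) :
    Module.Finite 𝕜 (charHom ε P m j) := by
  obtain ⟨r, l, d, h⟩ := exists_stdMod_iso hC P hP
  exact (finrank_charHom_of_iso hC h m j).1

-- Restriction to `M'` and `M''` gives a short exact sequence of spaces of functionals, because the
-- sequence of modules splits. The splitting need not preserve degrees, which is repaired with the
-- projections `gproj`.
include hC in
theorem finrank_charHom_add {M' M M'' : GrMod C} (hM' : M'.IsProj 𝒜) (hM : M.IsProj 𝒜)
    (hM'' : M''.IsProj 𝒜) (h : ShortExact M' M M'') (l : Λ) (d : ℤ) :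
    Module.finrank 𝕜 (charHom ε M l d) =
      Module.finrank 𝕜 (charHom ε M' l d) + Module.finrank 𝕜 (charHom ε M'' l d) := by
  obtain ⟨ι, π, hι, hπ, hinj, hex, hsurj⟩ := h
  have := hM''.projective
  have := finite_charHom hC hM l d
  obtain ⟨σ, hσ⟩ := Module.projective_lifting_property π LinearMap.id hsurj
  have hσ' : ∀ m, π (σ m) = m := fun m => LinearMap.congr_fun hσ m
  have hρ : ∀ x, ∃ y, ι y = x - σ (π x) := fun x =>
    (hex _).mp (by rw [map_sub, hσ', sub_self])
  choose ρ hρ using hρ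
  have hρadd : ∀ x y, ρ (x + y) = ρ x + ρ y := fun x y => hinj (by
    rw [map_add, hρ, hρ, hρ]; simp only [map_add]; abel)
  have hρsmul : ∀ (a : C) x, ρ (a • x) = a • ρ x := fun a x => hinj (by
    rw [map_smul, hρ, hρ]; simp only [map_smul, smul_sub])
  have hρι : ∀ y, ρ (ι y) = y := fun y => hinj (by
    rw [hρ, (hex _).mpr ⟨y, rfl⟩, map_zero, sub_zero])
  have hρ0 : ρ 0 = 0 := by simpa using hρadd 0 0
  let f := charHomMap (ε := ε) ι hι l d
  let g := charHomMap (ε := ε) π hπ l d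
  have hg : Function.Injective g := by
    rintro ψ χ h
    refine Subtype.ext (funext fun m => ?_)
    obtain ⟨m, rfl⟩ := hsurj m
    exact congrFun (congrArg Subtype.val h) m
  have hf : LinearMap.range f = ⊤ := by
    rw [LinearMap.range_eq_top]
    rintro ⟨ψ, hψ⟩
    -- Projecting to degree `d` first makes the extension homogeneous. It still transforms by `ε l`,
    -- because `ε l` vanishes on scalars of nonzero degree.
    refine ⟨⟨fun m => ψ (ρ (gproj hM.internal d m)), fun m n => ?_, fun a m => ?_,
      fun j hj m hm => ?_⟩, ?_⟩
    · beta_reduce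
      rw [map_add, hρadd, hψ.1]
    · beta_reduce
      refine isInternal_induction hC.internal a ?_ ?_ ?_
      · rw [zero_smul, map_zero, map_zero, zero_mul]
        rw [hρ0, charHom_zero hψ]
      · intro a b ha hb
        rw [add_smul, map_add, hρadd, hψ.1, ha, hb, map_add, add_mul]
      · intro i a ha
        rw [gproj_smul hM.internal hM.smul_mem ha, hρsmul, hψ.2.1]
        by_cases hi : i = 0
        · rw [hi, sub_zero]
        · rw [hC.aug_ne l i a hi ha, zero_mul, zero_mul]
    · beta_reduce
      rw [gproj_of_mem_ne hM.internal hm hj]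
      rw [hρ0, charHom_zero hψ]
    · refine Subtype.ext (funext fun y => ?_)
      change ψ (ρ (gproj hM.internal d (ι y))) = ψ y
      refine isInternal_induction hM'.internal y ?_ ?_ ?_
      · rw [map_zero, map_zero, hρ0]
      · intro x y hx hy
        rw [map_add, map_add, hρadd, hψ.1, hψ.1, hx, hy]
      · intro j y hy
        by_cases hj : j = d
        · subst hj
          rw [gproj_of_mem hM.internal (hι _ _ hy), hρι]
        · rw [gproj_of_mem_ne hM.internal (hι _ _ hy) hj, hψ.2.2 j hj y hy, hρ0,
            charHom_zero hψ]
  have hker : LinearMap.ker f = LinearMap.range g := by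
    ext ψ
    constructor
    · intro h
      have h0 : ∀ y, ψ.1 (ι y) = 0 := fun y => congrFun (congrArg Subtype.val h) y
      have hsub : ∀ x y, π x = π y → ψ.1 x = ψ.1 y := by
        intro x y hxy
        obtain ⟨z, hz⟩ := (hex (x - y)).mp (by rw [map_sub, hxy, sub_self])
        have : x = ι z + y := by rw [hz]; abel
        rw [this, ψ.2.1, h0, zero_add]
      refine ⟨⟨fun m => ψ.1 (σ m), fun m n => ?_, fun a m => ?_, fun j hj m hm => ?_⟩, ?_⟩
      · beta_reduce
        rw [map_add, ψ.2.1]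
      · beta_reduce
        rw [map_smul, ψ.2.2.1]
      -- `ψ` depends only on the image in `M''`, where `σ m` and its component of degree `j` agree.
      · have : ψ.1 (σ m) = ψ.1 (gproj hM.internal j (σ m)) := by
          refine hsub _ _ ?_
          have key : ∀ x, π (gproj hM.internal j x) = gproj hM''.internal j (π x) := by
            intro x
            refine isInternal_induction hM.internal x (by simp) ?_ ?_
            · intro x y hx hy; simp only [map_add, hx, hy]
            · intro i x hx
              by_cases hi : i = j
              · subst hi; rw [gproj_of_mem hM.internal hx, gproj_of_mem hM''.internal (hπ _ _ hx)]
              · rw [gproj_of_mem_ne hM.internal hx hi,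
                  gproj_of_mem_ne hM''.internal (hπ _ _ hx) hi, map_zero]
          rw [key, hσ', gproj_of_mem hM''.internal hm]
        refine this.trans ?_
        exact ψ.2.2.2 j hj _ (gproj_mem hM.internal j _)
      · refine Subtype.ext (funext fun m => ?_)
        exact hsub _ _ (hσ' _)
    · rintro ⟨χ, rfl⟩
      refine Subtype.ext (funext fun y => ?_)
      change χ.1 (π (ι y)) = 0
      rw [(hex _).mpr ⟨y, rfl⟩, charHom_zero χ.2]
  rw [← LinearMap.finrank_range_add_finrank_ker f, hker, hf, finrank_top,
    LinearMap.finrank_range_of_inj hg]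

-- The decomposition into shifts of `C e_l` involves choices, but its multiplicities are dimensions
-- that do not depend on them. This lets additivity on exact sequences be read off from
-- `finrank_charHom_add`.
open Classical in
include hC in
theorem exists_multiplicity (P : GrProj 𝒜) : ∃ p : Λ → ℤ[T;T⁻¹],
    (∀ l d, (p l).coeff d = Module.finrank 𝕜 (charHom ε P.1 l d)) ∧
    K0.cls P = ∑ l, p l • K0.cls ⟨leftIdealMod 𝒜 (e l), leftIdealMod_isProj hC l⟩ := by
  obtain ⟨r, l, d, h⟩ := exists_stdMod_iso hC P.1 P.2
  refine ⟨fun m => ∑ i, if l i = m then LaurentPolynomial.T (d i) else 0, fun m j => ?_, ?_⟩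
  · rw [(finrank_charHom_of_iso hC h m j).2, AddMonoidAlgebra.coeff_sum, Finset.sum_apply',
      Fintype.card_subtype, Finset.card_filter]
    push_cast
    refine Finset.sum_congr rfl fun i _ => ?_
    by_cases h1 : l i = m <;> simp [h1, LaurentPolynomial.T_apply]
  · rw [← K0.cls_congr (M := ⟨stdMod 𝒜 e l d, stdMod_isProj hC l d⟩) h, cls_stdMod hC]
    simp only [Finset.sum_smul]
    rw [Finset.sum_comm]
    refine Finset.sum_congr rfl fun i _ => ?_
    rw [Finset.sum_eq_single (l i)]
    · rw [if_pos rfl]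
    · intro m _ hm; rw [if_neg (Ne.symm hm), zero_smul]
    · intro h; exact absurd (Finset.mem_univ _) h

/-- The graded multiplicities of the modules `C e_l` in a graded projective module. -/
def multiplicity (P : GrProj 𝒜) : Λ → ℤ[T;T⁻¹] := (exists_multiplicity hC P).choose

theorem coeff_multiplicity (P : GrProj 𝒜) (l : Λ) (d : ℤ) :
    (multiplicity hC P l).coeff d = Module.finrank 𝕜 (charHom ε P.1 l d) :=
  (exists_multiplicity hC P).choose_spec.1 l d

theorem cls_eq_sum_multiplicity (P : GrProj 𝒜) : K0.cls P = ∑ l, multiplicity hC P l •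
    K0.cls ⟨leftIdealMod 𝒜 (e l), leftIdealMod_isProj hC l⟩ :=
  (exists_multiplicity hC P).choose_spec.2

theorem multiplicity_shift (i : ℤ) (P : GrProj 𝒜) :
    multiplicity hC ⟨P.1.shift i, P.2.shift i⟩ =
      (LaurentPolynomial.T i : ℤ[T;T⁻¹]) • multiplicity hC P := by
  funext l
  refine LaurentPolynomial.ext fun d => ?_
  have h : ((multiplicity hC ⟨P.1.shift i, P.2.shift i⟩ l).coeff d : ℤ) =
      (multiplicity hC P l).coeff (d - i) := by
    rw [coeff_multiplicity, coeff_multiplicity]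
    exact congrArg (fun V : Submodule 𝕜 (P.1.carrier → 𝕜) => (Module.finrank 𝕜 V : ℤ))
      (charHom_shift P.1 i l d)
  rw [h, Pi.smul_apply, smul_eq_mul, LaurentPolynomial.T, AddMonoidAlgebra.coeff_single_mul_eq_mul_coeff (d - i), one_mul]
  intro j _
  omega

theorem multiplicity_add {M' M M'' : GrProj 𝒜} (h : ShortExact M'.1 M.1 M''.1) :
    multiplicity hC M = multiplicity hC M' + multiplicity hC M'' := by
  funext l
  refine LaurentPolynomial.ext fun d => ?_
  rw [Pi.add_apply, AddMonoidAlgebra.coeff_add, Finsupp.add_apply, coeff_multiplicity,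
    coeff_multiplicity, coeff_multiplicity, finrank_charHom_add hC M'.2 M.2 M''.2 h]
  push_cast
  rfl

/-- Graded multiplicities as a map on the Grothendieck group. -/
def K0.toMultiplicity : K0 𝒜 →ₗ[ℤ[T;T⁻¹]] (Λ → ℤ[T;T⁻¹]) :=
  (Submodule.span ℤ[T;T⁻¹] (K0Rels 𝒜)).liftQ
    (Finsupp.linearCombination ℤ[T;T⁻¹] (multiplicity hC)) (by
      rw [Submodule.span_le]
      rintro _ (⟨M', M, M'', h, rfl⟩ | ⟨i, M, rfl⟩)
      · simp [multiplicity_add hC h]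
      · simp [multiplicity_shift])

theorem K0.toMultiplicity_cls (P : GrProj 𝒜) :
    K0.toMultiplicity hC (K0.cls P) = multiplicity hC P := by
  have : K0.toMultiplicity hC (K0.cls P) =
    Finsupp.linearCombination ℤ[T;T⁻¹] (multiplicity hC) (Finsupp.single P 1) := rfl
  rw [this, Finsupp.linearCombination_single, one_smul]

open Classical in
theorem multiplicity_leftIdealMod (m : Λ) :
    multiplicity hC ⟨leftIdealMod 𝒜 (e m), leftIdealMod_isProj hC m⟩ = Pi.single m 1 := by
  have hiso : GrIso (stdMod 𝒜 e (fun _ : Fin 1 => m) fun _ => 0) (leftIdealMod 𝒜 (e m)) := by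
    refine ⟨LinearEquiv.funUnique (Fin 1) C (Ideal.span {e m} : Ideal C), fun d x => ?_⟩
    constructor
    · intro h
      have := h 0 trivial
      change (x 0).1 ∈ 𝒜 (d - 0) at this
      rw [sub_zero] at this
      exact this
    · intro h i _
      rw [Subsingleton.elim i 0]
      change (x 0).1 ∈ 𝒜 (d - 0)
      rw [sub_zero]
      exact h
  funext l
  refine LaurentPolynomial.ext fun d => ?_
  rw [coeff_multiplicity, (finrank_charHom_of_iso hC hiso l d).2, Fintype.card_subtype,
    Finset.card_filter]
  simp only [Finset.univ_unique, Finset.sum_singleton, Pi.single_apply]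
  by_cases h1 : m = l
  · subst h1
    rw [if_pos rfl, ← LaurentPolynomial.T_zero, LaurentPolynomial.T_apply]
    simp
  · rw [if_neg (Ne.symm h1), if_neg (fun h => h1 h.1)]
    simp

theorem span_range_cls : Submodule.span ℤ[T;T⁻¹] (Set.range (K0.cls (𝒜 := 𝒜))) = ⊤ := by
  rw [eq_top_iff]
  intro x _
  obtain ⟨f, rfl⟩ := Submodule.Quotient.mk_surjective _ x
  induction f using Finsupp.induction_linear with
  | zero => exact zero_mem _
  | add f g hf hg => rw [Submodule.Quotient.mk_add]; exact add_mem (hf trivial) (hg trivial)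
  | single P c =>
    have : (Submodule.Quotient.mk (Finsupp.single P c) : K0 𝒜) = c • K0.cls P := by
      rw [K0.cls, ← Submodule.Quotient.mk_smul, Finsupp.smul_single, smul_eq_mul, mul_one]
    rw [this]
    exact Submodule.smul_mem _ _ (Submodule.subset_span ⟨P, rfl⟩)

/-- The Grothendieck group is free on the classes of the modules `C e_l`. -/
def K0.basis : Module.Basis Λ ℤ[T;T⁻¹] (K0 𝒜) := by
  classical
  refine Module.Basis.ofEquivFun (LinearEquiv.ofLinearMap (K0.toMultiplicity hC)
    (Fintype.linearCombination ℤ[T;T⁻¹]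
      fun l => K0.cls ⟨leftIdealMod 𝒜 (e l), leftIdealMod_isProj hC l⟩) ?_ ?_)
  · refine LinearMap.pi_ext' fun l => LinearMap.ext_ring ?_
    simp [Fintype.linearCombination_apply_single, K0.toMultiplicity_cls, multiplicity_leftIdealMod]
  · refine LinearMap.ext_on_range (span_range_cls (𝒜 := 𝒜)) fun P => ?_
    rw [LinearMap.comp_apply, K0.toMultiplicity_cls, Fintype.linearCombination_apply,
      ← cls_eq_sum_multiplicity hC P]
    rfl

theorem K0.basis_apply (l : Λ) :
    K0.basis hC l = K0.cls ⟨leftIdealMod 𝒜 (e l), leftIdealMod_isProj hC l⟩ := by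
  classical
  rw [K0.basis, Module.Basis.coe_ofEquivFun]
  simp [Fintype.linearCombination_apply_single]

end GradedModules

end

end OSzSar

namespace OSzSar

noncomputable section

universe u v

/-! ### Induction of graded projective modules -/

section Induction

variable {𝕜 : Type u} [Field 𝕜] {A : Type u} [Ring A] [Algebra 𝕜 A] {B : Type u} [Ring B]
  [Algebra 𝕜 B] {𝒜 : ℤ → AddSubgroup A} {ℬ : ℤ → AddSubgroup B} {Λ : Type v} [Fintype Λ]
  {e : Λ → A} {e' : Λ → B} {ε : Λ → A →+* 𝕜} {ε' : Λ → B →+* 𝕜}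

omit [Algebra 𝕜 A] in
theorem GrMod.IsProj.congr {P Q : GrMod A} (h : GrIso P Q) (hP : P.IsProj 𝒜) : Q.IsProj 𝒜 := by
  obtain ⟨φ, hφ⟩ := h
  refine ⟨?_, ?_, ?_, ?_⟩
  · refine isInternal_quotient hP.internal φ.toLinearMap.toAddMonoidHom φ.surjective ?_ ?_
    · intro d m hm
      have : m = 0 := φ.injective (hm.trans (map_zero φ).symm)
      rw [this, map_zero, map_zero]
    · intro d
      ext q
      constructor
      · intro hq
        exact ⟨φ.symm q, (hφ d _).mpr (by rwa [φ.apply_symm_apply]), φ.apply_symm_apply q⟩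
      · rintro ⟨m, hm, rfl⟩
        exact (hφ d m).mp hm
  · intro i j a m ha hm
    obtain ⟨m, rfl⟩ := φ.surjective m
    have := (hφ _ _).mp (hP.smul_mem i j a m ha ((hφ _ _).mpr hm))
    rwa [map_smul] at this
  · have := hP.finite
    exact Module.Finite.equiv φ
  · have := hP.projective
    exact Module.Projective.of_equiv φ

theorem balanced_mk (g : B →+* A) (M : GrMod B) (a : A) (b : B) (m : M.carrier) :
    (Submodule.Quotient.mk ((a * g b) ⊗ₜ[ℤ] m) : (A ⊗[ℤ] M.carrier) ⧸ balanced g M) =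
      Submodule.Quotient.mk (a ⊗ₜ[ℤ] (b • m)) :=
  (Submodule.Quotient.eq _).mpr (Submodule.subset_span ⟨a, b, m, rfl⟩)

variable (hB : IsBasicGr 𝕜 ℬ e' ε') (hA : IsBasicGr 𝕜 𝒜 e ε) (g : B →+* A)
  (hg : ∀ d, ∀ b ∈ ℬ d, g b ∈ 𝒜 d) (hge : ∀ l, g (e' l) = e l)

-- The reason is `A ⊗_B B e' ≅ A g(e')`, applied in each summand. One direction sends `a ⊗ m` to `a`
-- times the image under `g` of the coordinates of `m`; the other sends the generators to `1 ⊗`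
-- generators.
include hB hA hg hge in
theorem induced_iso (P : GrMod B) {r : ℕ} (l : Fin r → Λ) (d : Fin r → ℤ)
    (h : GrIso (stdMod ℬ e' l d) P) : GrIso (stdMod 𝒜 e l d) (induced 𝒜 g P) := by
  obtain ⟨φ₀, hφ₀⟩ := h
  let FB := ∀ i, (Ideal.span {e' (l i)} : Ideal B)
  let FA := ∀ i, (Ideal.span {e (l i)} : Ideal A)
  let φ : FB ≃ₗ[B] P.carrier := φ₀
  have hφ : ∀ j (x : FB), (∀ i, (x i).1 ∈ ℬ (j - d i)) ↔ φ x ∈ P.deg j := fun j x =>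
    ⟨fun h => (hφ₀ j x).mp fun i _ => h i, fun h i => (hφ₀ j x).mpr h i trivial⟩
  have hmem : ∀ (x : FB) i, g (x i).1 ∈ (Ideal.span {e (l i)} : Ideal A) := fun x i => by
    rw [← mul_of_mem_span_idem (hB.e_idem (l i)) (x i).2, map_mul, hge]
    exact Ideal.mul_mem_left _ _ (Ideal.mem_span_singleton_self _)
  let Γ : P.carrier →+ FA := AddMonoidHom.mk' (fun m i => ⟨g (φ.symm m i).1, hmem _ i⟩) (by
    intro x y
    funext i
    refine Subtype.ext ?_
    change g (φ.symm (x + y) i).1 = g (φ.symm x i).1 + g (φ.symm y i).1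
    rw [map_add φ.symm]
    exact map_add g _ _)
  have hΓ : ∀ m i, (Γ m i).1 = g (φ.symm m i).1 := fun _ _ => rfl
  have hΓs : ∀ (b : B) m, Γ (b • m) = g b • Γ m := by
    intro b m
    funext i
    refine Subtype.ext ?_
    rw [hΓ, map_smul, Pi.smul_apply]
    exact map_mul g _ _
  let toF₀ : A ⊗[ℤ] P.carrier →ₗ[A] FA := TensorProduct.AlgebraTensorModule.lift
    (LinearMap.toSpanSingleton A (P.carrier →ₗ[ℤ] FA) Γ.toIntLinearMap)
  have htoF₀ : ∀ a m, toF₀ (a ⊗ₜ m) = a • Γ m := fun _ _ => rfl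
  let Q := (A ⊗[ℤ] P.carrier) ⧸ balanced g P
  let toF : Q →ₗ[A] FA := (balanced g P).liftQ toF₀ (by
    rw [balanced, Submodule.span_le]
    rintro _ ⟨a, b, m, rfl⟩
    rw [SetLike.mem_coe, LinearMap.mem_ker, map_sub, htoF₀, htoF₀, hΓs, mul_smul, sub_self])
  have htoF : ∀ a m, toF (Submodule.Quotient.mk (a ⊗ₜ m)) = a • Γ m := fun _ _ => rfl
  let p : Fin r → Q := fun i => Submodule.Quotient.mk (1 ⊗ₜ[ℤ] φ (stdGen l i))
  have hp : ∀ (a : A) i, a • p i = Submodule.Quotient.mk (a ⊗ₜ[ℤ] φ (stdGen l i)) := by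
    intro a i
    rw [← Submodule.Quotient.mk_smul, TensorProduct.smul_tmul', smul_eq_mul, mul_one]
  have hΓp : ∀ i, Γ (φ (stdGen l i)) = stdGen l i := by
    intro i
    funext j
    refine Subtype.ext ?_
    rw [hΓ, φ.symm_apply_apply]
    by_cases h : j = i
    · subst h
      rw [stdGen, stdGen, Pi.single_eq_same, Pi.single_eq_same, hge]
    · rw [stdGen, stdGen, Pi.single_eq_of_ne h, Pi.single_eq_of_ne h, ZeroMemClass.coe_zero,
        map_zero, ZeroMemClass.coe_zero]
  have h1 : ∀ x : FA, toF (stdLift l p x) = x := by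
    intro x
    rw [stdLift_apply, map_sum]
    conv_rhs => rw [eq_sum_stdGen l x (fun i => (x i).1) fun i =>
      (mul_of_mem_span_idem (hA.e_idem (l i)) (x i).2).symm]
    refine Finset.sum_congr rfl fun i _ => ?_
    rw [map_smul, htoF, hΓp, one_smul]
  have h2 : ∀ t : Q, stdLift l p (toF t) = t := by
    intro t
    obtain ⟨t, rfl⟩ := Submodule.Quotient.mk_surjective _ t
    induction t using TensorProduct.induction_on with
    | zero => simp
    | add x y hx hy => rw [Submodule.Quotient.mk_add, map_add, map_add, hx, hy]
    | tmul a m =>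
      rw [htoF, map_smul, stdLift_apply]
      have h3 : ∀ i, (Γ m i).1 • p i =
          (balanced g P).mkQ (1 ⊗ₜ[ℤ] ((φ.symm m i).1 • φ (stdGen l i))) := by
        intro i
        rw [hΓ, hp, Submodule.mkQ_apply, ← balanced_mk, one_mul]
      have h4 : m = ∑ i, (φ.symm m i).1 • φ (stdGen l i) := by
        conv_lhs => rw [← φ.apply_symm_apply m, eq_sum_stdGen l (φ.symm m) (fun i => (φ.symm m i).1)
          fun i => (mul_of_mem_span_idem (hB.e_idem (l i)) (φ.symm m i).2).symm]
        rw [map_sum]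
        simp only [map_smul]
      have h5 : ∑ i, (Γ m i).1 • p i = (balanced g P).mkQ (1 ⊗ₜ[ℤ] m) := by
        rw [Finset.sum_congr rfl fun i _ => h3 i, ← map_sum, ← TensorProduct.tmul_sum, ← h4]
      rw [h5, ← map_smul, TensorProduct.smul_tmul', smul_eq_mul, mul_one]
      rfl
  refine ⟨LinearEquiv.ofLinearMap (stdLift l p) toF (LinearMap.ext h2) (LinearMap.ext h1), ?_⟩
  have hgen : ∀ i, φ (stdGen l i) ∈ P.deg (d i) := by
    intro i
    rw [← hφ]
    intro j
    by_cases h : j = i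
    · subst h
      rw [stdGen, Pi.single_eq_same, sub_self]
      exact hB.e_mem _
    · rw [stdGen, Pi.single_eq_of_ne h]
      exact zero_mem _
  intro j (x : FA)
  change _ ↔ stdLift l p x ∈ (induced 𝒜 g P).deg j
  constructor
  · intro hx
    rw [stdLift_apply]
    refine sum_mem fun i _ => ?_
    rw [hp]
    exact AddSubgroup.subset_closure ⟨j - d i, d i, (x i).1, φ (stdGen l i), by omega,
      hx i trivial, hgen i, rfl⟩
  · intro hx
    -- The inverse map also preserves degrees. It suffices to check this on the tensors that
    -- generate the homogeneous part, and there it follows from `hg`.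
    have key : ∀ t ∈ (induced 𝒜 g P).deg j, ∀ i, (toF t i).1 ∈ 𝒜 (j - d i) := by
      intro t ht i
      refine AddSubgroup.closure_induction (p := fun t _ => (toF t i).1 ∈ 𝒜 (j - d i)) ?_ ?_ ?_ ?_ ht
      · rintro _ ⟨s, t, a, m, hst, ha, hm, rfl⟩
        rw [htoF]
        change a * g (φ.symm m i).1 ∈ _
        have h3 := hg _ _ ((hφ t (φ.symm m)).mpr (by rwa [φ.apply_symm_apply]) i)
        have h4 := hA.mul_mem _ _ _ _ ha h3
        have h5 : s + (t - d i) = j - d i := by omega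
        rwa [h5] at h4
      · rw [map_zero]; exact zero_mem _
      · intro x y _ _ hx hy
        rw [map_add]
        exact add_mem hx hy
      · intro x _ hx
        rw [map_neg]
        exact neg_mem hx
    intro i _
    have := key _ hx i
    rw [h1] at this
    exact this

include hB hA hg hge in
theorem induced_isProj (P : GrMod B) (hP : P.IsProj ℬ) : (induced 𝒜 g P).IsProj 𝒜 := by
  obtain ⟨r, l, d, h⟩ := exists_stdMod_iso hB P hP
  exact GrMod.IsProj.congr (induced_iso hB hA g hg hge P l d h) (stdMod_isProj hA l d)

/-- The isomorphism of Grothendieck groups that matches the classes of indecomposable projectives. -/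
def K0.basisEquiv : K0 ℬ ≃ₗ[ℤ[T;T⁻¹]] K0 𝒜 := (K0.basis hB).equiv (K0.basis hA) (Equiv.refl Λ)

/-- The equivalence was defined by matching bases, without reference to `g`. It is induction along
`g` because induction keeps the labels and shifts of a decomposition. -/
theorem K0.basisEquiv_apply (P : GrProj ℬ) : K0.basisEquiv hB hA (K0.cls P) =
    K0.cls ⟨induced 𝒜 g P.1, induced_isProj hB hA g hg hge P.1 P.2⟩ := by
  obtain ⟨r, l, d, h⟩ := exists_stdMod_iso hB P.1 P.2
  rw [← K0.cls_congr (M := ⟨stdMod ℬ e' l d, stdMod_isProj hB l d⟩) h,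
    ← K0.cls_congr (M := ⟨stdMod 𝒜 e l d, stdMod_isProj hA l d⟩)
      (induced_iso hB hA g hg hge P.1 l d h), cls_stdMod hB, cls_stdMod hA, map_sum]
  refine Finset.sum_congr rfl fun i _ => ?_
  rw [map_smul, ← K0.basis_apply hB, ← K0.basis_apply hA, K0.basisEquiv, Module.Basis.equiv_apply,
    Equiv.refl_apply]

end Induction

end

end OSzSar

namespace OSzSar

noncomputable section

/-! ### Complete homogeneous symmetric polynomials -/

-- A multiset of size `d + 1` either avoids the new variable or contains it, in which case one copy
-- can be removed. Everything about the ideals `I_b` comes from this recursion.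
open MvPolynomial in
theorem hsymm_option_succ {σ : Type*} [Fintype σ] [DecidableEq σ] (d : ℕ) :
    hsymm (Option σ) ℤ (d + 1) = rename some (hsymm σ ℤ (d + 1)) + X none * hsymm (Option σ) ℤ d := by
  rw [hsymm, ← symOptionSuccEquiv.symm.sum_comp, Fintype.sum_sum_type, add_comm]
  congr 1
  · rw [hsymm, map_sum]
    refine Finset.sum_congr rfl fun s _ => ?_
    rw [← Multiset.prod_hom, Multiset.map_map]
    change (Multiset.map X (Multiset.map some s.1)).prod = _
    rw [Multiset.map_map]
    simp
  · rw [hsymm, Finset.mul_sum]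
    refine Finset.sum_congr rfl fun s _ => ?_
    change (Multiset.map X (none ::ₘ s.1)).prod = _
    rw [Multiset.map_cons, Multiset.prod_cons]

/-- `h_d` in the first `m` of `n` variables. -/
def hLe {n : ℕ} (m : ℕ) (hm : m ≤ n) (d : ℕ) : PolyR n :=
  MvPolynomial.rename (Fin.castLE hm) (MvPolynomial.hsymm (Fin m) ℤ d)

theorem hLe_zero_right {n m : ℕ} (hm : m ≤ n) : hLe m hm 0 = 1 := by simp [hLe]

theorem hLe_zero_left {n : ℕ} (d : ℕ) : hLe 0 (Nat.zero_le n) (d + 1) = 0 := by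
  rw [hLe, MvPolynomial.hsymm]
  simp

theorem hLe_succ {n m : ℕ} (hm : m + 1 ≤ n) (d : ℕ) : hLe (m + 1) hm (d + 1) =
    hLe m (Nat.le_of_succ_le hm) (d + 1) + MvPolynomial.X ⟨m, hm⟩ * hLe (m + 1) hm d := by
  have h := congrArg (MvPolynomial.rename finSuccEquivLast.symm)
    (hsymm_option_succ (σ := Fin m) d)
  rw [map_add, map_mul, MvPolynomial.rename_hsymm, MvPolynomial.rename_hsymm,
    MvPolynomial.rename_rename, MvPolynomial.rename_X] at h
  rw [hLe, h, map_add, map_mul, MvPolynomial.rename_rename, MvPolynomial.rename_X]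
  congr 2
  refine congrArg MvPolynomial.rename (funext fun i => ?_)
  ext
  simp

theorem hPoly_eq_hLe {n : ℕ} (i : Fin n) (d : ℕ) : hPoly i d = hLe (i + 1) i.isLt d := rfl

theorem hPoly_succ {n : ℕ} (i : Fin n) (d : ℕ) :
    hPoly i (d + 1) = hLe i i.isLt.le (d + 1) + MvPolynomial.X i * hPoly i d := by
  rw [hPoly_eq_hLe, hLe_succ]
  rfl

theorem hPoly_castSucc {n : ℕ} (i : Fin n) (d : ℕ) :
    hPoly i.castSucc d = MvPolynomial.rename Fin.castSucc (hPoly i d) := by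
  rw [hPoly, hPoly, MvPolynomial.rename_rename]
  rfl

theorem hLe_castSucc {n m : ℕ} (hm : m ≤ n) (d : ℕ) :
    hLe m (Nat.le_succ_of_le hm) d = MvPolynomial.rename Fin.castSucc (hLe m hm d) := by
  rw [hLe, hLe, MvPolynomial.rename_rename]
  rfl

theorem hLe_isHomogeneous {n m : ℕ} (hm : m ≤ n) (d : ℕ) : (hLe m hm d).IsHomogeneous d := by
  refine MvPolynomial.IsHomogeneous.rename_isHomogeneous ?_
  refine MvPolynomial.IsHomogeneous.sum _ _ _ fun s _ => ?_
  have h : ∀ t : Multiset (Fin m),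
      ((t.map (MvPolynomial.X (R := ℤ))).prod).IsHomogeneous t.card := by
    intro t
    induction t using Multiset.induction_on with
    | empty => simpa using MvPolynomial.isHomogeneous_one _ _
    | cons a t ih =>
      rw [Multiset.map_cons, Multiset.prod_cons, Multiset.card_cons, add_comm]
      exact (MvPolynomial.isHomogeneous_X _ a).mul ih
  have := h s.1
  rwa [s.2] at this

theorem hPoly_isHomogeneous {n : ℕ} (i : Fin n) (d : ℕ) : (hPoly i d).IsHomogeneous d :=
  hLe_isHomogeneous _ d

/-- `h_d` is a monic polynomial of degree `d` in its last variable. -/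
theorem exists_monic_hPoly_last (n d : ℕ) : ∃ P : Polynomial (PolyR n), P.Monic ∧ P.natDegree = d ∧
    hPoly (Fin.last n) d = P.eval₂ (MvPolynomial.rename (R := ℤ) Fin.castSucc).toRingHom
      (MvPolynomial.X (Fin.last n)) := by
  induction d with
  | zero => exact ⟨1, Polynomial.monic_one, by simp, by simp [hPoly_eq_hLe, hLe_zero_right]⟩
  | succ d ih =>
    obtain ⟨P, hP, hd, he⟩ := ih
    have hdeg : (Polynomial.X * P).natDegree = d + 1 := by
      rw [Polynomial.natDegree_X_mul hP.ne_zero, hd]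
    have hlt : (Polynomial.C (hLe n le_rfl (d + 1) : PolyR n)).degree < (Polynomial.X * P).degree := by
      refine lt_of_le_of_lt Polynomial.degree_C_le ?_
      rw [Polynomial.degree_eq_natDegree (Polynomial.monic_X.mul hP).ne_zero, hdeg]
      exact_mod_cast Nat.succ_pos d
    refine ⟨Polynomial.X * P + Polynomial.C (hLe n le_rfl (d + 1)),
      (Polynomial.monic_X.mul hP).add_of_left hlt, ?_, ?_⟩
    · rw [Polynomial.natDegree_add_eq_left_of_degree_lt hlt, hdeg]
    · rw [hPoly_succ, he, Polynomial.eval₂_add, Polynomial.eval₂_mul, Polynomial.eval₂_X,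
        Polynomial.eval₂_C, add_comm (_ * _)]
      congr 1
      exact hLe_castSucc le_rfl (d + 1)

/-! ### Quotients by triangular systems of monic polynomials -/

/-- The `i`-th polynomial is monic of degree `d i` in the `i`-th variable, and involves only the
variables up to this one. -/
def IsTri : ∀ {n : ℕ}, (Fin n → PolyR n) → (Fin n → ℕ) → Prop
  | 0, _, _ => True
  | n + 1, p, d => ∃ p' : Fin n → PolyR n, (∀ j, p j.castSucc = MvPolynomial.rename Fin.castSucc (p' j)) ∧
      IsTri p' (fun j => d j.castSucc) ∧
      ∃ P : Polynomial (PolyR n), P.Monic ∧ P.natDegree = d (Fin.last n) ∧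
        p (Fin.last n) = P.eval₂ (MvPolynomial.rename (R := ℤ) Fin.castSucc).toRingHom
          (MvPolynomial.X (Fin.last n))

/-- The alternative `X i` is admitted in order to compute the rank of the quotient in which one
generator `h_{b_i}` is replaced by `x_i`; see `free_quotient_hIdeal_X`. -/
theorem isTri_of_forall {n : ℕ} (p : Fin n → PolyR n) (d : Fin n → ℕ)
    (h : ∀ i, p i = hPoly i (d i) ∨ p i = MvPolynomial.X i ∧ d i = 1) : IsTri p d := by
  induction n with
  | zero => trivial
  | succ n ih =>
    have h1 : ∀ j : Fin n, ∃ p' : PolyR n, p j.castSucc = MvPolynomial.rename Fin.castSucc p' ∧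
        (p' = hPoly j (d j.castSucc) ∨ p' = MvPolynomial.X j ∧ d j.castSucc = 1) := by
      intro j
      rcases h j.castSucc with h | ⟨h, hd⟩
      · exact ⟨_, h.trans (hPoly_castSucc j _), Or.inl rfl⟩
      · exact ⟨MvPolynomial.X j, by rw [h, MvPolynomial.rename_X], Or.inr ⟨rfl, hd⟩⟩
    choose p' hp' hp'' using h1
    refine ⟨p', hp', ih p' _ hp'', ?_⟩
    rcases h (Fin.last n) with h | ⟨h, hd⟩
    · rw [h]
      exact exists_monic_hPoly_last n _
    · exact ⟨Polynomial.X, Polynomial.monic_X, by rw [hd, Polynomial.natDegree_X],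
        by rw [h, Polynomial.eval₂_X]⟩

/-- Adjoining one more variable subject to a monic equation. -/
theorem nonempty_adjoinRoot_equiv {n : ℕ} (p' : Fin n → PolyR n) (p : Fin (n + 1) → PolyR (n + 1))
    (hp : ∀ j, p j.castSucc = MvPolynomial.rename Fin.castSucc (p' j)) (P : Polynomial (PolyR n))
    (hP : p (Fin.last n) = P.eval₂ (MvPolynomial.rename (R := ℤ) Fin.castSucc).toRingHom
          (MvPolynomial.X (Fin.last n))) :
    Nonempty (AdjoinRoot (P.map (Ideal.Quotient.mk (Ideal.span (Set.range p')))) ≃+*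
      PolyR (n + 1) ⧸ Ideal.span (Set.range p)) := by
  set I' := Ideal.span (Set.range p')
  set I := Ideal.span (Set.range p)
  set P' := P.map (Ideal.Quotient.mk I')
  let F₀ : PolyR (n + 1) →+* AdjoinRoot P' := MvPolynomial.eval₂Hom (Int.castRingHom _)
    (Fin.lastCases (AdjoinRoot.root P')
      fun j => AdjoinRoot.of P' (Ideal.Quotient.mk I' (MvPolynomial.X j)))
  have hF₀last : F₀ (MvPolynomial.X (Fin.last n)) = AdjoinRoot.root P' := by simp [F₀]
  have hF₀c : F₀.comp (MvPolynomial.rename (R := ℤ) Fin.castSucc).toRingHom =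
      (AdjoinRoot.of P').comp (Ideal.Quotient.mk I') := by
    refine MvPolynomial.ringHom_ext' (RingHom.ext_int _ _) fun j => ?_
    simp [F₀]
  have hF₀c' : ∀ x, F₀ (MvPolynomial.rename Fin.castSucc x) =
      AdjoinRoot.of P' (Ideal.Quotient.mk I' x) := fun x => RingHom.congr_fun hF₀c x
  have hF₀I : ∀ a ∈ I, F₀ a = 0 := by
    intro a ha
    have hle : I ≤ RingHom.ker F₀ := by
      rw [Ideal.span_le]
      rintro _ ⟨j, rfl⟩
      rw [SetLike.mem_coe, RingHom.mem_ker]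
      refine Fin.lastCases ?_ (fun j => ?_) j
      · rw [hP, Polynomial.hom_eval₂, hF₀c, hF₀last, ← Polynomial.eval₂_map, AdjoinRoot.eval₂_root]
      · have hj : p' j ∈ I' := Ideal.subset_span ⟨j, rfl⟩
        rw [hp, hF₀c', Ideal.Quotient.eq_zero_iff_mem.mpr hj, map_zero]
    exact hle ha
  let F : PolyR (n + 1) ⧸ I →+* AdjoinRoot P' := Ideal.Quotient.lift I F₀ hF₀I
  let G₀ : PolyR n ⧸ I' →+* PolyR (n + 1) ⧸ I := Ideal.Quotient.lift I'
    ((Ideal.Quotient.mk I).comp (MvPolynomial.rename (R := ℤ) Fin.castSucc).toRingHom) (by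
      intro a ha
      have hle : I' ≤ RingHom.ker
          ((Ideal.Quotient.mk I).comp (MvPolynomial.rename (R := ℤ) Fin.castSucc).toRingHom) := by
        rw [Ideal.span_le]
        rintro _ ⟨j, rfl⟩
        rw [SetLike.mem_coe, RingHom.mem_ker]
        refine Ideal.Quotient.eq_zero_iff_mem.mpr (Ideal.subset_span ⟨j.castSucc, hp j⟩)
      exact hle ha)
  have hG₀ : G₀.comp (Ideal.Quotient.mk I') =
      (Ideal.Quotient.mk I).comp (MvPolynomial.rename (R := ℤ) Fin.castSucc).toRingHom :=
    RingHom.ext fun _ => rfl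
  let G : AdjoinRoot P' →+* PolyR (n + 1) ⧸ I :=
    AdjoinRoot.lift G₀ (Ideal.Quotient.mk I (MvPolynomial.X (Fin.last n))) (by
      rw [Polynomial.eval₂_map, hG₀, ← Polynomial.hom_eval₂, ← hP]
      exact Ideal.Quotient.eq_zero_iff_mem.mpr (Ideal.subset_span ⟨_, rfl⟩))
  have hFmk : ∀ x, F (Ideal.Quotient.mk I x) = F₀ x := fun _ => rfl
  have hGof : ∀ x, G (AdjoinRoot.of P' (Ideal.Quotient.mk I' x)) =
      Ideal.Quotient.mk I (MvPolynomial.rename Fin.castSucc x) := fun x => by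
    simp only [G, AdjoinRoot.lift_of]
    rfl
  have hGroot : G (AdjoinRoot.root P') = Ideal.Quotient.mk I (MvPolynomial.X (Fin.last n)) := by
    simp only [G, AdjoinRoot.lift_root]
  refine ⟨RingEquiv.ofRingHom G F ?_ ?_⟩
  · refine Ideal.Quotient.ringHom_ext (MvPolynomial.ringHom_ext' (RingHom.ext_int _ _) fun j => ?_)
    simp only [RingHom.comp_apply, RingHom.id_apply, hFmk]
    refine Fin.lastCases ?_ (fun j => ?_) j
    · rw [hF₀last, hGroot]
    · rw [← MvPolynomial.rename_X Fin.castSucc, hF₀c', hGof]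
  · refine AdjoinRoot.ringHom_ext (Ideal.Quotient.ringHom_ext
      (MvPolynomial.ringHom_ext' (RingHom.ext_int _ _) fun j => ?_)) ?_
    · simp only [RingHom.comp_apply, RingHom.id_apply]
      rw [hGof, hFmk, hF₀c']
    · simp only [RingHom.comp_apply, RingHom.id_apply]
      rw [hGroot, hFmk, hF₀last]

/-- Adding the variables one at a time gives a tower in which each ring is obtained from the
previous one by adjoining a root of a monic polynomial, so it is free over it with rank the degree;
ranks multiply in towers. -/
theorem IsTri.free {n : ℕ} {p : Fin n → PolyR n} {d : Fin n → ℕ} (h : IsTri p d)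
    (hd : ∀ i, 0 < d i) : Module.Free ℤ (PolyR n ⧸ Ideal.span (Set.range p)) ∧
      Module.Finite ℤ (PolyR n ⧸ Ideal.span (Set.range p)) ∧
      Module.finrank ℤ (PolyR n ⧸ Ideal.span (Set.range p)) = ∏ i, d i := by
  induction n with
  | zero =>
    have hbot : Ideal.span (Set.range p) = ⊥ := by simp
    rw [hbot]
    let f : (PolyR 0 ⧸ (⊥ : Ideal (PolyR 0))) ≃ₗ[ℤ] ℤ :=
      ((RingEquiv.quotientBot (PolyR 0)).trans
        (MvPolynomial.isEmptyAlgEquiv ℤ (Fin 0)).toRingEquiv).toAddEquiv.toIntLinearEquiv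
    exact ⟨Module.Free.of_equiv f.symm, Module.Finite.equiv f.symm, by rw [f.finrank_eq]; simp⟩
  | succ n ih =>
    obtain ⟨p', hp', htri, P, hmon, hdeg, hlast⟩ := h
    obtain ⟨hfree, hfin, hrank⟩ := ih htri fun i => hd _
    obtain ⟨f⟩ := nonempty_adjoinRoot_equiv p' p hp' P hlast
    set Q := PolyR n ⧸ Ideal.span (Set.range p')
    set P' := P.map (Ideal.Quotient.mk (Ideal.span (Set.range p')))
    have hmon' : P'.Monic := hmon.map _
    -- Positive degrees keep `Q` nontrivial; over the zero ring the degree of a monic polynomial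
    -- would be lost.
    have hpos : 0 < Module.finrank ℤ Q := by
      rw [hrank]
      exact Finset.prod_pos fun i _ => hd _
    have : Nontrivial Q := Module.nontrivial_of_finrank_pos hpos
    have := hmon'.free_adjoinRoot
    have := hmon'.finite_adjoinRoot
    have hfree' : Module.Free ℤ (AdjoinRoot P') := Module.Free.trans (R := ℤ) (S := Q)
    have hfin' : Module.Finite ℤ (AdjoinRoot P') := Module.Finite.trans Q _
    have hrank' : Module.finrank Q (AdjoinRoot P') = d (Fin.last n) := by
      rw [(AdjoinRoot.powerBasis' hmon').finrank, AdjoinRoot.powerBasis'_dim,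
        hmon.natDegree_map, hdeg]
    let f' : AdjoinRoot P' ≃ₗ[ℤ] (PolyR (n + 1) ⧸ Ideal.span (Set.range p)) :=
      f.toAddEquiv.toIntLinearEquiv
    refine ⟨Module.Free.of_equiv f', Module.Finite.equiv f', ?_⟩
    rw [← f'.finrank_eq, ← Module.finrank_mul_finrank ℤ Q (AdjoinRoot P'), hrank, hrank',
      Fin.prod_univ_castSucc]

end

end OSzSar

namespace OSzSar

noncomputable section

/-! ### Colon ideals -/

/-- The sequence `R/(J+(v)) → R/(J+(uv)) → R/(J+(u)) → 0`, with first map multiplication by `u`, is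
always exact. If the ranks add up, the kernel of the first map has rank zero, and in a finite free
group only the zero subgroup does. -/
theorem mem_of_mul_mem_of_finrank {R : Type*} [CommRing R] {J : Ideal R} {u v : R}
    (hfree : Module.Free ℤ (R ⧸ (J ⊔ Ideal.span {v})))
    (hfin : Module.Finite ℤ (R ⧸ (J ⊔ Ideal.span {v})))
    (hfin' : Module.Finite ℤ (R ⧸ (J ⊔ Ideal.span {u * v})))
    (hrank : Module.finrank ℤ (R ⧸ (J ⊔ Ideal.span {u * v})) =
      Module.finrank ℤ (R ⧸ (J ⊔ Ideal.span {v})) + Module.finrank ℤ (R ⧸ (J ⊔ Ideal.span {u})))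
    {m : R} (hm : u * m ∈ J ⊔ Ideal.span {u * v}) : m ∈ J ⊔ Ideal.span {v} := by
  set I₁ := J ⊔ Ideal.span {u * v}
  set Iv := J ⊔ Ideal.span {v}
  set Iu := J ⊔ Ideal.span {u}
  have hu : u ∈ Iu := Ideal.mem_sup_right (Ideal.mem_span_singleton_self u)
  have hle : I₁ ≤ Iu := sup_le le_sup_left (by
    rw [Ideal.span_singleton_le_iff_mem]
    exact Ideal.mul_mem_right _ _ hu)
  have hmul : Iv ≤ Submodule.comap (LinearMap.mulLeft R u) I₁ := sup_le
    (fun j hj => Ideal.mem_sup_left (Ideal.mul_mem_left _ _ hj)) (by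
      rw [Submodule.span_le, Set.singleton_subset_iff]
      exact Ideal.mem_sup_right (Ideal.mem_span_singleton_self _))
  let f : (R ⧸ Iv) →ₗ[ℤ] (R ⧸ I₁) :=
    (Submodule.mapQ Iv I₁ (LinearMap.mulLeft R u) hmul).toAddMonoidHom.toIntLinearMap
  let π : (R ⧸ I₁) →ₗ[ℤ] (R ⧸ Iu) := (Ideal.Quotient.factor hle).toAddMonoidHom.toIntLinearMap
  have hf : ∀ x, f (Ideal.Quotient.mk Iv x) = Ideal.Quotient.mk I₁ (u * x) := fun _ => rfl
  have hπ : ∀ x, π (Ideal.Quotient.mk I₁ x) = Ideal.Quotient.mk Iu x := fun _ => rfl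
  have hrange : LinearMap.range f = LinearMap.ker π := by
    ext y
    obtain ⟨y, rfl⟩ := Ideal.Quotient.mk_surjective y
    rw [LinearMap.mem_ker, hπ, Ideal.Quotient.eq_zero_iff_mem]
    constructor
    · rintro ⟨x, hx⟩
      obtain ⟨x, rfl⟩ := Ideal.Quotient.mk_surjective x
      rw [hf, Ideal.Quotient.eq] at hx
      have h1 : y = u * x - (u * x - y) := by ring
      rw [h1]
      exact sub_mem (Ideal.mul_mem_right _ _ hu) (hle hx)
    · intro hy
      obtain ⟨j, hj, z, hz, rfl⟩ := Submodule.mem_sup.mp hy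
      obtain ⟨a, rfl⟩ := Ideal.mem_span_singleton'.mp hz
      refine ⟨Ideal.Quotient.mk Iv a, ?_⟩
      rw [hf, Ideal.Quotient.eq]
      have h1 : u * a - (j + a * u) = -j := by ring
      rw [h1]
      exact neg_mem (Ideal.mem_sup_left hj)
  have hsurj : Function.Surjective π := by
    intro y
    obtain ⟨y, rfl⟩ := Ideal.Quotient.mk_surjective y
    exact ⟨Ideal.Quotient.mk I₁ y, rfl⟩
  have h1 := Submodule.finrank_quotient_add_finrank (LinearMap.ker π)
  rw [π.quotKerEquivRange.finrank_eq, LinearMap.range_eq_top.mpr hsurj, finrank_top, ← hrange] at h1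
  have h2 := Submodule.finrank_quotient_add_finrank (LinearMap.ker f)
  rw [f.quotKerEquivRange.finrank_eq] at h2
  have h3 : Module.finrank ℤ (LinearMap.ker f) = 0 := by omega
  have h4 : LinearMap.ker f = ⊥ := Submodule.finrank_eq_zero.mp h3
  have h5 : Ideal.Quotient.mk Iv m ∈ LinearMap.ker f := by
    rw [LinearMap.mem_ker, hf]
    exact Ideal.Quotient.eq_zero_iff_mem.mpr hm
  rw [h4, Submodule.mem_bot] at h5
  exact Ideal.Quotient.eq_zero_iff_mem.mp h5

/-! ### The ideals `I_b` -/

/-- The ideal `I_b` generated by the `h_{b i}(x_1, …, x_i)`. -/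
def hIdeal {n : ℕ} (b : Fin n → ℕ) : Ideal (PolyR n) :=
  Ideal.span (Set.range fun i : Fin n => hPoly i (b i))

theorem hPoly_mem_hIdeal_self {n : ℕ} (b : Fin n → ℕ) (i : Fin n) : hPoly i (b i) ∈ hIdeal b :=
  Ideal.subset_span ⟨i, rfl⟩

/-- Induction on `i` and `a` through the recursion `h_{a+1}(x_1..x_i) = h_{a+1}(x_1..x_{i-1}) + x_i
h_a(x_1..x_i)`. The condition that `b` drops by at most one per step is what makes the degree `a +
1` large enough for the first term. -/
theorem hPoly_mem_of_le {n : ℕ} {b : Fin n → ℕ} {I : Ideal (PolyR n)} (i : Fin n)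
    (hI : ∀ j ≤ i, hPoly j (b j) ∈ I) (hb : ∀ j j' : Fin n, (j : ℕ) + 1 = j' → j' ≤ i → b j ≤ b j' + 1)
    {a : ℕ} (ha : b i ≤ a) : hPoly i a ∈ I := by
  obtain ⟨i, hi⟩ := i
  induction i generalizing a with
  | zero =>
    induction a, ha using Nat.le_induction with
    | base => exact hI _ le_rfl
    | succ a _ ih =>
      rw [hPoly_succ]
      refine add_mem ?_ (Ideal.mul_mem_left _ _ ih)
      have : hLe 0 (Nat.zero_le n) (a + 1) ∈ I := by rw [hLe_zero_left]; exact zero_mem _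
      exact this
  | succ i ihi =>
    induction a, ha using Nat.le_induction with
    | base => exact hI _ le_rfl
    | succ a ha ih =>
      rw [hPoly_succ]
      refine add_mem ?_ (Ideal.mul_mem_left _ _ ih)
      have h1 := hb ⟨i, (Nat.lt_succ_self i).trans hi⟩ ⟨i + 1, hi⟩ rfl le_rfl
      have hlt : (⟨i, (Nat.lt_succ_self i).trans hi⟩ : Fin n) ≤ ⟨i + 1, hi⟩ := Nat.le_succ i
      exact ihi _ (fun j hj => hI j (hj.trans hlt)) (fun j j' h h' => hb j j' h (h'.trans hlt))
        (h1.trans (Nat.succ_le_succ ha))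

/-- `h_{a+1}` in the variables strictly before `i`. -/
theorem hLe_mem_of_le {n : ℕ} {b : Fin n → ℕ} {I : Ideal (PolyR n)} (i : Fin n)
    (hI : ∀ j < i, hPoly j (b j) ∈ I) (hb : ∀ j j' : Fin n, (j : ℕ) + 1 = j' → j' ≤ i → b j ≤ b j' + 1)
    {a : ℕ} (ha : b i ≤ a) : hLe i i.isLt.le (a + 1) ∈ I := by
  obtain ⟨i, hi⟩ := i
  cases i with
  | zero =>
    have : hLe 0 (Nat.zero_le n) (a + 1) ∈ I := by rw [hLe_zero_left]; exact zero_mem _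
    exact this
  | succ i =>
    have h1 := hb ⟨i, (Nat.lt_succ_self i).trans hi⟩ ⟨i + 1, hi⟩ rfl le_rfl
    have hlt : (⟨i, (Nat.lt_succ_self i).trans hi⟩ : Fin n) < ⟨i + 1, hi⟩ := Nat.lt_succ_self i
    exact hPoly_mem_of_le ⟨i, (Nat.lt_succ_self i).trans hi⟩ (fun j hj => hI j (hj.trans_lt hlt))
      (fun j j' h h' => hb j j' h (h'.trans hlt.le)) (h1.trans (Nat.succ_le_succ ha))

theorem span_range_update {R : Type*} [CommRing R] {n : ℕ} (q : Fin n → R) (i : Fin n) (w : R) :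
    Ideal.span (Set.range (Function.update q i w)) = Ideal.span (q '' {i}ᶜ) ⊔ Ideal.span {w} := by
  have h : Set.range (Function.update q i w) = q '' {i}ᶜ ∪ {w} := by
    ext y
    constructor
    · rintro ⟨j, rfl⟩
      by_cases h : j = i
      · subst h; right; simp
      · left; exact ⟨j, h, by rw [Function.update_of_ne h]⟩
    · rintro (⟨j, hj, rfl⟩ | rfl)
      · exact ⟨j, by rw [Function.update_of_ne hj]⟩
      · exact ⟨i, by simp⟩
  rw [h, Ideal.span_union]

section Step

variable {n : ℕ} {b : Fin n → ℕ} (i : Fin n)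

theorem hPoly_update_self (b : Fin n → ℕ) (i : Fin n) (c : ℕ) :
    (fun j => hPoly j (Function.update b i c j)) =
      Function.update (fun j => hPoly j (b j)) i (hPoly i c) := by
  funext j
  by_cases h : j = i
  · subst h; simp
  · simp [Function.update_of_ne h]

variable (hpos : ∀ j, 0 < b j) (hb : ∀ j j' : Fin n, (j : ℕ) + 1 = j' → j' ≤ i → b j ≤ b j' + 1)

theorem hIdeal_eq_sup (b : Fin n → ℕ) (i : Fin n) : hIdeal b =
    Ideal.span ((fun j => hPoly j (b j)) '' {i}ᶜ) ⊔ Ideal.span {hPoly i (b i)} := by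
  rw [← span_range_update, ← hPoly_update_self, Function.update_eq_self]
  rfl

-- Modulo the generators of smaller index, `h_{b_i+1}` equals `x_i h_{b_i}`: the difference is a
-- complete symmetric polynomial in the earlier variables and lies in their ideal. So raising `b_i`
-- by one replaces a generator `v` by `x_i v`.
include hb in
theorem hIdeal_update_eq_sup : hIdeal (Function.update b i (b i + 1)) =
    Ideal.span ((fun j => hPoly j (b j)) '' {i}ᶜ) ⊔
      Ideal.span {(MvPolynomial.X i : PolyR n) * hPoly i (b i)} := by
  have hmem : hLe i i.isLt.le (b i + 1) ∈ Ideal.span ((fun j => hPoly j (b j)) '' {i}ᶜ) :=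
    hLe_mem_of_le (b := b) (a := b i) i (fun j hj => Ideal.subset_span
      (Set.mem_image_of_mem (fun j => hPoly j (b j)) (show j ∈ ({i}ᶜ : Set (Fin n)) from hj.ne)))
      hb le_rfl
  have h1 : hIdeal (Function.update b i (b i + 1)) =
      Ideal.span ((fun j => hPoly j (b j)) '' {i}ᶜ) ⊔ Ideal.span {hPoly i (b i + 1)} := by
    rw [hIdeal, hPoly_update_self, span_range_update]
  rw [h1]
  generalize Ideal.span ((fun j => hPoly j (b j)) '' {i}ᶜ) = J at *
  have h2 := hPoly_succ i (b i)
  have h3 := eq_sub_of_add_eq' h2.symm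
  generalize hPoly i (b i + 1) = w at *
  refine le_antisymm (sup_le le_sup_left ?_) (sup_le le_sup_left ?_)
  · rw [Ideal.span_singleton_le_iff_mem, h2]
    exact add_mem (Ideal.mem_sup_left hmem)
      (Ideal.mem_sup_right (Ideal.mem_span_singleton_self _))
  · rw [Ideal.span_singleton_le_iff_mem, h3]
    exact sub_mem (Ideal.mem_sup_right (Ideal.mem_span_singleton_self _)) (Ideal.mem_sup_left hmem)

include hpos in
theorem free_quotient_hIdeal : Module.Free ℤ (PolyR n ⧸ hIdeal b) ∧
    Module.Finite ℤ (PolyR n ⧸ hIdeal b) ∧ Module.finrank ℤ (PolyR n ⧸ hIdeal b) = ∏ i, b i :=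
  (isTri_of_forall _ _ fun _ => Or.inl rfl).free hpos

include hpos in
theorem free_quotient_hIdeal_X : Module.Free ℤ (PolyR n ⧸
      (Ideal.span ((fun j => hPoly j (b j)) '' {i}ᶜ) ⊔ Ideal.span {(MvPolynomial.X i : PolyR n)})) ∧
    Module.Finite ℤ (PolyR n ⧸
      (Ideal.span ((fun j => hPoly j (b j)) '' {i}ᶜ) ⊔ Ideal.span {(MvPolynomial.X i : PolyR n)})) ∧
    Module.finrank ℤ (PolyR n ⧸
      (Ideal.span ((fun j => hPoly j (b j)) '' {i}ᶜ) ⊔ Ideal.span {(MvPolynomial.X i : PolyR n)})) =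
    ∏ j, Function.update b i 1 j := by
  rw [← span_range_update]
  refine (isTri_of_forall _ _ fun j => ?_).free fun j => ?_
  · by_cases h : j = i
    · subst h; right; simp
    · left; simp [Function.update_of_ne h]
  · by_cases h : j = i
    · subst h; simp
    · simpa [Function.update_of_ne h] using hpos j

-- With `b_i + 1` in place of `b_i` the product of ranks splits as `b_i + 1` times the rest. This is
-- the additivity required by `mem_of_mul_mem_of_finrank` for the factors `x_i` and `h_{b_i}`.
include hpos hb in
theorem finrank_step : Module.finrank ℤ (PolyR n ⧸ hIdeal (Function.update b i (b i + 1))) =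
    ∏ i, b i + ∏ j, Function.update b i 1 j := by
  rw [(free_quotient_hIdeal (b := Function.update b i (b i + 1)) fun j => ?_).2.2]
  · have h0 : ∏ j, b j = ∏ j, Function.update b i (b i) j := by rw [Function.update_eq_self]
    rw [h0]
    simp only [Finset.prod_update_of_mem (Finset.mem_univ i)]
    ring
  · by_cases h : j = i
    · subst h; simp
    · simpa [Function.update_of_ne h] using hpos j

include hpos hb in
theorem X_mul_mem_hIdeal_update_iff (m : PolyR n) :
    MvPolynomial.X i * m ∈ hIdeal (Function.update b i (b i + 1)) ↔ m ∈ hIdeal b := by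
  have hf := free_quotient_hIdeal hpos
  have hX := free_quotient_hIdeal_X i hpos
  have hr := finrank_step i hpos hb
  have hf' := (free_quotient_hIdeal (b := Function.update b i (b i + 1)) fun j => by
    by_cases h : j = i
    · subst h; simp
    · simpa [Function.update_of_ne h] using hpos j).2.1
  rw [hIdeal_update_eq_sup i hb] at hr hf' ⊢
  rw [hIdeal_eq_sup b i] at hf ⊢
  constructor
  · intro hm
    exact mem_of_mul_mem_of_finrank hf.1 hf.2.1 hf' (by rw [hr, hf.2.2, hX.2.2]) hm
  · intro hm
    obtain ⟨j, hj, z, hz, rfl⟩ := Submodule.mem_sup.mp hm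
    obtain ⟨a, rfl⟩ := Ideal.mem_span_singleton'.mp hz
    rw [mul_add]
    refine add_mem (Ideal.mem_sup_left (Ideal.mul_mem_left _ _ hj)) (Ideal.mem_sup_right ?_)
    rw [mul_left_comm]
    exact Ideal.mul_mem_left _ _ (Ideal.mem_span_singleton_self _)

-- The same rank count as for `X_mul_mem_hIdeal_update_iff`, with the roles of the factors `x_i` and
-- `h_{b_i}` exchanged.
include hpos hb in
theorem exists_of_hPoly_mul_mem (m : PolyR n)
    (hm : hPoly i (b i) * m ∈ hIdeal (Function.update b i (b i + 1))) :
    ∃ s, m - MvPolynomial.X i * s ∈ hIdeal (Function.update b i (b i + 1)) := by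
  have hf := free_quotient_hIdeal hpos
  have hX := free_quotient_hIdeal_X i hpos
  have hr := finrank_step i hpos hb
  have hf' := (free_quotient_hIdeal (b := Function.update b i (b i + 1)) fun j => by
    by_cases h : j = i
    · subst h; simp
    · simpa [Function.update_of_ne h] using hpos j).2.1
  rw [hIdeal_update_eq_sup i hb, mul_comm (MvPolynomial.X i)] at hr hf' hm
  rw [hIdeal_update_eq_sup i hb]
  rw [hIdeal_eq_sup b i] at hf
  have := mem_of_mul_mem_of_finrank hX.1 hX.2.1 hf' (by rw [hr, hf.2.2, hX.2.2, add_comm]) hm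
  obtain ⟨j, hj, z, hz, rfl⟩ := Submodule.mem_sup.mp this
  obtain ⟨a, rfl⟩ := Ideal.mem_span_singleton'.mp hz
  refine ⟨a, Ideal.mem_sup_left ?_⟩
  have : j + a * MvPolynomial.X i - MvPolynomial.X i * a = j := by ring
  rwa [this]

end Step

theorem hIdeal_le_of_le {n : ℕ} {b b' : Fin n → ℕ}
    (hb : ∀ j j' : Fin n, (j : ℕ) + 1 = j' → b j ≤ b j' + 1) (h : ∀ i, b i ≤ b' i) :
    hIdeal b' ≤ hIdeal b := by
  rw [hIdeal, Ideal.span_le]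
  rintro _ ⟨i, rfl⟩
  exact hPoly_mem_of_le i (fun j _ => hPoly_mem_hIdeal_self b j) (fun j j' h _ => hb j j' h) (h i)

/-- The colon ideals of `I_{b'}` by `I_b` and by `x^{b' - b}`, for `b ≤ b'`. -/
theorem hIdeal_colon {n : ℕ} {b : Fin n → ℕ} (hpos : ∀ j, 0 < b j)
    (hb : ∀ j j' : Fin n, (j : ℕ) + 1 = j' → b j ≤ b j' + 1) (N : ℕ) (b' : Fin n → ℕ)
    (hle : ∀ i, b i ≤ b' i) (hN : ∑ i, (b' i - b i) = N) :
    (∀ m, (∏ i, (MvPolynomial.X i : PolyR n) ^ (b' i - b i)) * m ∈ hIdeal b' ↔ m ∈ hIdeal b) ∧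
    ∀ m, (∀ r ∈ hIdeal b, r * m ∈ hIdeal b') →
      ∃ s, m - (∏ i, (MvPolynomial.X i : PolyR n) ^ (b' i - b i)) * s ∈ hIdeal b' := by
  induction N generalizing b' with
  | zero =>
    have h0 : b' = b := by
      funext i
      have := (Finset.sum_eq_zero_iff.mp hN) i (Finset.mem_univ i)
      have := hle i
      omega
    subst h0
    exact ⟨fun m => by simp, fun m _ => ⟨m, by simp⟩⟩
  | succ N ih =>
    have hex : ∃ i, b i < b' i := by
      by_contra! h
      have : ∑ i, (b' i - b i) = 0 := Finset.sum_eq_zero fun i _ => by have := h i; omega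
      omega
    -- `b'` is arbitrary above `b`, so its own steps are not controlled. At the smallest index of
    -- disagreement all earlier entries coincide with those of `b`, and the one-step lemmas only
    -- look at indices up to `i`.
    obtain ⟨i, hi, hmin⟩ : ∃ i, b i < b' i ∧ ∀ j < i, ¬ b j < b' j := by
      have hwf := (Finset.univ.filter fun i => b i < b' i).exists_minimal
        (by obtain ⟨i, hi⟩ := hex; exact ⟨i, by simp [hi]⟩)
      obtain ⟨i, hi⟩ := hwf
      refine ⟨i, by simpa using hi.1, fun j hj hlt => ?_⟩
      exact absurd (hi.2 (by simp [hlt]) hj.le) (not_le.mpr hj)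
    let b₁ : Fin n → ℕ := Function.update b' i (b' i - 1)
    have hb₁i : b₁ i = b' i - 1 := by simp [b₁]
    have hb₁j : ∀ j, j ≠ i → b₁ j = b' j := fun j hj => Function.update_of_ne hj _ _
    have hb' : Function.update b₁ i (b₁ i + 1) = b' := by
      funext j
      by_cases h : j = i
      · subst h; rw [Function.update_self, hb₁i]; omega
      · rw [Function.update_of_ne h, hb₁j j h]
    have hle₁ : ∀ j, b j ≤ b₁ j := by
      intro j
      by_cases h : j = i
      · subst h; rw [hb₁i]; omega
      · rw [hb₁j j h]; exact hle j
    have hpos₁ : ∀ j, 0 < b₁ j := fun j => (hpos j).trans_le (hle₁ j)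
    have hstep : ∀ j j' : Fin n, (j : ℕ) + 1 = j' → j' ≤ i → b₁ j ≤ b₁ j' + 1 := by
      intro j j' h h'
      have hj : j < i := lt_of_lt_of_le (Fin.lt_def.mpr (by omega)) h'
      have h1 : b₁ j = b j := by
        rw [hb₁j j hj.ne]
        have := hmin j hj
        have := hle j
        omega
      rw [h1]
      exact (hb j j' h).trans (Nat.succ_le_succ (hle₁ j'))
    have hsub : ∀ j, b' j - b j = (b₁ j - b j) + (if j = i then 1 else 0) := by
      intro j
      by_cases h : j = i
      · subst h; rw [hb₁i, if_pos rfl]; omega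
      · rw [hb₁j j h, if_neg h, add_zero]
    have hprod : (∏ j, (MvPolynomial.X j : PolyR n) ^ (b' j - b j)) =
        MvPolynomial.X i * ∏ j, (MvPolynomial.X j : PolyR n) ^ (b₁ j - b j) := by
      simp only [hsub, pow_add, Finset.prod_mul_distrib]
      rw [mul_comm]
      congr 1
      rw [Finset.prod_eq_single i]
      · simp
      · intro j _ hj; rw [if_neg hj, pow_zero]
      · intro h; exact absurd (Finset.mem_univ i) h
    have hN₁ : ∑ j, (b₁ j - b j) = N := by
      simp only [hsub, Finset.sum_add_distrib, Finset.sum_ite_eq', Finset.mem_univ, if_true] at hN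
      omega
    obtain ⟨ih1, ih2⟩ := ih b₁ hle₁ hN₁
    have hX := X_mul_mem_hIdeal_update_iff i hpos₁ hstep
    have hV := exists_of_hPoly_mul_mem i hpos₁ hstep
    rw [hb'] at hX hV
    rw [hprod]
    refine ⟨fun m => by rw [mul_assoc, hX, ih1], fun m hm => ?_⟩
    have hv : hPoly i (b₁ i) ∈ hIdeal b := hPoly_mem_of_le i (fun j _ => hPoly_mem_hIdeal_self b j)
      (fun j j' h _ => hb j j' h) (hle₁ i)
    -- The polynomial `h_{b₁ i}` lies in `I_b`, so `m` is killed by it modulo `I_{b'}`; this splits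
    -- off one factor `x_i`.
    obtain ⟨m', hm'⟩ := hV m (hm _ hv)
    obtain ⟨s, hs⟩ := ih2 m' fun r hr => by
      rw [← hX]
      have h1 : MvPolynomial.X i * (r * m') = r * m - r * (m - MvPolynomial.X i * m') := by ring
      rw [h1]
      exact sub_mem (hm r hr) (Ideal.mul_mem_left _ _ hm')
    refine ⟨s, ?_⟩
    have h1 : m - MvPolynomial.X i * (∏ j, (MvPolynomial.X j : PolyR n) ^ (b₁ j - b j)) * s =
        (m - MvPolynomial.X i * m') +
        MvPolynomial.X i * (m' - (∏ j, (MvPolynomial.X j : PolyR n) ^ (b₁ j - b j)) * s) := by ring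
    rw [h1]
    exact add_mem hm' ((hX _).mpr hs)

/-! ### Homomorphisms between the modules `R_b` -/

section Hom

variable {n k : ℕ}

theorem bSeq_pos (μ : LState n k) (i : Fin n) : 0 < bSeq μ i := by rw [bSeq]; omega

theorem bSeq_le_succ (μ : LState n k) (j j' : Fin n) (h : (j : ℕ) + 1 = j') :
    bSeq μ j ≤ bSeq μ j' + 1 := by
  have hsub : μ.1.filter (fun a => j < a) ⊆ insert j' (μ.1.filter fun a => j' < a) := by
    intro a ha
    rw [Finset.mem_filter] at ha
    rw [Finset.mem_insert, Finset.mem_filter]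
    by_cases h1 : a = j'
    · exact Or.inl h1
    · refine Or.inr ⟨ha.1, ?_⟩
      have h2 := ha.2
      rw [Fin.lt_def] at h2 ⊢
      have : (a : ℕ) ≠ j' := fun e => h1 (Fin.ext e)
      omega
  have := (Finset.card_le_card hsub).trans (Finset.card_insert_le _ _)
  rw [bSeq, bSeq]
  omega

/-- The componentwise minimum of the sequences `b^l` and `b^μ`. -/
def bMin (l μ : LState n k) (i : Fin n) : ℕ := min (bSeq μ i) (bSeq l i)

theorem bMin_pos (l μ : LState n k) (i : Fin n) : 0 < bMin l μ i :=
  lt_min (bSeq_pos μ i) (bSeq_pos l i)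

theorem bMin_le_succ (l μ : LState n k) (j j' : Fin n) (h : (j : ℕ) + 1 = j') :
    bMin l μ j ≤ bMin l μ j' + 1 := by
  have h1 := bSeq_le_succ l j j' h
  have h2 := bSeq_le_succ μ j j' h
  rw [bMin, bMin]
  omega

theorem cMono_eq (l μ : LState n k) :
    cMono l μ = ∏ i, (MvPolynomial.X i : PolyR n) ^ (bSeq μ i - bMin l μ i) := by
  refine Finset.prod_congr rfl fun i _ => ?_
  rw [bMin]
  congr 1
  omega

/-- The colon computation needs comparable sequences. This reduces an arbitrary pair to the
comparable pair `bMin l μ ≤ bSeq μ`. -/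
theorem sIdeal_sup (l μ : LState n k) : hIdeal (bMin l μ) ≤ sIdeal l ⊔ sIdeal μ := by
  rw [hIdeal, Ideal.span_le]
  rintro _ ⟨i, rfl⟩
  rcases min_choice (bSeq μ i) (bSeq l i) with h | h
  · simp only [SetLike.mem_coe, bMin, h]
    exact Ideal.mem_sup_right (Ideal.subset_span ⟨i, rfl⟩)
  · simp only [SetLike.mem_coe, bMin, h]
    exact Ideal.mem_sup_left (Ideal.subset_span ⟨i, rfl⟩)

theorem cMono_mul_mem (l μ : LState n k) {r : PolyR n} (hr : r ∈ sIdeal l) :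
    cMono l μ * r ∈ sIdeal μ := by
  have h := (hIdeal_colon (bMin_pos l μ) (bMin_le_succ l μ) _ (bSeq μ) (fun i => min_le_left _ _)
    rfl).1 r
  rw [cMono_eq]
  exact h.mpr (hIdeal_le_of_le (bMin_le_succ l μ) (fun i => min_le_right _ _) hr)

/-- The generator `1 ↦ x^c` of `Hom_R(R_l, R_μ)`. -/
def cHom (l μ : LState n k) : SMod l →ₗ[PolyR n] SMod μ :=
  Submodule.mapQ (sIdeal l) (sIdeal μ) (LinearMap.mulLeft (PolyR n) (cMono l μ)) fun _ hr =>
    cMono_mul_mem l μ hr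

theorem cHom_one (l μ : LState n k) : cHom l μ 1 = Ideal.Quotient.mk (sIdeal μ) (cMono l μ) := by
  change Submodule.Quotient.mk (cMono l μ * 1) = _
  rw [mul_one]
  rfl

theorem smul_mk_one {I : Ideal (PolyR n)} (p q : PolyR n) :
    p • Ideal.Quotient.mk I q = Ideal.Quotient.mk I (p * q) := by
  rfl

theorem sMod_hom_ext {l μ : LState n k} {φ ψ : SMod l →ₗ[PolyR n] SMod μ} (h : φ 1 = ψ 1) :
    φ = ψ := by
  refine LinearMap.ext fun x => ?_
  obtain ⟨x, rfl⟩ := Ideal.Quotient.mk_surjective x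
  have h1 : Ideal.Quotient.mk (sIdeal l) x = x • (1 : SMod l) := by
    rw [← map_one (Ideal.Quotient.mk (sIdeal l)), smul_mk_one, mul_one]
  rw [h1, map_smul, map_smul, h]

/-- A representative `m` of `φ 1` satisfies `I_l m ⊆ I_μ`, and `I_μ m ⊆ I_μ` trivially, so the ideal
of the minimum also multiplies `m` into `I_μ`. The second half of `hIdeal_colon` then divides `m` by
`x^c`. -/
theorem exists_smul_cHom {l μ : LState n k} (φ : SMod l →ₗ[PolyR n] SMod μ) :
    ∃ s : PolyR n, φ = s • cHom l μ := by
  obtain ⟨m, hm⟩ := Ideal.Quotient.mk_surjective (φ 1)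
  have hkill : ∀ r ∈ sIdeal l, r * m ∈ sIdeal μ := by
    intro r hr
    rw [← Ideal.Quotient.eq_zero_iff_mem, ← smul_mk_one, hm, ← map_smul]
    have : r • (1 : SMod l) = 0 := by
      rw [← map_one (Ideal.Quotient.mk (sIdeal l)), smul_mk_one, mul_one]
      exact Ideal.Quotient.eq_zero_iff_mem.mpr hr
    rw [this, map_zero]
  obtain ⟨s, hs⟩ := (hIdeal_colon (bMin_pos l μ) (bMin_le_succ l μ) _ (bSeq μ)
    (fun i => min_le_left _ _) rfl).2 m fun r hr => by
      obtain ⟨x, hx, y, hy, rfl⟩ := Submodule.mem_sup.mp (sIdeal_sup l μ hr)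
      rw [add_mul]
      exact add_mem (hkill x hx) (Ideal.mul_mem_right _ _ hy)
  refine ⟨s, sMod_hom_ext ?_⟩
  rw [LinearMap.smul_apply, cHom_one, smul_mk_one, ← hm, Ideal.Quotient.eq, cMono_eq, mul_comm s]
  exact hs

end Hom

end

end OSzSar

namespace OSzSar

noncomputable section

universe u

/-! ### Rings spanned by arrows between I-states -/

/-- Additive maps that identify both sides of the relations in all products identify both sides of
the generated congruence. -/
theorem map_eq_of_ringConGen {S N : Type*} [Ring S] [AddCommGroup N] {r : S → S → Prop} (Θ : S →+ N)
    (h : ∀ a b, r a b → ∀ u v, Θ (u * a * v) = Θ (u * b * v)) {a b : S} (hab : ringConGen r a b) :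
    Θ a = Θ b := by
  -- Quantifying over both outer factors is what makes this relation multiplicative.
  let s : RingCon S :=
    { r := fun a b => ∀ u v, Θ (u * a * v) = Θ (u * b * v)
      iseqv := ⟨fun _ _ _ => rfl, fun h u v => (h u v).symm, fun h h' u v => (h u v).trans (h' u v)⟩
      add' := fun {a b c d} h h' u v => by
        simp only [mul_add, add_mul, map_add, h u v, h' u v]
      mul' := fun {a b c d} h h' u v => by
        have h1 := h u (c * v)
        have h2 := h' (u * b) v
        simp only [mul_assoc] at h1 h2 ⊢
        rw [h1, h2] }
  have hle : ringConGen r ≤ s := RingCon.ringConGen_le.mpr fun a b hab => h a b hab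
  have := hle hab 1 1
  simpa using this

section HomogeneousComponents

variable {n : ℕ}

/-- The homogeneous component of degree `e`, where the variables have degree `2`. -/
def evenComp (e : ℤ) : PolyR n →+ PolyR n :=
  if 0 ≤ e ∧ e % 2 = 0 then (MvPolynomial.homogeneousComponent (e / 2).toNat).toAddMonoidHom else 0

theorem evenComp_of_eq {e : ℤ} {m : ℕ} {p : PolyR n} (hp : p.IsHomogeneous m) (h : 2 * (m : ℤ) = e) :
    evenComp e p = p := by
  have h1 : (e / 2).toNat = m := by omega
  rw [evenComp, if_pos ⟨by omega, by omega⟩, h1]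
  exact (MvPolynomial.homogeneousComponent_of_mem hp).trans (if_pos rfl)

theorem evenComp_of_ne {e : ℤ} {m : ℕ} {p : PolyR n} (hp : p.IsHomogeneous m) (h : 2 * (m : ℤ) ≠ e) :
    evenComp e p = 0 := by
  rw [evenComp]
  split_ifs with he
  · exact (MvPolynomial.homogeneousComponent_of_mem hp).trans (if_neg (by omega))
  · rfl

theorem evenComp_isHomogeneous (e : ℤ) (p : PolyR n) :
    evenComp e p = 0 ∨ ∃ m : ℕ, 2 * (m : ℤ) = e ∧ (evenComp e p).IsHomogeneous m := by
  rw [evenComp]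
  split_ifs with he
  · exact Or.inr ⟨(e / 2).toNat, by omega, MvPolynomial.homogeneousComponent_isHomogeneous _ p⟩
  · exact Or.inl rfl

@[elab_as_elim]
theorem homogeneous_induction {P : PolyR n → Prop} (p : PolyR n) (h0 : P 0)
    (hadd : ∀ p q, P p → P q → P (p + q)) (hom : ∀ m p, p.IsHomogeneous m → P p) : P p := by
  rw [← MvPolynomial.sum_homogeneousComponent p]
  exact Finset.sum_induction _ P hadd h0 fun i _ =>
    hom i _ (MvPolynomial.homogeneousComponent_isHomogeneous i p)

end HomogeneousComponents

/-! ### Weights, degrees and the cocycle of monomials -/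

section Weights

variable {n k : ℕ}

/-- The monomial in the relation `f_{x,y} f_{y,z} = U^g f_{x,z}`. -/
def gMono (x y z : IState n k) : PolyR n := ∏ j : Fin n, (MvPolynomial.X j : PolyR n) ^ gExp x y z j

/-- The degree of `f_{x,y}`. -/
def arrowDeg (x y : IState n k) : ℤ := ∑ j : Fin n, (wtDist x y j : ℤ)

theorem two_mul_gExp (x y z : IState n k) (j : Fin n) :
    2 * gExp x y z j + wtDist x z j = wtDist x y j + wtDist y z j := by
  unfold gExp wtDist
  omega

theorem gMono_self_left (x y : IState n k) : gMono x x y = 1 :=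
  Finset.prod_eq_one fun j _ => by simp [gExp, wtDist]

theorem gMono_self_right (x y : IState n k) : gMono x y y = 1 :=
  Finset.prod_eq_one fun j _ => by simp [gExp, wtDist]

/-- This is associativity of the multiplication of arrows. It makes the monomial matrix units of
`b0Rep` satisfy the relations of `B₀(n,k)`. -/
theorem gMono_cocycle (x y z w : IState n k) :
    gMono x y w * gMono y z w = gMono x y z * gMono x z w := by
  simp only [gMono, ← Finset.prod_mul_distrib, ← pow_add]
  refine Finset.prod_congr rfl fun j _ => ?_
  congr 1
  have h1 := two_mul_gExp x y w j
  have h2 := two_mul_gExp y z w j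
  have h3 := two_mul_gExp x y z j
  have h4 := two_mul_gExp x z w j
  omega

theorem gMono_isHomogeneous (x y z : IState n k) :
    (gMono x y z).IsHomogeneous (∑ j : Fin n, gExp x y z j) :=
  MvPolynomial.IsHomogeneous.prod _ _ _ fun j _ => MvPolynomial.isHomogeneous_X_pow j _

theorem two_mul_sum_gExp (x y z : IState n k) :
    2 * ((∑ j : Fin n, gExp x y z j : ℕ) : ℤ) + arrowDeg x z = arrowDeg x y + arrowDeg y z := by
  simp only [arrowDeg, Nat.cast_sum, Finset.mul_sum, ← Finset.sum_add_distrib]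
  refine Finset.sum_congr rfl fun j _ => ?_
  exact_mod_cast two_mul_gExp x y z j

theorem arrowDeg_nonneg (x y : IState n k) : 0 ≤ arrowDeg x y :=
  Finset.sum_nonneg fun _ _ => Int.natCast_nonneg _

theorem arrowDeg_self (x : IState n k) : arrowDeg x x = 0 :=
  Finset.sum_eq_zero fun j _ => by simp [wtDist]

theorem eq_of_wt_eq {x y : IState n k} (h : ∀ j, wt x j = wt y j) : x = y := by
  -- The weights extended to all indices: the count is `k` at index `0` and zero beyond `n`. An
  -- element belongs to the state exactly where the count drops.
  let W : IState n k → ℕ → ℕ := fun x i => (x.1.filter fun a : Fin (n + 1) => i ≤ (a : ℕ)).card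
  have hW : ∀ i, W x i = W y i := by
    intro i
    rcases i with _ | i
    · simp [W, x.2, y.2]
    · by_cases hi : i < n
      · exact h ⟨i, hi⟩
      · have : ∀ z : IState n k, W z (i + 1) = 0 := fun z => by
          rw [Finset.card_eq_zero, Finset.filter_eq_empty_iff]
          intro a _
          have := a.isLt
          omega
        rw [this, this]
  have hmem : ∀ (z : IState n k) (a : Fin (n + 1)), a ∈ z.1 ↔ W z a = W z (a + 1) + 1 := by
    intro z a
    have h1 : z.1.filter (fun b : Fin (n + 1) => (a : ℕ) ≤ b) =
        z.1.filter (fun b : Fin (n + 1) => (a : ℕ) + 1 ≤ b) ∪ z.1.filter (fun b => b = a) := by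
      ext b
      simp only [Finset.mem_filter, Finset.mem_union, Fin.ext_iff]
      grind
    have h2 : W z a = W z (a + 1) + (z.1.filter (fun b => b = a)).card := by
      simp only [W]
      rw [h1, Finset.card_union_of_disjoint]
      rw [Finset.disjoint_left]
      intro b hb hb'
      rw [Finset.mem_filter] at hb hb'
      have := hb.2
      rw [hb'.2] at this
      omega
    rw [h2, Finset.filter_eq']
    split_ifs with h <;> simp [h]
  exact Subtype.ext (Finset.ext fun a => by rw [hmem, hmem, hW, hW])

theorem eq_of_arrowDeg_eq_zero {x y : IState n k} (h : arrowDeg x y = 0) : x = y := by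
  refine eq_of_wt_eq fun j => ?_
  have := (Finset.sum_eq_zero_iff_of_nonneg fun _ _ => Int.natCast_nonneg _).mp h j
    (Finset.mem_univ j)
  unfold wtDist at this
  omega

end Weights

/-- A ring that is additively spanned by the polynomial multiples `g x y p` of arrows from `x` to `y`
which multiply as in `B₀(n,k)`. -/
structure ArrowFamily {n k : ℕ} {Λ : Type} [Fintype Λ] (τ : Λ → IState n k) {S : Type*} [Ring S]
    (g : Λ → Λ → PolyR n →+ S) : Prop where
  mul : ∀ x y z p q, g x y p * g y z q = g x z (p * q * gMono (τ x) (τ y) (τ z))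
  orth : ∀ x y z w p q, y ≠ z → g x y p * g z w q = 0
  one : ∑ x, g x x 1 = 1
  span : ∀ s, ∃ p : Λ → Λ → PolyR n, s = ∑ x, ∑ y, g x y (p x y)

/-- The grading in which the arrow from `x` to `y` has degree `∑ |v_i^x - v_i^y|`. -/
def arrowGr {n k : ℕ} {Λ : Type} (τ : Λ → IState n k) {S : Type*} [AddCommGroup S]
    (g : Λ → Λ → PolyR n →+ S) (d : ℤ) : AddSubgroup S :=
  AddSubgroup.closure {b | ∃ (x y : Λ) (p : PolyR n) (m : ℕ), p.IsHomogeneous m ∧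
    2 * (m : ℤ) + arrowDeg (τ x) (τ y) = d ∧ b = g x y p}

section ArrowFamily

variable {n k : ℕ} {Λ : Type} [Fintype Λ] {τ : Λ → IState n k} {S : Type*} [Ring S]
  {g : Λ → Λ → PolyR n →+ S}

omit [Fintype Λ] in
theorem mem_arrowGr {x y : Λ} {p : PolyR n} {m : ℕ} (hp : p.IsHomogeneous m) :
    g x y p ∈ arrowGr τ g (2 * (m : ℤ) + arrowDeg (τ x) (τ y)) :=
  AddSubgroup.subset_closure ⟨x, y, p, m, hp, rfl, rfl⟩

/-- The arrows define a grading if the relations between them are homogeneous. -/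
theorem arrowGr_isInternal (hspan : ∀ s, ∃ p : Λ → Λ → PolyR n, s = ∑ x, ∑ y, g x y (p x y))
    (hk : ∀ p : Λ → Λ → PolyR n, ∑ x, ∑ y, g x y (p x y) = 0 →
      ∀ d, ∑ x, ∑ y, g x y (evenComp (d - arrowDeg (τ x) (τ y)) (p x y)) = 0) :
    DirectSum.IsInternal (arrowGr τ g) := by
  classical
  let F : (Λ → Λ → PolyR n) →+ S :=
    { toFun := fun p => ∑ x, ∑ y, g x y (p x y)
      map_zero' := by simp
      map_add' := fun p q => by simp [Finset.sum_add_distrib] }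
  let E : ℤ → (Λ → Λ → PolyR n) →+ S := fun d =>
    { toFun := fun p => ∑ x, ∑ y, g x y (evenComp (d - arrowDeg (τ x) (τ y)) (p x y))
      map_zero' := by simp
      map_add' := fun p q => by simp [Finset.sum_add_distrib] }
  have hF : Function.Surjective F := fun s => (hspan s).imp fun p hp => hp.symm
  -- The projection is defined on coefficients; it descends to `S` exactly because components of
  -- relations are relations.
  let π : ∀ d : ℤ, S →+ S := fun d => (F.liftOfSurjective hF) ⟨E d, fun p hp => hk p hp d⟩
  have hπ : ∀ d p, π d (F p) = E d p := fun d p =>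
    AddMonoidHom.liftOfRightInverse_comp_apply F _ (Function.rightInverse_surjInv hF) _ p
  have hsingle : ∀ x y p, F (Pi.single x (Pi.single y p)) = g x y p := by
    intro x y p
    change ∑ x', ∑ y', g x' y' _ = _
    rw [Finset.sum_eq_single x, Finset.sum_eq_single y]
    · simp
    · intro y' _ hy; simp [hy]
    · simp
    · intro x' _ hx; simp [hx]
    · simp
  have hπg : ∀ d x y p, π d (g x y p) = g x y (evenComp (d - arrowDeg (τ x) (τ y)) p) := by
    intro d x y p
    rw [← hsingle, hπ]
    change ∑ x', ∑ y', g x' y' _ = _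
    rw [Finset.sum_eq_single x, Finset.sum_eq_single y]
    · simp
    · intro y' _ hy; simp [hy]
    · simp
    · intro x' _ hx; simp [hx]
    · simp
  refine isInternal_of_separating ?_ π ?_ ?_
  · rw [eq_top_iff]
    intro s _
    obtain ⟨p, rfl⟩ := hspan s
    refine sum_mem fun x _ => sum_mem fun y _ => ?_
    refine homogeneous_induction (p x y) (by simp) ?_ ?_
    · intro p q hp hq; rw [map_add]; exact add_mem hp hq
    · intro m p hp
      exact (le_iSup (arrowGr τ g) _) (mem_arrowGr hp)
  · intro d j hj s hs
    refine AddSubgroup.closure_induction ?_ (by simp) ?_ ?_ hs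
    · rintro _ ⟨x, y, p, m, hp, rfl, rfl⟩
      rw [hπg, evenComp_of_ne hp (by omega), map_zero]
    · intro x y _ _ hx hy; rw [map_add, hx, hy, add_zero]
    · intro x _ hx; rw [map_neg, hx, neg_zero]
  · intro d s hs h0
    rw [← h0]
    refine (AddSubgroup.closure_induction (p := fun s _ => π d s = s) ?_ (by simp) ?_ ?_ hs).symm
    · rintro _ ⟨x, y, p, m, hp, rfl, rfl⟩
      rw [hπg, evenComp_of_eq hp (by omega)]
    · intro x y _ _ hx hy; rw [map_add, hx, hy]
    · intro x _ hx; rw [map_neg, hx]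

omit [Fintype Λ] in
theorem gproj_arrow (h : DirectSum.IsInternal (arrowGr τ g)) (d : ℤ) (x y : Λ) (p : PolyR n) :
    gproj h d (g x y p) = g x y (evenComp (d - arrowDeg (τ x) (τ y)) p) := by
  refine homogeneous_induction p (by simp) ?_ ?_
  · intro p q hp hq; simp only [map_add, hp, hq]
  · intro m p hp
    by_cases hd : 2 * (m : ℤ) + arrowDeg (τ x) (τ y) = d
    · rw [evenComp_of_eq hp (by omega), gproj_of_mem h (hd ▸ mem_arrowGr hp)]
    · rw [evenComp_of_ne hp (by omega), map_zero, gproj_of_mem_ne h (mem_arrowGr hp) hd]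

theorem ArrowFamily.mul_mem (hg : ArrowFamily τ g) (i j : ℤ) (a b : S) (ha : a ∈ arrowGr τ g i)
    (hb : b ∈ arrowGr τ g j) : a * b ∈ arrowGr τ g (i + j) := by
  classical
  refine AddSubgroup.closure_induction ?_ (by simp) ?_ ?_ ha
  · rintro _ ⟨x, y, p, m, hp, rfl, rfl⟩
    refine AddSubgroup.closure_induction ?_ (by simp) ?_ ?_ hb
    · rintro _ ⟨z, w, q, m', hq, rfl, rfl⟩
      by_cases hyz : y = z
      · subst hyz
        rw [hg.mul]
        have h1 := mem_arrowGr (τ := τ) (g := g) (x := x) (y := w)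
          ((hp.mul hq).mul (gMono_isHomogeneous (τ x) (τ y) (τ w)))
        have h2 := two_mul_sum_gExp (τ x) (τ y) (τ w)
        convert h1 using 2
        push_cast at h2 ⊢
        linarith
      · rw [hg.orth _ _ _ _ _ _ hyz]; exact zero_mem _
    · intro a b _ _ ha hb; rw [mul_add]; exact add_mem ha hb
    · intro a _ ha; rw [mul_neg]; exact neg_mem ha
  · intro a b _ _ ha hb; rw [add_mul]; exact add_mem ha hb
  · intro a _ ha; rw [neg_mul]; exact neg_mem ha

/-- The images of the arrows in a quotient. -/
theorem ArrowFamily.map (hg : ArrowFamily τ g) {Q : Type*} [Ring Q] (f : S →+* Q)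
    (hf : Function.Surjective f) : ArrowFamily τ fun x y => f.toAddMonoidHom.comp (g x y) where
  mul x y z p q := by
    change f _ * f _ = f _
    rw [← map_mul, hg.mul]
  orth x y z w p q h := by
    change f _ * f _ = 0
    rw [← map_mul, hg.orth _ _ _ _ _ _ h, map_zero]
  one := by
    change ∑ x, f _ = 1
    rw [← map_sum, hg.one, map_one]
  span s := by
    obtain ⟨s, rfl⟩ := hf s
    obtain ⟨p, rfl⟩ := hg.span s
    exact ⟨p, by simp⟩

omit [Fintype Λ] in
theorem arrowGr_map {Q : Type*} [Ring Q] (f : S →+* Q) (d : ℤ) :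
    arrowGr τ (fun x y => f.toAddMonoidHom.comp (g x y)) d = (arrowGr τ g d).map f.toAddMonoidHom := by
  rw [arrowGr, arrowGr, AddMonoidHom.map_closure]
  congr 1
  ext b
  constructor
  · rintro ⟨x, y, p, m, hp, hd, rfl⟩
    exact ⟨_, ⟨x, y, p, m, hp, hd, rfl⟩, rfl⟩
  · rintro ⟨_, ⟨x, y, p, m, hp, hd, rfl⟩, rfl⟩
    exact ⟨x, y, p, m, hp, hd, rfl⟩

/-- The grading descends to quotients by homogeneous relations. -/
theorem ArrowFamily.isInternal_quotient (hg : ArrowFamily τ g)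
    (h : DirectSum.IsInternal (arrowGr τ g)) {Q : Type*} [Ring Q] (f : S →+* Q)
    (hf : Function.Surjective f) {r : S → S → Prop} (hk : ∀ s, f s = 0 → ringConGen r s 0)
    (hr : ∀ a b, r a b → a - b ∈ AddSubgroup.closure {s | (∃ d, s ∈ arrowGr τ g d) ∧ f s = 0}) :
    DirectSum.IsInternal (arrowGr τ fun x y => f.toAddMonoidHom.comp (g x y)) := by
  refine OSzSar.isInternal_quotient h f.toAddMonoidHom hf ?_ (arrowGr_map _)
  intro d s hs
  let Θ := f.toAddMonoidHom.comp (gproj h d)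
  refine (map_eq_of_ringConGen Θ (fun a b hab u v => ?_) (hk s hs)).trans (map_zero Θ)
  change f (gproj h d _) = f (gproj h d _)
  rw [← sub_eq_zero, ← map_sub, ← map_sub, ← sub_mul, ← mul_sub]
  refine AddSubgroup.closure_induction (p := fun s _ => f (gproj h d (u * s * v)) = 0) ?_
    (by simp) ?_ ?_ (hr a b hab)
  · rintro s ⟨⟨j, hj⟩, hs⟩
    exact gproj_mem_of_generators h hg.mul_mem _ hs hj d u v
  · intro s t _ _ hs ht
    rw [mul_add, add_mul, map_add, map_add, hs, ht, add_zero]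
  · intro s _ hs
    rw [mul_neg, neg_mul, map_neg, map_neg, hs, neg_zero]

end ArrowFamily

/-! ### Base change of arrow families to a field -/

section BaseChange

variable (𝕜 : Type u) [Field 𝕜] {S : Type} [Ring S]

/-- The base change of a character with values in `ℤ`. -/
def baseAug (η : S →+* ℤ) : 𝕜 ⊗[ℤ] S →+* 𝕜 :=
  (Algebra.TensorProduct.lift (AlgHom.id ℤ 𝕜) ((Algebra.ofId ℤ 𝕜).comp η.toIntAlgHom)
    fun _ _ => Commute.all _ _).toRingHom

theorem baseAug_tmul (η : S →+* ℤ) (c : 𝕜) (s : S) : baseAug 𝕜 η (c ⊗ₜ s) = c * (η s : 𝕜) := by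
  change Algebra.TensorProduct.lift _ _ _ (c ⊗ₜ[ℤ] s) = _
  rw [Algebra.TensorProduct.lift_tmul]
  simp

variable {n k : ℕ} {Λ : Type} [Fintype Λ] [DecidableEq Λ] {τ : Λ → IState n k}
  {g : Λ → Λ → PolyR n →+ S}

-- Both contributions to the degree are nonnegative, so both vanish. An arrow of degree zero is a
-- loop, since the weights determine the state, and its coefficient is an integer constant.
omit [DecidableEq Λ] in
theorem eq_sum_of_mem_arrowGr_zero (hτ : Function.Injective τ) {s : S} (hs : s ∈ arrowGr τ g 0) :
    ∃ z : Λ → ℤ, s = ∑ l, z l • g l l 1 := by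
  classical
  refine AddSubgroup.closure_induction ?_ ⟨0, by simp⟩ ?_ ?_ hs
  · rintro _ ⟨x, y, p, m, hp, hd, rfl⟩
    have h0 := arrowDeg_nonneg (τ x) (τ y)
    have hm : m = 0 := by omega
    obtain rfl : x = y := hτ (eq_of_arrowDeg_eq_zero (by omega))
    subst hm
    obtain ⟨c, rfl⟩ : ∃ c : ℤ, p = MvPolynomial.C c :=
      ⟨_, MvPolynomial.totalDegree_eq_zero_iff_eq_C.mp
        ((MvPolynomial.totalDegree_zero_iff_isHomogeneous (p := p)).mpr hp)⟩
    refine ⟨Pi.single x c, ?_⟩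
    rw [Finset.sum_eq_single x]
    · rw [Pi.single_eq_same, ← map_zsmul]
      simp
    · intro y _ hy; simp [hy]
    · simp
  · rintro _ _ _ _ ⟨z, rfl⟩ ⟨w, rfl⟩
    exact ⟨z + w, by simp [add_smul, Finset.sum_add_distrib]⟩
  · rintro _ _ ⟨z, rfl⟩
    exact ⟨-z, by simp⟩

/-- The base change of a graded ring spanned by arrows is nonnegatively graded, with part of degree
zero spanned by the trivial arrows. -/
theorem ArrowFamily.isBasicGr (hg : ArrowFamily τ g) (hτ : Function.Injective τ)
    (h : DirectSum.IsInternal (arrowGr τ g)) (η : Λ → S →+* ℤ)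
    (hη : ∀ l x y p, η l (g x y p) = if x = l ∧ y = l then MvPolynomial.constantCoeff p else 0) :
    IsBasicGr 𝕜 (baseGr 𝕜 (arrowGr τ g)) (fun l => (1 : 𝕜) ⊗ₜ[ℤ] g l l 1)
      (fun l => baseAug 𝕜 (η l)) where
  internal := isInternal_baseGr 𝕜 h
  mul_mem i j a b ha hb := by
    refine AddSubgroup.closure_induction ?_ (by simp) ?_ ?_ ha
    · rintro _ ⟨c, s, hs, rfl⟩
      refine AddSubgroup.closure_induction ?_ (by simp) ?_ ?_ hb
      · rintro _ ⟨c', s', hs', rfl⟩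
        rw [Algebra.TensorProduct.tmul_mul_tmul]
        exact AddSubgroup.subset_closure ⟨_, _, hg.mul_mem i j s s' hs hs', rfl⟩
      · intro a b _ _ ha hb; rw [mul_add]; exact add_mem ha hb
      · intro a _ ha
        convert neg_mem ha using 1
        exact mul_neg (α := 𝕜 ⊗[ℤ] S) (c ⊗ₜ[ℤ] s) a
    · intro a b _ _ ha hb; rw [add_mul]; exact add_mem ha hb
    · intro a _ ha
      convert neg_mem ha using 1
      exact neg_mul (α := 𝕜 ⊗[ℤ] S) a b
  neg d hd a ha := by
    have hs : ∀ s ∈ arrowGr τ g d, s = 0 := by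
      intro s hs
      refine AddSubgroup.closure_induction ?_ rfl ?_ ?_ hs
      · rintro _ ⟨x, y, p, m, hp, hd', rfl⟩
        have := arrowDeg_nonneg (τ x) (τ y)
        omega
      · intro a b _ _ ha hb; rw [ha, hb, add_zero]
      · intro a _ ha; rw [ha, neg_zero]
    refine AddSubgroup.closure_induction ?_ rfl ?_ ?_ ha
    · rintro _ ⟨c, s, hs', rfl⟩
      rw [hs s hs', TensorProduct.tmul_zero]
    · intro a b _ _ ha hb; rw [ha, hb, add_zero]
    · intro a _ ha; rw [ha, neg_zero]
  zero a ha := by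
    refine AddSubgroup.closure_induction ?_ ⟨0, by simp⟩ ?_ ?_ ha
    · rintro _ ⟨c, s, hs, rfl⟩
      obtain ⟨z, rfl⟩ := eq_sum_of_mem_arrowGr_zero hτ hs
      refine ⟨fun l => c * z l, ?_⟩
      rw [TensorProduct.tmul_sum]
      refine Finset.sum_congr rfl fun l _ => ?_
      rw [TensorProduct.smul_tmul', smul_eq_mul, mul_one, ← TensorProduct.smul_tmul, zsmul_eq_mul,
        mul_comm]
    · rintro _ _ _ _ ⟨z, rfl⟩ ⟨w, rfl⟩
      exact ⟨z + w, by simp [add_smul, Finset.sum_add_distrib]⟩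
    · rintro _ _ ⟨z, rfl⟩
      exact ⟨-z, by simp⟩
  e_mem l := AddSubgroup.subset_closure ⟨1, _, AddSubgroup.subset_closure
    ⟨l, l, 1, 0, MvPolynomial.isHomogeneous_one _ _, by rw [arrowDeg_self]; rfl, rfl⟩, rfl⟩
  e_idem l := by
    rw [Algebra.TensorProduct.tmul_mul_tmul, hg.mul, gMono_self_left, mul_one, mul_one, mul_one]
  e_orth l m hlm := by
    rw [Algebra.TensorProduct.tmul_mul_tmul, hg.orth _ _ _ _ _ _ hlm, TensorProduct.tmul_zero]
  sum_e := by
    rw [← TensorProduct.tmul_sum, hg.one]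
    rfl
  aug_e l := by rw [baseAug_tmul, hη]; simp
  aug_e_ne l m hlm := by rw [baseAug_tmul, hη, if_neg (fun h => hlm h.1.symm)]; simp
  aug_ne l d a hd ha := by
    have hs : ∀ s ∈ arrowGr τ g d, η l s = 0 := by
      intro s hs
      refine AddSubgroup.closure_induction ?_ (map_zero _) ?_ ?_ hs
      · rintro _ ⟨x, y, p, m, hp, rfl, rfl⟩
        rw [hη]
        split_ifs with hxy
        · obtain ⟨rfl, rfl⟩ := hxy
          rw [arrowDeg_self] at hd
          exact hp.coeff_eq_zero (d := 0) (by simp; omega)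
        · rfl
      · intro a b _ _ ha hb; rw [map_add, ha, hb, add_zero]
      · intro a _ ha; rw [map_neg, ha, neg_zero]
    refine AddSubgroup.closure_induction ?_ (map_zero _) ?_ ?_ ha
    · rintro _ ⟨c, s, hs', rfl⟩
      rw [baseAug_tmul, hs s hs', Int.cast_zero, mul_zero]
    · intro a b _ _ ha hb; rw [map_add, ha, hb, add_zero]
    · intro a _ ha; rw [map_neg, ha, neg_zero]

end BaseChange

end

end OSzSar

namespace OSzSar

noncomputable section

universe u

/-! ### The grading of the algebra `A_{n,k}` -/

section Ideals

variable {n k : ℕ}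

theorem evenComp_mul {c : PolyR n} {N : ℕ} (hc : c.IsHomogeneous N) (e : ℤ) (p : PolyR n) :
    evenComp e (p * c) = evenComp (e - 2 * N) p * c := by
  refine homogeneous_induction p (by simp) ?_ ?_
  · intro p q hp hq; simp only [add_mul, map_add, hp, hq]
  · intro m p hp
    by_cases h : 2 * ((m + N : ℕ) : ℤ) = e
    · rw [evenComp_of_eq (hp.mul hc) h, evenComp_of_eq hp (by push_cast at h; omega)]
    · rw [evenComp_of_ne (hp.mul hc) h, evenComp_of_ne hp (by push_cast at h; omega), zero_mul]

theorem evenComp_mem_sIdeal (μ : LState n k) {r : PolyR n} (hr : r ∈ sIdeal μ) (e : ℤ) :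
    evenComp e r ∈ sIdeal μ := by
  rw [sIdeal] at hr
  refine Submodule.closure_induction (p := fun r _ => evenComp e r ∈ sIdeal μ) (by simp) ?_ ?_ hr
  · intro p q _ _ hp hq; rw [map_add]; exact add_mem hp hq
  · rintro a _ ⟨i, rfl⟩
    rw [smul_eq_mul]
    beta_reduce
    rw [evenComp_mul (hPoly_isHomogeneous i _)]
    exact Ideal.mul_mem_left _ _ (Ideal.subset_span ⟨i, rfl⟩)

theorem cMono_isHomogeneous (l μ : LState n k) :
    (cMono l μ).IsHomogeneous (∑ i : Fin n, (bSeq μ i - bSeq l i)) :=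
  MvPolynomial.IsHomogeneous.prod _ _ _ fun j _ => MvPolynomial.isHomogeneous_X_pow j _

/-- The dictionary between the two algebras: position `a` of a `∧`, counted from zero, is the
element `a` of the state, so both sides count the elements strictly above `j`. -/
theorem wt_toI (x : LState n k) (j : Fin n) : wt (toI x) j + 1 = bSeq x j := by
  rw [bSeq, wt, add_comm, toI]
  congr 1
  rw [Finset.filter_map, Finset.card_map]
  rfl

/-- In each variable this is the identity `max(s,0) + max(t,0) = (|s| + |t| - |s+t|)/2 + max(s+t,0)`
for differences `s`, `t` of weights. It is the reason why the generators `1 ↦ x^c` compose like the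
arrows of `B₀(n,k)`. -/
theorem cMono_mul_cMono (x y z : LState n k) :
    cMono z y * cMono y x = gMono (toI x) (toI y) (toI z) * cMono z x := by
  simp only [gMono, cMono, ← Finset.prod_mul_distrib, ← pow_add]
  refine Finset.prod_congr rfl fun j _ => ?_
  congr 1
  have h1 := two_mul_gExp (toI x) (toI y) (toI z) j
  simp only [← wt_toI]
  unfold wtDist at h1
  omega

/-- Since `2 max(t,0) - t = |t|`, the degree conventions of the two algebras agree on the
generators. -/
theorem two_mul_sum_cExp (x y : LState n k) :
    2 * ((∑ i : Fin n, (bSeq x i - bSeq y i) : ℕ) : ℤ) + ∑ i : Fin n, ((bSeq y i : ℤ) - bSeq x i) =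
      arrowDeg (toI x) (toI y) := by
  simp only [arrowDeg, Nat.cast_sum, Finset.mul_sum, ← Finset.sum_add_distrib, wtDist, ← wt_toI]
  refine Finset.sum_congr rfl fun j _ => ?_
  omega

theorem cHom_comp (x y z : LState n k) :
    cHom y x ∘ₗ cHom z y = gMono (toI x) (toI y) (toI z) • cHom z x := by
  apply sMod_hom_ext
  have h1 : Ideal.Quotient.mk (sIdeal y) (cMono z y) = cMono z y • (1 : SMod y) := by
    rw [← map_one (Ideal.Quotient.mk (sIdeal y)), smul_mk_one, mul_one]
  rw [LinearMap.comp_apply, cHom_one, h1, map_smul, cHom_one, LinearMap.smul_apply, cHom_one,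
    smul_mk_one, smul_mk_one, cMono_mul_cMono]

theorem smul_cHom_eq_zero_iff (l μ : LState n k) (p : PolyR n) :
    p • cHom l μ = 0 ↔ p * cMono l μ ∈ sIdeal μ := by
  rw [← Ideal.Quotient.eq_zero_iff_mem, ← smul_mk_one, ← cHom_one, ← LinearMap.smul_apply]
  constructor
  · intro h; rw [h, LinearMap.zero_apply]
  · intro h; exact sMod_hom_ext (h.trans (LinearMap.zero_apply _).symm)

/-- A homomorphism `1 ↦ p` with `p` homogeneous is a homogeneous multiple of `1 ↦ x^c`. -/
theorem eq_evenComp_smul_cHom {l μ : LState n k} {φ : SMod l →ₗ[PolyR n] SMod μ} {p : PolyR n}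
    {m : ℕ} (hp : p.IsHomogeneous m) (hφ : φ 1 = Ideal.Quotient.mk (sIdeal μ) p) {s : PolyR n}
    (hs : φ = s • cHom l μ) :
    φ = evenComp (2 * m - 2 * (∑ i : Fin n, (bSeq μ i - bSeq l i) : ℕ)) s • cHom l μ := by
  apply sMod_hom_ext
  rw [hs, LinearMap.smul_apply, cHom_one, smul_mk_one, Ideal.Quotient.eq] at hφ
  have h1 := evenComp_mem_sIdeal μ hφ (2 * m)
  rw [map_sub, evenComp_mul (cMono_isHomogeneous l μ), evenComp_of_eq hp rfl, ← Ideal.Quotient.eq,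
    ← smul_mk_one, ← cHom_one, ← LinearMap.smul_apply] at h1
  rw [h1, ← Ideal.Quotient.eq.mpr hφ, ← smul_mk_one, ← cHom_one, ← LinearMap.smul_apply, hs]

theorem constantCoeff_eq_zero {p : PolyR n} {m : ℕ} (hp : p.IsHomogeneous m) (hm : 0 < m) :
    MvPolynomial.constantCoeff p = 0 :=
  hp.coeff_eq_zero (d := 0) (by simp; omega)

/-- The augmentation `R_μ → ℤ`. -/
def sMod_aug (μ : LState n k) : SMod μ →+* ℤ :=
  Ideal.Quotient.lift (sIdeal μ) MvPolynomial.constantCoeff fun r hr => by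
    have : sIdeal μ ≤ RingHom.ker (MvPolynomial.constantCoeff : PolyR n →+* ℤ) := by
      rw [sIdeal, Ideal.span_le]
      rintro _ ⟨i, rfl⟩
      exact constantCoeff_eq_zero (hPoly_isHomogeneous i _) (bSeq_pos μ i)
    exact this hr

theorem sMod_aug_mk (μ : LState n k) (p : PolyR n) :
    sMod_aug μ (Ideal.Quotient.mk (sIdeal μ) p) = MvPolynomial.constantCoeff p :=
  Ideal.Quotient.lift_mk _ _ _

theorem cMono_self (l : LState n k) : cMono l l = 1 := by simp [cMono]

theorem cHom_self (l : LState n k) : cHom l l = LinearMap.id := by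
  apply sMod_hom_ext
  rw [cHom_one, cMono_self]
  rfl

end Ideals

/-! ### The ring `⨁ Hom(R_l, R_μ)` as an arrow family -/

section SEnd

variable {n k : ℕ}

theorem sHom_add (l μ : LState n k) (φ ψ : SMod l →ₗ[PolyR n] SMod μ) :
    sHom l μ (φ + ψ) = sHom l μ φ + sHom l μ ψ := by
  rw [sHom, LinearMap.add_comp, LinearMap.comp_add]; rfl

theorem sHom_smul (l μ : LState n k) (p : PolyR n) (φ : SMod l →ₗ[PolyR n] SMod μ) :
    sHom l μ (p • φ) = p • sHom l μ φ := by
  rw [sHom, LinearMap.smul_comp, LinearMap.comp_smul]; rfl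

theorem sHom_mul (l μ ν : LState n k) (φ : SMod μ →ₗ[PolyR n] SMod ν)
    (ψ : SMod l →ₗ[PolyR n] SMod μ) : sHom μ ν φ * sHom l μ ψ = sHom l ν (φ ∘ₗ ψ) := by
  refine LinearMap.ext fun v => ?_
  change Pi.single ν (φ ((Pi.single μ (ψ (v l)) : ∀ μ : LState n k, SMod μ) μ)) = _
  rw [Pi.single_eq_same]
  rfl

theorem sHom_mul_of_ne {l μ μ' ν : LState n k} (h : μ' ≠ μ) (φ : SMod μ →ₗ[PolyR n] SMod ν)
    (ψ : SMod l →ₗ[PolyR n] SMod μ') : sHom μ ν φ * sHom l μ' ψ = 0 := by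
  refine LinearMap.ext fun v => ?_
  change Pi.single ν (φ ((Pi.single μ' (ψ (v l)) : ∀ μ : LState n k, SMod μ) μ)) = _
  rw [Pi.single_eq_of_ne h.symm, map_zero, Pi.single_zero]
  rfl

/-- The component of an endomorphism of `⨁ R_μ`. -/
def sEntry (T : SEnd n k) (l μ : LState n k) : SMod l →ₗ[PolyR n] SMod μ :=
  LinearMap.proj μ ∘ₗ T ∘ₗ LinearMap.single (PolyR n) (fun ν : LState n k => SMod ν) l

theorem sum_sHom_sEntry (T : SEnd n k) : ∑ μ, ∑ l, sHom l μ (sEntry T l μ) = T := by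
  refine LinearMap.pi_ext fun l v => ?_
  simp only [LinearMap.sum_apply]
  have h1 : ∀ μ, ∑ l', sHom l' μ (sEntry T l' μ) (Pi.single l v) =
      Pi.single μ (T (Pi.single l v) μ) := by
    intro μ
    rw [Finset.sum_eq_single l]
    · change Pi.single μ (T (Pi.single l ((Pi.single l v : ∀ ν : LState n k, SMod ν) l)) μ) = _
      rw [Pi.single_eq_same]
    · intro l' _ hl
      change Pi.single μ (T (Pi.single l' ((Pi.single l v : ∀ ν : LState n k, SMod ν) l')) μ) = _
      rw [Pi.single_eq_of_ne hl, Pi.single_zero, map_zero]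
      exact Pi.single_zero _
    · simp
  simp only [h1]
  exact Finset.univ_sum_single _

theorem sEntry_sHom (l μ : LState n k) (φ : SMod l →ₗ[PolyR n] SMod μ) :
    sEntry (sHom l μ φ) l μ = φ := by
  refine LinearMap.ext fun v => ?_
  change (Pi.single μ (φ ((Pi.single l v : ∀ ν : LState n k, SMod ν) l)) :
    ∀ ν : LState n k, SMod ν) μ = _
  rw [Pi.single_eq_same, Pi.single_eq_same]

theorem sEntry_sHom_of_ne {l μ l' μ' : LState n k} (h : ¬ (μ = μ' ∧ l = l'))
    (φ : SMod l →ₗ[PolyR n] SMod μ) : sEntry (sHom l μ φ) l' μ' = 0 := by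
  refine LinearMap.ext fun v => ?_
  change (Pi.single μ (φ ((Pi.single l' v : ∀ ν : LState n k, SMod ν) l)) :
    ∀ ν : LState n k, SMod ν) μ' = _
  by_cases hl : l = l'
  · rw [Pi.single_eq_of_ne (fun e => h ⟨e.symm, hl⟩)]; rfl
  · rw [Pi.single_eq_of_ne hl, map_zero, Pi.single_zero]; rfl

/-- The ring `⨁ Hom(R_l, R_μ)`; a copy of `SEnd n k` that carries only the ring structure. -/
def SRing (n k : ℕ) : Type := SEnd n k

instance (n k : ℕ) : Ring (SRing n k) := inferInstanceAs (Ring (SEnd n k))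

/-- The map that remains of a homomorphism `R_l → R_μ`, as an element of `SRing n k`. -/
def rHom (l μ : LState n k) : (SMod l →ₗ[PolyR n] SMod μ) →+ SRing n k where
  toFun φ := (sHom l μ φ : SEnd n k)
  map_zero' := by
    have h : sHom l μ 0 = (0 : SEnd n k) := by simp [sHom]
    exact h
  map_add' φ ψ := sHom_add l μ φ ψ

theorem rHom_mul (l μ ν : LState n k) (φ : SMod μ →ₗ[PolyR n] SMod ν)
    (ψ : SMod l →ₗ[PolyR n] SMod μ) : rHom μ ν φ * rHom l μ ψ = rHom l ν (φ ∘ₗ ψ) :=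
  sHom_mul l μ ν φ ψ

theorem rHom_mul_of_ne {l μ μ' ν : LState n k} (h : μ' ≠ μ) (φ : SMod μ →ₗ[PolyR n] SMod ν)
    (ψ : SMod l →ₗ[PolyR n] SMod μ') : rHom μ ν φ * rHom l μ' ψ = 0 :=
  sHom_mul_of_ne h φ ψ

/-- The component of an element of `⨁ Hom(R_l, R_μ)`. -/
def rEntry (l μ : LState n k) : SRing n k →+ (SMod l →ₗ[PolyR n] SMod μ) where
  toFun T := sEntry (T : SEnd n k) l μ
  map_zero' := rfl
  map_add' _ _ := rfl

theorem rEntry_rHom (l μ : LState n k) (φ : SMod l →ₗ[PolyR n] SMod μ) :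
    rEntry l μ (rHom l μ φ) = φ :=
  sEntry_sHom l μ φ

theorem rEntry_rHom_of_ne {l μ l' μ' : LState n k} (h : ¬ (μ = μ' ∧ l = l'))
    (φ : SMod l →ₗ[PolyR n] SMod μ) : rEntry l' μ' (rHom l μ φ) = 0 :=
  sEntry_sHom_of_ne h φ

theorem sum_rHom_rEntry (T : SRing n k) : ∑ μ, ∑ l, rHom l μ (rEntry l μ T) = T :=
  sum_sHom_sEntry T

/-- The multiple of `1 ↦ x^c` as an arrow from `x` to `y`, that is, as a map `R_y → R_x`. -/
def sArrow (x y : LState n k) : PolyR n →+ SRing n k :=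
  (rHom y x).comp ((smulAddHom (PolyR n) (SMod y →ₗ[PolyR n] SMod x)).flip (cHom y x))

theorem sArrow_apply (x y : LState n k) (p : PolyR n) : sArrow x y p = rHom y x (p • cHom y x) :=
  rfl

theorem sum_rHom_id : ∑ l : LState n k, rHom l l LinearMap.id = 1 := by
  have h : ∑ l : LState n k, sHom l l LinearMap.id = 1 := by
    refine LinearMap.ext fun v => ?_
    rw [LinearMap.sum_apply]
    exact Finset.univ_sum_single v
  exact h

/-- An arrow from `x` to `y` is a map `R_y → R_x`; with this reversal, concatenation of arrows is
composition of maps. The spanning property is the cyclicity of the modules of homomorphisms. -/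
theorem sArrow_arrowFamily : ArrowFamily toI (sArrow (n := n) (k := k)) where
  mul x y z p q := by
    rw [sArrow_apply, sArrow_apply, sArrow_apply, rHom_mul, LinearMap.smul_comp,
      LinearMap.comp_smul, cHom_comp, smul_smul, smul_smul, mul_assoc]
  orth x y z w p q h := rHom_mul_of_ne h.symm _ _
  one := by
    simp only [sArrow_apply, one_smul, cHom_self]
    exact sum_rHom_id
  span T := by
    choose s hs using fun x y => exists_smul_cHom (rEntry y x T)
    refine ⟨s, ?_⟩
    conv_lhs => rw [← sum_rHom_rEntry T]
    simp only [sArrow_apply, ← hs]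

theorem rEntry_sum_sArrow (p : LState n k → LState n k → PolyR n) (x y : LState n k) :
    rEntry y x (∑ x, ∑ y, sArrow x y (p x y)) = p x y • cHom y x := by
  rw [map_sum, Finset.sum_eq_single x, map_sum, Finset.sum_eq_single y]
  · exact rEntry_rHom y x _
  · intro y' _ hy
    exact rEntry_rHom_of_ne (fun h => hy h.2) _
  · simp
  · intro x' _ hx
    rw [map_sum]
    exact Finset.sum_eq_zero fun y' _ => rEntry_rHom_of_ne (fun h => hx h.1) _
  · simp

/-- Relations can be tested entry by entry, and `p • cHom` vanishes exactly when `p x^c` lies in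
`I_μ`. This is a homogeneous condition, as both the ideal and the monomial are homogeneous. -/
theorem sArrow_isInternal : DirectSum.IsInternal (arrowGr toI (sArrow (n := n) (k := k))) := by
  refine arrowGr_isInternal sArrow_arrowFamily.span fun p hp d => ?_
  refine Finset.sum_eq_zero fun x _ => Finset.sum_eq_zero fun y _ => ?_
  have h1 := rEntry_sum_sArrow p x y
  rw [hp, map_zero] at h1
  have h2 := (smul_cHom_eq_zero_iff y x _).mp h1.symm
  have h3 := evenComp_mem_sIdeal x h2
    (d - arrowDeg (toI x) (toI y) + 2 * (∑ i : Fin n, (bSeq x i - bSeq y i) : ℕ))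
  rw [evenComp_mul (cMono_isHomogeneous y x), add_sub_cancel_right] at h3
  rw [sArrow_apply, (smul_cHom_eq_zero_iff y x _).mpr h3, map_zero]

end SEnd

/-! ### The quotient `A_{n,k}` and its characters -/

section AZ

variable {n k : ℕ}

theorem vee_strictMono (μ : LState n k) : StrictMono (vee μ) :=
  OrderEmbedding.strictMono _

theorem not_tooFar_self (l : LState n k) : ¬ TooFar l l := by
  rintro ⟨j, j', h, h'⟩
  have := vee_strictMono l (show j < j' by rw [Fin.lt_def]; omega)
  rw [or_self] at h'
  exact absurd h' (not_le.mpr this)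

/-- On the diagonal the interval from one `∨` to just before the next contains the first `∨`, so the
monomial is not `1`. Hence dividing by `W` does not kill the idempotents. -/
theorem constantCoeff_intervalMono_self (l : LState n k) (j : Fin (n - k)) :
    MvPolynomial.constantCoeff (intervalMono l l j) = 0 := by
  rw [intervalMono, map_prod]
  refine Finset.prod_eq_zero (i := vee l j) ?_ (by simp)
  rw [Finset.mem_filter]
  refine ⟨Finset.mem_univ _, by simp, fun j' h => ?_⟩
  rw [min_self]
  exact vee_strictMono l (by rw [Fin.lt_def]; omega)

theorem Wsub_eq_span {l μ : LState n k} (h : ¬ TooFar l μ) :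
    Wsub l μ = Submodule.span (PolyR n) (Set.range fun j => intervalMono l μ j • cHom l μ) := by
  rw [Wsub, if_neg h]
  congr 1
  ext φ
  constructor
  · rintro ⟨j, hj⟩
    refine ⟨j, sMod_hom_ext ?_⟩
    rw [hj, LinearMap.smul_apply, cHom_one, smul_mk_one]
  · rintro ⟨j, rfl⟩
    refine ⟨j, ?_⟩
    rw [LinearMap.smul_apply, cHom_one, smul_mk_one]

/-- The quotient map onto `A_{n,k}`. -/
def AZ.mkR (n k : ℕ) : SRing n k →+* AZ n k := (AZ.mk n k : SEnd n k →+* AZ n k)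

theorem AZ.mkR_surjective : Function.Surjective (AZ.mkR n k) :=
  RingCon.mk'_surjective (WIdeal n k).ringCon

theorem aCls_eq_zero_of_mem {l μ : LState n k} {φ : SMod l →ₗ[PolyR n] SMod μ} (h : φ ∈ Wsub l μ) :
    aCls l μ φ = 0 := by
  have h1 : sHom l μ φ ∈ WIdeal n k := TwoSidedIdeal.subset_span ⟨l, μ, φ, h, rfl⟩
  exact ((RingCon.eq _).mpr h1).trans (map_zero (AZ.mk n k))

/-- The arrows of `A_{n,k}`. -/
def aArrow (x y : LState n k) : PolyR n →+ AZ n k :=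
  (AZ.mkR n k).toAddMonoidHom.comp (sArrow x y)

theorem aArrow_apply (x y : LState n k) (p : PolyR n) : aArrow x y p = p • aCls y x (cHom y x) := by
  change AZ.mk n k (sHom y x (p • cHom y x)) = _
  rw [sHom_smul, map_smul]
  rfl

theorem aArrow_arrowFamily : ArrowFamily toI (aArrow (n := n) (k := k)) :=
  sArrow_arrowFamily.map _ AZ.mkR_surjective

/-- The relations of `A_{n,k}` are generated by homogeneous ones. -/
theorem rHom_mem_closure {l μ : LState n k} {φ : SMod l →ₗ[PolyR n] SMod μ} (hφ : φ ∈ Wsub l μ) :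
    rHom l μ φ ∈ AddSubgroup.closure
      {s | (∃ d, s ∈ arrowGr toI sArrow d) ∧ AZ.mkR n k s = 0} := by
  have hsub : ∀ (m : ℕ) (p : PolyR n), p.IsHomogeneous m → p • cHom l μ ∈ Wsub l μ → rHom l μ (p • cHom l μ) ∈
      AddSubgroup.closure {s | (∃ d, s ∈ arrowGr toI sArrow d) ∧ AZ.mkR n k s = 0} :=
    fun m p hp hpW => AddSubgroup.subset_closure
      ⟨⟨_, mem_arrowGr (τ := toI) (g := sArrow) (x := μ) (y := l) hp⟩, aCls_eq_zero_of_mem hpW⟩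
  by_cases h : TooFar l μ
  · have htop : Wsub l μ = ⊤ := if_pos h
    obtain ⟨s, rfl⟩ := exists_smul_cHom φ
    rw [htop] at hsub
    clear hφ
    refine homogeneous_induction s ?_ ?_ ?_
    · rw [zero_smul, map_zero]; exact zero_mem _
    · intro p q hp hq; rw [add_smul, map_add]; exact add_mem hp hq
    · intro m p hp; exact hsub m p hp trivial
  · rw [Wsub_eq_span h] at hφ
    refine Submodule.closure_induction (p := fun φ _ => rHom l μ φ ∈ _) ?_ ?_ ?_ hφ
    · rw [map_zero]; exact zero_mem _
    · intro p q _ _ hp hq; rw [map_add]; exact add_mem hp hq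
    · rintro p _ ⟨j, rfl⟩
      refine homogeneous_induction p ?_ ?_ ?_
      · rw [zero_smul, map_zero]; exact zero_mem _
      · intro p q hp hq; rw [add_smul, map_add]; exact add_mem hp hq
      · intro m p hp
        have hj : (intervalMono l μ j).IsHomogeneous _ :=
          MvPolynomial.IsHomogeneous.prod _ _ _ fun i _ => MvPolynomial.isHomogeneous_X ℤ i
        beta_reduce
        rw [smul_smul]
        refine hsub _ _ (hp.mul hj) ?_
        rw [Wsub_eq_span h, mul_smul]
        exact Submodule.smul_mem _ _ (Submodule.subset_span ⟨j, rfl⟩)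

theorem AZ.rel_of_mkR_eq_zero (s : SRing n k) (hs : AZ.mkR n k s = 0) : ringConGen
    (fun a b : SRing n k => ∃ (l μ : LState n k), ∃ φ ∈ Wsub l μ, a - b = rHom l μ φ) s 0 :=
  (RingCon.eq (WIdeal n k).ringCon).mp (hs.trans (map_zero (AZ.mkR n k)).symm)

theorem aArrow_isInternal : DirectSum.IsInternal (arrowGr toI (aArrow (n := n) (k := k))) := by
  refine sArrow_arrowFamily.isInternal_quotient sArrow_isInternal (AZ.mkR n k) AZ.mkR_surjective
    AZ.rel_of_mkR_eq_zero ?_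
  rintro a b ⟨l, μ, φ, hφ, hab⟩
  rw [hab]
  exact rHom_mem_closure hφ

/-- If `1 ↦ p` with `p` homogeneous is written as `s • cHom`, then `s` may be inhomogeneous, but it
can be replaced by its component of the correct degree. The degrees match by `two_mul_sum_cExp`. -/
theorem aZGr_eq_arrowGr : aZGr n k = arrowGr toI (aArrow (n := n) (k := k)) := by
  funext d
  refine le_antisymm ?_ ?_
  · rw [aZGr, AddSubgroup.closure_le]
    rintro _ ⟨l, μ, φ, p, m, hp, hφ, rfl, rfl⟩
    obtain ⟨s, hs⟩ := exists_smul_cHom φ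
    have h1 := eq_evenComp_smul_cHom hp hφ hs
    have h2 := two_mul_sum_cExp μ l
    rw [h1]
    generalize evenComp_def : evenComp (2 * m - 2 * (∑ i : Fin n, (bSeq μ i - bSeq l i) : ℕ)) s = t
    have h3 := evenComp_isHomogeneous (2 * m - 2 * (∑ i : Fin n, (bSeq μ i - bSeq l i) : ℕ)) s
    rw [evenComp_def] at h3
    have h4 : aCls l μ (t • cHom l μ) = aArrow μ l t := rfl
    rw [h4]
    rcases h3 with rfl | ⟨m', hm', ht⟩
    · rw [map_zero]; exact zero_mem _
    · exact AddSubgroup.subset_closure ⟨μ, l, t, m', ht, by omega, rfl⟩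
  · rw [arrowGr, AddSubgroup.closure_le]
    rintro _ ⟨x, y, p, m, hp, rfl, rfl⟩
    have h2 := two_mul_sum_cExp x y
    refine AddSubgroup.subset_closure ⟨y, x, p • cHom y x, p * cMono y x, _,
      hp.mul (cMono_isHomogeneous y x), ?_, ?_, rfl⟩
    · rw [LinearMap.smul_apply, cHom_one, smul_mk_one]
    · push_cast at h2 ⊢; linarith

/-- The diagonal augmentations of `⨁ Hom(R_l, R_μ)`. -/
def sEnd_augAdd (l : LState n k) : SRing n k →+ ℤ where
  toFun T := sMod_aug l (rEntry l l T 1)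
  map_zero' := by rw [map_zero, LinearMap.zero_apply, map_zero]
  map_add' S T := by rw [map_add, LinearMap.add_apply, map_add]

theorem sEnd_augAdd_sArrow (l x y : LState n k) (p : PolyR n) :
    sEnd_augAdd l (sArrow x y p) = if x = l ∧ y = l then MvPolynomial.constantCoeff p else 0 := by
  change sMod_aug l (rEntry l l (rHom y x (p • cHom y x)) 1) = _
  split_ifs with h
  · obtain ⟨rfl, rfl⟩ := h
    rw [rEntry_rHom, LinearMap.smul_apply, cHom_one, smul_mk_one, sMod_aug_mk, cMono_self, mul_one]
  · rw [rEntry_rHom_of_ne h, LinearMap.zero_apply, map_zero]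

theorem constantCoeff_gMono {x y : IState n k} (h : x ≠ y) :
    MvPolynomial.constantCoeff (gMono x y x) = 0 := by
  refine constantCoeff_eq_zero (gMono_isHomogeneous x y x) ?_
  have h1 := two_mul_sum_gExp x y x
  have h2 := arrowDeg_nonneg x y
  have h3 := arrowDeg_nonneg y x
  rw [arrowDeg_self] at h1
  have h4 : arrowDeg x y ≠ 0 := fun e => h (eq_of_arrowDeg_eq_zero e)
  omega

/-- A diagonal entry of a product could also receive a round trip `l → y → l` with `y ≠ l`. Its
monomial has positive degree by `constantCoeff_gMono`, so evaluation at zero does not see it. -/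
theorem sEnd_augAdd_mul (l : LState n k) (S T : SRing n k) :
    sEnd_augAdd l (S * T) = sEnd_augAdd l S * sEnd_augAdd l T := by
  obtain ⟨p, rfl⟩ := sArrow_arrowFamily.span S
  obtain ⟨q, rfl⟩ := sArrow_arrowFamily.span T
  simp only [Finset.sum_mul, map_sum]
  refine Finset.sum_congr rfl fun x _ => Finset.sum_congr rfl fun y _ => ?_
  simp only [Finset.mul_sum, map_sum]
  refine Finset.sum_congr rfl fun z _ => Finset.sum_congr rfl fun w _ => ?_
  rw [sEnd_augAdd_sArrow, sEnd_augAdd_sArrow]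
  by_cases hyz : y = z
  · subst hyz
    rw [sArrow_arrowFamily.mul, sEnd_augAdd_sArrow]
    by_cases hx : x = l
    · by_cases hw : w = l
      · subst hx hw
        by_cases hy : y = w
        · subst hy
          simp [gMono_self_left]
        · rw [map_mul, constantCoeff_gMono (fun e => hy (toI_injective e).symm)]
          simp [hy]
      · simp [hw]
    · simp [hx]
  · rw [sArrow_arrowFamily.orth _ _ _ _ _ _ hyz, map_zero]
    split_ifs with h1 h2
    · exact absurd (h1.2.trans h2.1.symm) hyz
    · simp
    · simp
    · simp

/-- The diagonal augmentations of `⨁ Hom(R_l, R_μ)`, as characters. -/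
def sEnd_aug (l : LState n k) : SRing n k →+* ℤ where
  __ := sEnd_augAdd l
  map_mul' := sEnd_augAdd_mul l
  map_one' := by
    change sEnd_augAdd l 1 = 1
    rw [← sArrow_arrowFamily.one, map_sum, Finset.sum_eq_single l]
    · rw [sEnd_augAdd_sArrow]; simp
    · intro x _ hx; rw [sEnd_augAdd_sArrow, if_neg (fun h => hx h.1)]
    · simp

theorem sEnd_aug_of_mem_Wsub (ν l μ : LState n k) {φ : SMod l →ₗ[PolyR n] SMod μ}
    (hφ : φ ∈ Wsub l μ) : sEnd_aug ν (rHom l μ φ) = 0 := by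
  change sMod_aug ν (rEntry ν ν (rHom l μ φ) 1) = 0
  by_cases h : μ = ν ∧ l = ν
  · obtain ⟨rfl, rfl⟩ := h
    rw [rEntry_rHom]
    rw [Wsub_eq_span (not_tooFar_self _)] at hφ
    refine Submodule.closure_induction (p := fun φ _ => sMod_aug l (φ 1) = 0) ?_ ?_ ?_ hφ
    · rw [LinearMap.zero_apply, map_zero]
    · intro φ ψ _ _ h1 h2; rw [LinearMap.add_apply, map_add, h1, h2, add_zero]
    · rintro p _ ⟨j, rfl⟩
      rw [LinearMap.smul_apply, LinearMap.smul_apply, cHom_one, smul_mk_one, smul_mk_one,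
        sMod_aug_mk, map_mul, map_mul, constantCoeff_intervalMono_self]
      simp
  · rw [rEntry_rHom_of_ne h, LinearMap.zero_apply, map_zero]

theorem sEnd_aug_eq_of_rel (l : LState n k) {a b : SRing n k} (h : (WIdeal n k).ringCon a b) :
    sEnd_aug l a = sEnd_aug l b := by
  have hle : ringConGen (fun a b : SRing n k => ∃ (l μ : LState n k), ∃ φ ∈ Wsub l μ,
      a - b = rHom l μ φ) ≤ RingCon.ker (sEnd_aug l) := by
    rw [RingCon.ringConGen_le]
    rintro a b ⟨l', μ, φ, hφ, hab⟩
    change sEnd_aug l a = sEnd_aug l b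
    rw [← sub_eq_zero, ← map_sub, hab, sEnd_aug_of_mem_Wsub l l' μ hφ]
  exact hle h

/-- The diagonal augmentations of `A_{n,k}`. -/
def aZ_aug (l : LState n k) : AZ n k →+* ℤ :=
  (WIdeal n k).ringCon.lift (sEnd_aug l : SRing n k →+* ℤ) fun _ _ h => sEnd_aug_eq_of_rel l h

theorem aZ_aug_aArrow (l x y : LState n k) (p : PolyR n) :
    aZ_aug l (aArrow x y p) = if x = l ∧ y = l then MvPolynomial.constantCoeff p else 0 :=
  sEnd_augAdd_sArrow l x y p

theorem aArrow_one (l : LState n k) : aArrow l l 1 = aCls l l LinearMap.id := by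
  rw [aArrow_apply, one_smul, cHom_self]

theorem sarGr_isBasicGr (𝕜 : Type u) [Field 𝕜] (n k : ℕ) :
    IsBasicGr 𝕜 (sarGr 𝕜 n k) (fun l : LState n k => (1 : 𝕜) ⊗ₜ[ℤ] aCls l l LinearMap.id)
      (fun l => baseAug 𝕜 (aZ_aug l)) := by
  have h := aArrow_arrowFamily.isBasicGr 𝕜 toI_injective (aArrow_isInternal (n := n) (k := k))
    aZ_aug aZ_aug_aArrow
  simp only [aArrow_one, ← aZGr_eq_arrowGr] at h
  exact h

end AZ

end

end OSzSar

namespace OSzSar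

noncomputable section

universe u

/-! ### The grading of `B_l(n,k)` -/

section Arrows

variable {n k : ℕ}

theorem f0_mul_of_ne (x y z w : IState n k) (h : y ≠ z) : f0 x y * f0 z w = 0 := by
  simp only [f0, ← map_mul]
  rw [B0.mk_rel (B0Rel.ortho x y z w h), map_zero]

theorem f0_mul (x y z : IState n k) : f0 x y * f0 y z = gMono x y z • f0 x z := by
  simp only [f0, ← map_mul]
  rw [B0.mk_rel (B0Rel.mul x y z), map_smul]
  rfl

theorem sum_f0 : ∑ x : IState n k, f0 x x = 1 := by
  simp only [f0, ← map_sum]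
  rw [← B0.mk_rel B0Rel.one, map_one]

theorem B0.mk_surjective : Function.Surjective (B0.mk n k) :=
  RingCon.mk'_surjective (ringConGen (B0Rel n k))

theorem span_f0 : Submodule.span (PolyR n)
    (Set.range fun xy : IState n k × IState n k => f0 xy.1 xy.2) = ⊤ := by
  rw [eq_top_iff]
  intro b _
  obtain ⟨b, rfl⟩ := B0.mk_surjective b
  have h1 : (1 : B0 n k) ∈ Submodule.span (PolyR n)
      (Set.range fun xy : IState n k × IState n k => f0 xy.1 xy.2) := by
    rw [← sum_f0]
    exact sum_mem fun x _ => Submodule.subset_span ⟨(x, x), rfl⟩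
  induction b using FreeAlgebra.induction with
  | grade0 r =>
    rw [AlgHom.commutes, Algebra.algebraMap_eq_smul_one]
    exact Submodule.smul_mem _ _ h1
  | grade1 xy => exact Submodule.subset_span ⟨xy, rfl⟩
  | add a b ha hb => rw [map_add]; exact add_mem (ha trivial) (hb trivial)
  | mul a b ha hb =>
    rw [map_mul]
    replace ha := ha trivial
    replace hb := hb trivial
    generalize B0.mk n k a = a at *
    generalize B0.mk n k b = b at *
    refine Submodule.span_induction ?_ (by rw [zero_mul]; exact zero_mem _) ?_ ?_ ha
    · rintro _ ⟨⟨x, y⟩, rfl⟩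
      refine Submodule.span_induction ?_ (by rw [mul_zero]; exact zero_mem _) ?_ ?_ hb
      · rintro _ ⟨⟨z, w⟩, rfl⟩
        by_cases h : y = z
        · subst h
          rw [f0_mul]
          exact Submodule.smul_mem _ _ (Submodule.subset_span ⟨(x, w), rfl⟩)
        · rw [f0_mul_of_ne _ _ _ _ h]; exact zero_mem _
      · intro b c _ _ hb hc; rw [mul_add]; exact add_mem hb hc
      · intro r b _ hb; rw [mul_smul_comm]; exact Submodule.smul_mem _ _ hb
    · intro b c _ _ hb hc; rw [add_mul]; exact add_mem hb hc
    · intro r b _ hb; rw [smul_mul_assoc]; exact Submodule.smul_mem _ _ hb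

/-- The multiples of `f_{x,y}` in `B₀(n,k)`. -/
def b0Arrow (x y : IState n k) : PolyR n →+ B0 n k := (smulAddHom (PolyR n) (B0 n k)).flip (f0 x y)

theorem b0Arrow_apply (x y : IState n k) (p : PolyR n) : b0Arrow x y p = p • f0 x y := rfl

theorem b0Arrow_arrowFamily : ArrowFamily id (b0Arrow (n := n) (k := k)) where
  mul x y z p q := by
    rw [b0Arrow_apply, b0Arrow_apply, b0Arrow_apply, smul_mul_smul_comm, f0_mul, smul_smul]
    rfl
  orth x y z w p q h := by
    rw [b0Arrow_apply, b0Arrow_apply, smul_mul_smul_comm, f0_mul_of_ne _ _ _ _ h, smul_zero]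
  one := by simp only [b0Arrow_apply, one_smul, sum_f0]
  span s := by
    have hs : s ∈ Submodule.span (PolyR n)
      (Set.range fun xy : IState n k × IState n k => f0 xy.1 xy.2) := by rw [span_f0]; trivial
    obtain ⟨c, rfl⟩ := (Submodule.mem_span_range_iff_exists_fun _).mp hs
    exact ⟨fun x y => c (x, y), by rw [Fintype.sum_prod_type]; rfl⟩

open Classical in
/-- The representation of `B₀(n,k)` in which `f_{a,b}` acts by a monomial multiple of a matrix unit;
the multiple is `1` if `b = y`. -/
def b0Rep (y : IState n k) : B0 n k →ₐ[PolyR n] Matrix (IState n k) (IState n k) (PolyR n) :=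
  RingCon.liftₐ (ringConGen (B0Rel n k))
    (FreeAlgebra.lift (PolyR n) fun ab : IState n k × IState n k =>
      Matrix.single ab.1 ab.2 (gMono ab.1 ab.2 y)) <| RingCon.ringConGen_le.mpr <| by
    intro a b h
    change FreeAlgebra.lift (PolyR n) _ a = FreeAlgebra.lift (PolyR n) _ b
    cases h with
    | ortho x z w v h =>
      rw [map_mul, FreeAlgebra.lift_ι_apply, FreeAlgebra.lift_ι_apply, map_zero]
      exact Matrix.single_mul_single_of_ne _ _ _ _ h _
    | mul x z w =>
      rw [map_mul, map_smul, FreeAlgebra.lift_ι_apply, FreeAlgebra.lift_ι_apply,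
        FreeAlgebra.lift_ι_apply, Matrix.single_mul_single_same, Matrix.smul_single, gMono_cocycle]
      rfl
    | one =>
      rw [map_one, map_sum]
      simp only [FreeAlgebra.lift_ι_apply, gMono_self_left]
      exact Matrix.sum_single_one.symm

open Classical in
theorem b0Rep_f0 (y a b : IState n k) : b0Rep y (f0 a b) = Matrix.single a b (gMono a b y) :=
  FreeAlgebra.lift_ι_apply _ _

/-- The coefficient of `f_{x,y}`. -/
def b0Coef (x y : IState n k) : B0 n k →+ PolyR n where
  toFun b := b0Rep y b x y
  map_zero' := by rw [map_zero]; rfl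
  map_add' a b := by rw [map_add]; rfl

open Classical in
theorem b0Coef_b0Arrow (x y a b : IState n k) (p : PolyR n) :
    b0Coef x y (b0Arrow a b p) = if a = x ∧ b = y then p else 0 := by
  change b0Rep y (p • f0 a b) x y = _
  rw [map_smul, b0Rep_f0, Matrix.smul_apply, Matrix.single_apply]
  split_ifs with h
  · obtain ⟨rfl, rfl⟩ := h
    rw [gMono_self_right, smul_eq_mul, mul_one]
  · rw [smul_zero]

/-- The coefficients read off from `b0Rep` show that the arrows are linearly independent over the
polynomial ring, so there are no relations between their multiples. -/
theorem b0Arrow_isInternal : DirectSum.IsInternal (arrowGr id (b0Arrow (n := n) (k := k))) := by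
  refine arrowGr_isInternal b0Arrow_arrowFamily.span fun p hp d => ?_
  refine Finset.sum_eq_zero fun x _ => Finset.sum_eq_zero fun y _ => ?_
  have h := congrArg (b0Coef x y) hp
  rw [map_zero, map_sum, Finset.sum_eq_single x, map_sum, Finset.sum_eq_single y] at h
  · rw [b0Coef_b0Arrow, if_pos ⟨rfl, rfl⟩] at h
    rw [h, map_zero, map_zero]
  · intro y' _ hy; rw [b0Coef_b0Arrow, if_neg (fun h => hy h.2)]
  · simp
  · intro x' _ hx
    rw [map_sum]
    exact Finset.sum_eq_zero fun y' _ => by rw [b0Coef_b0Arrow, if_neg (fun h => hx h.1)]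
  · simp

/-- Moving an element across the line `j` changes only the number of elements beyond that line.
Hence the summands of `R_i` and `L_i` have degree one, and a step always crosses its own line. -/
theorem wt_of_isStep {j : Fin n} {x y : IState n k} (h : IsStep j x y) (l : Fin n) :
    wt y l = wt x l + if l = j then 1 else 0 := by
  obtain ⟨h1, h2, h3⟩ := h
  have h4 : j.succ ∉ x.1.erase j.castSucc := fun h => h2 (Finset.mem_of_mem_erase h)
  rw [wt, wt, h3, Finset.filter_insert, Finset.filter_erase]
  by_cases hlj : (l : ℕ) + 1 ≤ j
  · rw [if_pos (by rw [Fin.val_succ]; omega), if_neg (fun e => by rw [e] at hlj; omega),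
      Finset.card_insert_of_notMem, Finset.card_erase_add_one]
    · rfl
    · rw [Finset.mem_filter]; exact ⟨h1, hlj⟩
    · intro h
      exact h2 (Finset.mem_of_mem_filter _ (Finset.mem_of_mem_erase h))
  · have h5 : j.castSucc ∉ x.1.filter fun a : Fin (n + 1) => (l : ℕ) + 1 ≤ a := by
      rw [Finset.mem_filter]
      exact fun h => hlj h.2
    rw [Finset.erase_eq_of_notMem h5]
    by_cases hl : l = j
    · subst hl
      rw [if_pos (by rw [Fin.val_succ]), if_pos rfl, Finset.card_insert_of_notMem]
      intro h
      exact h2 (Finset.mem_of_mem_filter _ h)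
    · have : (l : ℕ) ≠ j := fun e => hl (Fin.ext e)
      rw [if_neg (by rw [Fin.val_succ]; omega), if_neg hl]
      rfl

theorem wtDist_comm (x y : IState n k) (j : Fin n) : wtDist x y j = wtDist y x j := by
  unfold wtDist; omega

theorem arrowDeg_comm (x y : IState n k) : arrowDeg x y = arrowDeg y x := by
  simp only [arrowDeg, wtDist_comm x y]

theorem arrowDeg_of_isStep {j : Fin n} {x y : IState n k} (h : IsStep j x y) : arrowDeg x y = 1 := by
  rw [arrowDeg, Finset.sum_eq_single j]
  · have := wt_of_isStep h j
    rw [if_pos rfl] at this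
    unfold wtDist
    omega
  · intro l _ hl
    have := wt_of_isStep h l
    rw [if_neg hl] at this
    unfold wtDist
    omega
  · simp

theorem f0_mem_arrowGr (x y : IState n k) : f0 x y ∈ arrowGr id b0Arrow (arrowDeg x y) := by
  have := mem_arrowGr (τ := id) (g := b0Arrow) (x := x) (y := y)
    (MvPolynomial.isHomogeneous_one (Fin n) ℤ)
  rwa [b0Arrow_apply, one_smul, Nat.cast_zero, mul_zero, zero_add] at this

theorem Rgen_mem (j : Fin n) : (Rgen j : B0 n k) ∈ arrowGr id b0Arrow 1 := by
  refine sum_mem fun x _ => sum_mem fun y _ => ?_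
  split_ifs with h
  · rw [← arrowDeg_of_isStep h]; exact f0_mem_arrowGr x y
  · exact zero_mem _

theorem Lgen_mem (j : Fin n) : (Lgen j : B0 n k) ∈ arrowGr id b0Arrow 1 := by
  refine sum_mem fun x _ => sum_mem fun y _ => ?_
  split_ifs with h
  · rw [← arrowDeg_of_isStep h, arrowDeg_comm]; exact f0_mem_arrowGr x y
  · exact zero_mem _

theorem BFull.mk_surjective : Function.Surjective (BFull.mk n k) :=
  RingCon.mk'_surjective (ringConGen (BRel n k))

theorem BFull.mk_eq_iff {a b : B0 n k} :
    BFull.mk n k a = BFull.mk n k b ↔ ringConGen (BRel n k) a b := RingCon.eq _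

/-- The multiples of `f_{x,y}` in `B(n,k)`. -/
def bArrow (x y : IState n k) : PolyR n →+ BFull n k :=
  (BFull.mk n k : B0 n k →+* BFull n k).toAddMonoidHom.comp (b0Arrow x y)

theorem bArrow_apply (x y : IState n k) (p : PolyR n) : bArrow x y p = p • f x y :=
  map_smul (BFull.mk n k) p (f0 x y)

theorem bArrow_arrowFamily : ArrowFamily id (bArrow (n := n) (k := k)) :=
  b0Arrow_arrowFamily.map _ BFull.mk_surjective

theorem bRel_homogeneous {a b : B0 n k} (h : BRel n k a b) :
    b = 0 ∧ ∃ d, a ∈ arrowGr id b0Arrow d := by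
  cases h with
  | RR i j h => exact ⟨rfl, _, b0Arrow_arrowFamily.mul_mem _ _ _ _ (Rgen_mem i) (Rgen_mem j)⟩
  | LL i j h => exact ⟨rfl, _, b0Arrow_arrowFamily.mul_mem _ _ _ _ (Lgen_mem j) (Lgen_mem i)⟩
  | U j x h₁ h₂ =>
    exact ⟨rfl, _, mem_arrowGr (τ := id) (g := b0Arrow) (x := x) (y := x)
      (MvPolynomial.isHomogeneous_X ℤ j)⟩

theorem bArrow_isInternal : DirectSum.IsInternal (arrowGr id (bArrow (n := n) (k := k))) := by
  refine b0Arrow_arrowFamily.isInternal_quotient b0Arrow_isInternal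
    (BFull.mk n k : B0 n k →+* BFull n k) BFull.mk_surjective (r := BRel n k) ?_ ?_
  · intro s hs
    exact BFull.mk_eq_iff.mp (hs.trans (map_zero (BFull.mk n k)).symm)
  · intro a b hab
    obtain ⟨rfl, h⟩ := bRel_homogeneous hab
    rw [sub_zero]
    exact AddSubgroup.subset_closure ⟨h, (BFull.mk_eq_iff.mpr (RingConGen.Rel.of _ _ hab)).trans
      (map_zero (BFull.mk n k))⟩

/-- The multiples of `f_{x,y}` in `B_l(n,k)`. -/
def blArrow (x y : LState n k) : PolyR n →+ BlZ n k where
  toFun p := fl p x y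
  map_zero' := Subtype.ext (zero_smul _ _)
  map_add' p q := Subtype.ext (add_smul p q _)

/-- The inclusion of `B_l(n,k)` in `B(n,k)`. -/
def blIncl : BlZ n k →+ BFull n k where
  toFun b := b.1
  map_zero' := rfl
  map_add' _ _ := rfl

theorem blIncl_injective : Function.Injective (blIncl (n := n) (k := k)) := Subtype.val_injective

theorem blIncl_blArrow (x y : LState n k) (p : PolyR n) :
    blIncl (blArrow x y p) = bArrow (toI x) (toI y) p := (bArrow_apply _ _ _).symm

theorem blIncl_mul (a b : BlZ n k) : blIncl (a * b) = blIncl a * blIncl b := rfl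

theorem blIncl_one : blIncl (1 : BlZ n k) = eLeft n k := rfl

theorem eLeft_mul_of_notMem {x : IState n k} (hx : x ∉ Set.range (toI : LState n k → IState n k))
    (y : IState n k) : eLeft n k * f x y = 0 := by
  rw [eLeft, Finset.sum_mul]
  exact Finset.sum_eq_zero fun z _ => f_mul_of_ne _ _ _ _ fun h => hx ⟨z, h⟩

theorem mul_eLeft_of_notMem {y : IState n k} (hy : y ∉ Set.range (toI : LState n k → IState n k))
    (x : IState n k) : f x y * eLeft n k = 0 := by
  rw [eLeft, Finset.mul_sum]
  exact Finset.sum_eq_zero fun z _ => f_mul_of_ne _ _ _ _ fun h => hy ⟨z, h.symm⟩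

theorem blArrow_arrowFamily : ArrowFamily toI (blArrow (n := n) (k := k)) where
  mul x y z p q := blIncl_injective <| by
    rw [blIncl_mul, blIncl_blArrow, blIncl_blArrow, blIncl_blArrow, bArrow_arrowFamily.mul]
    rfl
  orth x y z w p q h := blIncl_injective <| by
    rw [blIncl_mul, blIncl_blArrow, blIncl_blArrow,
      bArrow_arrowFamily.orth _ _ _ _ _ _ (fun e => h (toI_injective e)), map_zero]
  one := blIncl_injective <| by
    rw [map_sum, blIncl_one, eLeft]
    exact Finset.sum_congr rfl fun x _ => by rw [blIncl_blArrow, bArrow_apply, one_smul]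
  span s := by
    obtain ⟨p, hp⟩ := bArrow_arrowFamily.span (blIncl s)
    refine ⟨fun x y => p (toI x) (toI y), blIncl_injective ?_⟩
    have hs := (Subsemigroup.mem_corner_iff (eLeft_idem n k)).mp s.2
    have h1 : blIncl s = eLeft n k * blIncl s * eLeft n k :=
      (((congrArg (· * eLeft n k) hs.1).trans hs.2).symm : _)
    rw [h1, hp]
    simp only [map_sum, blIncl_blArrow, Finset.mul_sum, Finset.sum_mul]
    refine (Fintype.sum_of_injective toI toI_injective _ _ ?_ fun x => ?_).symm
    · intro x hx
      refine Finset.sum_eq_zero fun y _ => ?_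
      rw [bArrow_apply, mul_smul_comm, eLeft_mul_of_notMem hx, smul_zero, zero_mul]
    refine Fintype.sum_of_injective toI toI_injective _ _ ?_ fun y => ?_
    · intro y hy
      rw [bArrow_apply, mul_assoc, smul_mul_assoc, mul_eLeft_of_notMem hy, smul_zero, mul_zero]
    · rw [bArrow_apply, mul_smul_comm, eLeft_mul, smul_mul_assoc, mul_eLeft]

/-- A relation in the corner is a relation in `B(n,k)`, where the projections act on the multiples
of each arrow separately, so its components are again relations of the corner. -/
theorem blArrow_isInternal : DirectSum.IsInternal (arrowGr toI (blArrow (n := n) (k := k))) := by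
  refine arrowGr_isInternal blArrow_arrowFamily.span fun p hp d => blIncl_injective ?_
  have h := congrArg (fun b => gproj bArrow_isInternal d (blIncl b)) hp
  simp only [map_sum, blIncl_blArrow, gproj_arrow, map_zero] at h ⊢
  exact h

end Arrows

end

end OSzSar

namespace OSzSar

noncomputable section

universe u

/-! ### The homomorphism from `B_l(n,k)` to `A_{n,k}` -/

/-! ### Paths through two adjacent holes and interval monomials -/

section Divisibility

variable {n k : ℕ}

theorem card_filter_orderEmbOfFin {m : ℕ} {s : Finset (Fin n)} (hs : s.card = m) (i : Fin n)
    (h : Fin m) (h1 : s.orderEmbOfFin hs h ≤ i)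
    (h2 : ∀ h' : Fin m, (h : ℕ) + 1 = h' → i < s.orderEmbOfFin hs h') :
    (s.filter (· ≤ i)).card = h + 1 := by
  have : s.filter (· ≤ i) = (Finset.Iic h).map (s.orderEmbOfFin hs).toEmbedding := by
    ext a
    rw [Finset.mem_filter, Finset.mem_map]
    constructor
    · rintro ⟨ha, hai⟩
      have : a ∈ Set.range (s.orderEmbOfFin hs) := by rw [Finset.range_orderEmbOfFin]; exact ha
      obtain ⟨t, rfl⟩ := this
      refine ⟨t, ?_, rfl⟩
      rw [Finset.mem_Iic]
      by_contra! ht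
      have hlt : (h : ℕ) + 1 < m := lt_of_le_of_lt (Nat.succ_le_of_lt ht) t.isLt
      have h3 := h2 ⟨h + 1, hlt⟩ rfl
      have h4 : s.orderEmbOfFin hs ⟨h + 1, hlt⟩ ≤ s.orderEmbOfFin hs t :=
        (s.orderEmbOfFin hs).monotone (Nat.succ_le_of_lt ht)
      exact absurd (h3.trans_le h4) (not_lt.mpr hai)
    · rintro ⟨t, ht, rfl⟩
      exact ⟨Finset.orderEmbOfFin_mem _ _ _,
        ((s.orderEmbOfFin hs).monotone (Finset.mem_Iic.mp ht)).trans h1⟩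
  rw [this, Finset.card_map, Fin.card_Iic]

/-- Between two consecutive holes the number of preceding holes is constant. -/
theorem wt_add_of_vee_le {x : LState n k} {h : Fin (n - k)} {i : Fin n} (h1 : vee x h ≤ i)
    (h2 : ∀ h' : Fin (n - k), (h : ℕ) + 1 = h' → i < vee x h') : wt (toI x) i + i = k + h := by
  -- Of the `i + 1` positions up to `i`, exactly `h + 1` are holes, so `i - h` elements of `x` are
  -- used up and `k - (i - h)` lie beyond `i`.
  have h3 := card_filter_orderEmbOfFin _ i h h1 h2
  have h4 : bSeq x i + (x.1.filter (· ≤ i)).card = k + 1 := by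
    have hk := Finset.card_filter_add_card_filter_not (s := x.1) (fun a => i < a)
    simp only [not_lt, x.2] at hk
    rw [bSeq]
    omega
  have h5 : (x.1.filter (· ≤ i)).card + (x.1ᶜ.filter (· ≤ i)).card = i + 1 := by
    rw [← Finset.card_union_of_disjoint (Finset.disjoint_filter_filter disjoint_compl_right),
      ← Finset.filter_union, Finset.union_compl, ← Fin.card_Iic]
    congr 1
    ext a; simp
  rw [← wt_toI] at h4
  omega

/-- The number of elements below `m` that do not belong to `s`. -/
def holes (s : IState n k) (m : ℕ) : ℕ := ((s.1)ᶜ.filter fun a : Fin (n + 1) => (a : ℕ) < m).card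

theorem holes_mono (s : IState n k) : Monotone (holes s) := fun m m' h =>
  Finset.card_le_card fun a ha => by
    rw [Finset.mem_filter] at ha ⊢
    exact ⟨ha.1, ha.2.trans_le h⟩

theorem holes_succ_of_notMem (s : IState n k) (a : Fin (n + 1)) (ha : a ∉ s.1) :
    holes s (a + 1) = holes s a + 1 := by
  have : (s.1)ᶜ.filter (fun b : Fin (n + 1) => (b : ℕ) < a + 1) =
      insert a ((s.1)ᶜ.filter fun b : Fin (n + 1) => (b : ℕ) < a) := by
    ext b
    simp only [Finset.mem_filter, Finset.mem_insert, Finset.mem_compl, Fin.ext_iff]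
    constructor
    · rintro ⟨h1, h2⟩
      by_cases h : (b : ℕ) = a
      · exact Or.inl h
      · exact Or.inr ⟨h1, by omega⟩
    · rintro (h | ⟨h1, h2⟩)
      · rw [Fin.ext h]; exact ⟨ha, by omega⟩
      · exact ⟨h1, by omega⟩
  rw [holes, this, Finset.card_insert_of_notMem (by simp)]
  rfl

theorem wt_add_holes (s : IState n k) (l : Fin n) : wt s l + (l + 1) = k + holes s (l + 1) := by
  have h1 : wt s l + (s.1.filter fun a : Fin (n + 1) => (a : ℕ) < l + 1).card = k := by
    conv_rhs => rw [← s.2]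
    rw [wt, ← Finset.card_filter_add_card_filter_not (s := s.1)
      (fun a : Fin (n + 1) => (l : ℕ) + 1 ≤ a)]
    simp only [not_le]
  have h2 : (s.1.filter fun a : Fin (n + 1) => (a : ℕ) < l + 1).card + holes s (l + 1) = l + 1 := by
    rw [holes, ← Finset.card_union_of_disjoint
      (Finset.disjoint_filter_filter disjoint_compl_right), ← Finset.filter_union,
      Finset.union_compl]
    have : (Finset.univ.filter fun a : Fin (n + 1) => (a : ℕ) < l + 1) = Finset.Iic l.castSucc := by
      ext a
      simp only [Finset.mem_filter, Finset.mem_univ, true_and, Finset.mem_Iic, Fin.le_def,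
        Fin.val_castSucc]
      omega
    rw [this, Fin.card_Iic]
    rfl
  omega

theorem holes_le (s : IState n k) (m : ℕ) : holes s m + k ≤ n + 1 := by
  have h1 : holes s m ≤ (s.1)ᶜ.card := Finset.card_filter_le _ _
  have h2 := Finset.card_add_card_compl s.1
  rw [s.2, Fintype.card_fin] at h2
  omega

/-- A monomial in which all lines occur along which `x` and `y` agree with a state `s` with two
consecutive holes, except possibly for the line between the holes, is divisible by one of the
monomials that generate `W`. -/
theorem exists_intervalMono_dvd (x y : LState n k) (s : IState n k) {j : Fin n}
    (h₁ : j.castSucc ∉ s.1) (h₂ : j.succ ∉ s.1) (e : Fin n → ℕ) (he : ∀ l,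
      wt (toI x) l = wt (toI y) l → (wt s l ≠ wt (toI x) l ∨ l = j) → e l ≠ 0) :
    ∃ h, intervalMono y x h ∣ ∏ l, (MvPolynomial.X l : PolyR n) ^ e l := by
  have h3 := holes_succ_of_notMem s _ h₁
  have h4 := holes_succ_of_notMem s _ h₂
  rw [Fin.val_castSucc] at h3
  rw [Fin.val_succ] at h4
  have h5 := holes_le s ((j : ℕ) + 1 + 1)
  -- The index is the number of holes of `s` before the two adjacent ones. On this interval `x` and
  -- `y` both have that many holes, plus one, up to `l`; `s` has the same number only for `l = j`,
  -- because it has one fewer before `j` and one more after it.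
  refine ⟨⟨holes s j, by omega⟩, ?_⟩
  rw [intervalMono]
  refine (Finset.prod_dvd_prod_of_dvd _ (fun l => (MvPolynomial.X l : PolyR n) ^ e l) ?_).trans
    (Finset.prod_dvd_prod_of_subset _ _ _ (Finset.subset_univ _))
  intro l hl
  refine dvd_pow_self _ ?_
  rw [Finset.mem_filter, max_le_iff] at hl
  obtain ⟨-, ⟨hy, hx⟩, hlt⟩ := hl
  have hwx := wt_add_of_vee_le hx fun h' hh => (hlt h' hh).trans_le (min_le_left _ _)
  have hwy := wt_add_of_vee_le hy fun h' hh => (hlt h' hh).trans_le (min_le_right _ _)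
  refine he l (by omega) ?_
  by_cases hs : wt s l = wt (toI x) l
  · right
    have hws := wt_add_holes s l
    simp only at hwx
    have h6 : holes s (l + 1) = holes s j + 1 := by omega
    by_contra hne
    have hne' : (l : ℕ) ≠ j := fun e => hne (Fin.ext e)
    rcases Nat.lt_or_ge l j with hlj | hlj
    · have := holes_mono s (show (l : ℕ) + 1 ≤ j by omega)
      omega
    · have := holes_mono s (show (j : ℕ) + 1 + 1 ≤ l + 1 by omega)
      omega
  · exact Or.inl hs

theorem aArrow_mul_eq_zero (x y : LState n k) (s : IState n k) {j : Fin n}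
    (h₁ : j.castSucc ∉ s.1) (h₂ : j.succ ∉ s.1) (e : Fin n → ℕ) (he : ∀ l,
      wt (toI x) l = wt (toI y) l → (wt s l ≠ wt (toI x) l ∨ l = j) → e l ≠ 0) (q : PolyR n) :
    aArrow x y (q * ∏ l, (MvPolynomial.X l : PolyR n) ^ e l) = 0 := by
  obtain ⟨h, r, hr⟩ := exists_intervalMono_dvd x y s h₁ h₂ e he
  have : aArrow x y (q * ∏ l, (MvPolynomial.X l : PolyR n) ^ e l) =
      aCls y x ((q * ∏ l, (MvPolynomial.X l : PolyR n) ^ e l) • cHom y x) := rfl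
  rw [this]
  refine aCls_eq_zero_of_mem ?_
  by_cases hxy : TooFar y x
  · rw [Wsub, if_pos hxy]; trivial
  · rw [Wsub_eq_span hxy, hr, mul_comm (intervalMono y x h), ← mul_assoc, mul_smul]
    exact Submodule.smul_mem _ _ (Submodule.subset_span ⟨h, rfl⟩)

theorem aArrow_of_tooFar {x y : LState n k} (h : TooFar y x) (p : PolyR n) : aArrow x y p = 0 := by
  have : aArrow x y p = aCls y x (p • cHom y x) := rfl
  rw [this]
  exact aCls_eq_zero_of_mem (by rw [Wsub, if_pos h]; trivial)

end Divisibility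

/-! ### Construction and uniqueness of `Ξ` -/

section Xi

variable {n k : ℕ}

/-- The map from `B₀(n,k)` to `A_{n,k}` that forgets the arrows between states that are not left. -/
def xi0 : B0 n k →+ AZ n k := ∑ x, ∑ y, (aArrow x y).comp (b0Coef (toI x) (toI y))

theorem xi0_b0Arrow (x y : LState n k) (p : PolyR n) :
    xi0 (b0Arrow (toI x) (toI y) p) = aArrow x y p := by
  simp only [xi0, AddMonoidHom.finsetSum_apply, AddMonoidHom.comp_apply, b0Coef_b0Arrow]
  rw [Finset.sum_eq_single x, Finset.sum_eq_single y, if_pos ⟨rfl, rfl⟩]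
  · intro y' _ hy
    rw [if_neg (fun h => hy (toI_injective h.2).symm), map_zero]
  · simp
  · intro x' _ hx
    refine Finset.sum_eq_zero fun y' _ => ?_
    rw [if_neg (fun h => hx (toI_injective h.1).symm), map_zero]
  · simp

theorem xi0_b0Arrow_of_notMem {x y : IState n k} (h : ¬ (x ∈ Set.range (toI : LState n k → _) ∧
    y ∈ Set.range (toI : LState n k → _))) (p : PolyR n) : xi0 (b0Arrow x y p) = 0 := by
  simp only [xi0, AddMonoidHom.finsetSum_apply, AddMonoidHom.comp_apply, b0Coef_b0Arrow]
  refine Finset.sum_eq_zero fun x' _ => Finset.sum_eq_zero fun y' _ => ?_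
  rw [if_neg (fun e => h ⟨⟨x', e.1.symm⟩, ⟨y', e.2.symm⟩⟩), map_zero]

/-- The exponents in `f_{x,a} f_{a,c} f_{c,b} f_{b,y}`. -/
theorem two_mul_gExp_add (x a c b y : IState n k) (l : Fin n) :
    2 * (gExp x a c l + gExp x c b l + gExp x b y l) + wtDist x y l =
      wtDist x a l + wtDist a c l + wtDist c b l + wtDist b y l := by
  have h1 := two_mul_gExp x a c l
  have h2 := two_mul_gExp x c b l
  have h3 := two_mul_gExp x b y l
  omega

/-- On a line where `x` and `y` have equal weights, the exponent is half the total variation of the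
weight along the path. It is nonzero if the path visits `s` with another weight there, and also on
line `j`, which one of the two middle arrows crosses. So the monomial is divisible by an interval
monomial. -/
theorem xi0_path_eq_zero (x a c b y : IState n k) (p q : PolyR n) (s : IState n k) {j : Fin n}
    (h₁ : j.castSucc ∉ s.1) (h₂ : j.succ ∉ s.1) (hs : s = a ∨ s = b)
    (hj : wtDist a c j ≠ 0 ∨ wtDist c b j ≠ 0) :
    xi0 (b0Arrow x a p * (f0 a c * f0 c b) * b0Arrow b y q) = 0 := by
  have h0 : b0Arrow x a p * (f0 a c * f0 c b) * b0Arrow b y q = b0Arrow x y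
      (p * q * ∏ l, (MvPolynomial.X l : PolyR n) ^ (gExp x a c l + gExp x c b l + gExp x b y l)) := by
    have h1 : f0 x a * (f0 a c * f0 c b) * f0 b y =
        (gMono x a c * gMono x c b * gMono x b y) • f0 x y := by
      rw [← mul_assoc, f0_mul, smul_mul_assoc, f0_mul, smul_smul, smul_mul_assoc, f0_mul, smul_smul]
    rw [b0Arrow_apply, b0Arrow_apply, b0Arrow_apply, smul_mul_assoc, smul_mul_assoc, mul_smul_comm,
      h1, smul_smul, smul_smul]
    simp only [gMono, pow_add, Finset.prod_mul_distrib]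
  rw [h0]
  by_cases h : x ∈ Set.range (toI : LState n k → _) ∧ y ∈ Set.range (toI : LState n k → _)
  · obtain ⟨⟨x, rfl⟩, ⟨y, rfl⟩⟩ := h
    rw [xi0_b0Arrow]
    refine aArrow_mul_eq_zero x y s h₁ h₂ _ (fun l hl hor => ?_) _
    have h3 := two_mul_gExp_add (toI x) a c b (toI y) l
    unfold wtDist at h3 hj
    rcases hor with hor | rfl
    · rcases hs with rfl | rfl <;> omega
    · omega
  · exact xi0_b0Arrow_of_notMem h _

theorem b0_mul_mul_induction {N : Type*} [AddCommGroup N] (Θ : B0 n k →+ N) (r : B0 n k)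
    (h : ∀ x a b y p q, Θ (b0Arrow x a p * r * b0Arrow b y q) = 0) (u v : B0 n k) :
    Θ (u * r * v) = 0 := by
  obtain ⟨p, rfl⟩ := b0Arrow_arrowFamily.span u
  obtain ⟨q, rfl⟩ := b0Arrow_arrowFamily.span v
  simp only [Finset.sum_mul, Finset.mul_sum, map_sum, h, Finset.sum_const_zero]

/-- Expanding the sums that define the `R_i` or the `L_i` leaves only single paths; products of
arrows that do not meet vanish. -/
theorem xi0_sum_sum_eq_zero (P Q : IState n k → IState n k → Prop) [∀ x y, Decidable (P x y)]
    [∀ x y, Decidable (Q x y)] (hPQ : ∀ x a c b y p q, P a c → Q c b →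
      xi0 (b0Arrow x a p * (f0 a c * f0 c b) * b0Arrow b y q) = 0) (u v : B0 n k) :
    xi0 (u * ((∑ a, ∑ c, if P a c then f0 a c else 0) * (∑ c, ∑ b, if Q c b then f0 c b else 0)) * v)
      = 0 := by
  refine b0_mul_mul_induction _ _ (fun x a' b' y p q => ?_) u v
  simp only [Finset.sum_mul, Finset.mul_sum, map_sum]
  refine Finset.sum_eq_zero fun c' _ => Finset.sum_eq_zero fun b _ => Finset.sum_eq_zero fun a _ =>
    Finset.sum_eq_zero fun c _ => ?_
  split_ifs with h1 h2
  · by_cases hc : c = c'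
    · subst hc
      by_cases ha : a' = a
      · subst ha
        by_cases hb : b = b'
        · subst hb
          exact hPQ _ _ _ _ _ _ _ h1 h2
        · rw [b0Arrow_apply b', mul_assoc, mul_assoc, mul_smul_comm, f0_mul_of_ne _ _ _ _ hb]
          simp
      · rw [b0Arrow_apply x, ← mul_assoc, smul_mul_assoc, f0_mul_of_ne _ _ _ _ ha]
        simp
    · rw [f0_mul_of_ne _ _ _ _ hc]; simp
  all_goals simp

theorem xi0_bRel {a b : B0 n k} (h : BRel n k a b) (u v : B0 n k) : xi0 (u * a * v) = 0 := by
  classical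
  cases h with
  | RR i j hij =>
    refine xi0_sum_sum_eq_zero _ _ (fun x a c b y p q h1 h2 => ?_) u v
    have h3 := wt_of_isStep h2 j
    rw [if_pos rfl] at h3
    obtain ⟨ha, ha', hc⟩ := h1
    have hij' : i.succ = j.castSucc := Fin.ext (by simpa using hij)
    -- The state with two adjacent holes is the source `a`: its element enters the first hole and
    -- would then enter the second one. In the case of `L` it is the target `b`.
    refine xi0_path_eq_zero x a c b y p q a (j := j) (hij' ▸ ha') (fun hj => h2.2.1 ?_) (Or.inl rfl)
      (Or.inr (by unfold wtDist; omega))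
    rw [hc, Finset.mem_insert, Finset.mem_erase]
    refine Or.inr ⟨fun e => ?_, hj⟩
    have := congrArg Fin.val e
    simp at this
    omega
  | LL i j hij =>
    refine xi0_sum_sum_eq_zero _ _ (fun x a c b y p q h1 h2 => ?_) u v
    have h3 := wt_of_isStep h1 j
    rw [if_pos rfl] at h3
    obtain ⟨hb, hb', hc⟩ := h2
    have hij' : i.succ = j.castSucc := Fin.ext (by simpa using hij)
    refine xi0_path_eq_zero x a c b y p q b (j := j) (hij' ▸ hb') (fun hj => h1.2.1 ?_) (Or.inr rfl)
      (Or.inl (by unfold wtDist; omega))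
    rw [hc, Finset.mem_insert, Finset.mem_erase]
    refine Or.inr ⟨fun e => ?_, hj⟩
    have := congrArg Fin.val e
    simp at this
    omega
  | U j s h₁ h₂ =>
    refine b0_mul_mul_induction _ _ (fun x a b y p q => ?_) u v
    by_cases ha : a = s
    · subst ha
      by_cases hb : a = b
      · subst hb
        have h0 : b0Arrow x a p * ((MvPolynomial.X j : PolyR n) • f0 a a) * b0Arrow a y q =
            b0Arrow x y (p * q * ∏ l, (MvPolynomial.X l : PolyR n) ^
              ((if l = j then 1 else 0) + gExp x a y l)) := by
          have hX : ∏ l : Fin n, (MvPolynomial.X l : PolyR n) ^ (if l = j then 1 else 0) =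
              MvPolynomial.X j := by
            rw [Finset.prod_eq_single j]
            · simp
            · intro l _ hl; simp [hl]
            · simp
          simp only [b0Arrow_apply, smul_mul_assoc, mul_smul_comm, f0_mul, smul_smul, pow_add,
            Finset.prod_mul_distrib, hX, gMono_self_right]
          rw [gMono]
          congr 1
          ring
        rw [h0]
        by_cases h : x ∈ Set.range (toI : LState n k → _) ∧ y ∈ Set.range (toI : LState n k → _)
        · obtain ⟨⟨x, rfl⟩, ⟨y, rfl⟩⟩ := h
          rw [xi0_b0Arrow]
          refine aArrow_mul_eq_zero x y a h₁ h₂ _ (fun l hl hor => ?_) _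
          rcases hor with hor | rfl
          · have h3 := two_mul_gExp (toI x) a (toI y) l
            unfold wtDist at h3
            omega
          · simp
        · exact xi0_b0Arrow_of_notMem h _
      · simp only [b0Arrow_apply, mul_smul_comm, smul_mul_assoc, mul_assoc,
          f0_mul_of_ne _ _ _ _ hb, smul_zero, mul_zero, map_zero]
    · rw [b0Arrow_apply x]
      simp [f0_mul_of_ne _ _ _ _ ha]

/-- `xi0` is not treated as multiplicative, since paths between left states may run through states
that are not left. It descends as an additive map because it kills every product containing a
relation; multiplicativity is recovered on the corner. -/
theorem xi0_eq_of_mk_eq {a b : B0 n k} (h : BFull.mk n k a = BFull.mk n k b) : xi0 a = xi0 b := by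
  refine map_eq_of_ringConGen (r := BRel n k) xi0 (fun a b hab u v => ?_) (BFull.mk_eq_iff.mp h)
  rw [xi0_bRel hab, (bRel_homogeneous hab).1, mul_zero, zero_mul, map_zero]

/-- The map from `B(n,k)` to `A_{n,k}` that forgets the arrows between states that are not left. -/
def xiFull : BFull n k →+ AZ n k where
  toFun b := xi0 (Function.surjInv BFull.mk_surjective b)
  map_zero' := by
    rw [← map_zero xi0]
    apply xi0_eq_of_mk_eq
    rw [Function.surjInv_eq BFull.mk_surjective, map_zero]
  map_add' a b := by
    rw [← map_add xi0]
    apply xi0_eq_of_mk_eq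
    rw [map_add, Function.surjInv_eq BFull.mk_surjective, Function.surjInv_eq BFull.mk_surjective, Function.surjInv_eq BFull.mk_surjective]

theorem xiFull_bArrow (x y : LState n k) (p : PolyR n) :
    xiFull (bArrow (toI x) (toI y) p) = aArrow x y p := by
  rw [← xi0_b0Arrow]
  exact xi0_eq_of_mk_eq (Function.surjInv_eq BFull.mk_surjective _)

/-- An additive map that sends arrows to arrows is multiplicative. -/
def ArrowFamily.ringHom {Λ : Type} [Fintype Λ] {τ : Λ → IState n k} {S Q : Type*} [Ring S] [Ring Q]
    {g : Λ → Λ → PolyR n →+ S} {g' : Λ → Λ → PolyR n →+ Q} (hg : ArrowFamily τ g)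
    (hg' : ArrowFamily τ g') (F : S →+ Q) (hF : ∀ x y p, F (g x y p) = g' x y p) : S →+* Q where
  __ := F
  map_one' := by
    change F 1 = 1
    rw [← hg.one, ← hg'.one, map_sum]
    simp only [hF]
  map_mul' a b := by
    change F (a * b) = F a * F b
    obtain ⟨p, rfl⟩ := hg.span a
    obtain ⟨q, rfl⟩ := hg.span b
    simp only [Finset.sum_mul, Finset.mul_sum, map_sum, hF]
    refine Finset.sum_congr rfl fun z _ => Finset.sum_congr rfl fun w _ => Finset.sum_congr rfl
      fun x _ => Finset.sum_congr rfl fun y _ => ?_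
    by_cases h : y = z
    · subst h; rw [hg.mul, hF, hg'.mul]
    · rw [hg.orth _ _ _ _ _ _ h, hg'.orth _ _ _ _ _ _ h, map_zero]

/-- The homomorphism `Ξ`. -/
def xi (n k : ℕ) : BlZ n k →+* AZ n k :=
  blArrow_arrowFamily.ringHom aArrow_arrowFamily (xiFull.comp blIncl) fun x y p => by
    rw [AddMonoidHom.comp_apply, blIncl_blArrow, xiFull_bArrow]

theorem xi_blArrow (x y : LState n k) (p : PolyR n) : xi n k (blArrow x y p) = aArrow x y p := by
  change xiFull (blIncl (blArrow x y p)) = _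
  rw [blIncl_blArrow, xiFull_bArrow]

/-- The case distinction disappears because `W` is everything for pairs that are too far, so the
class of `1 ↦ x^c` is already zero there. -/
theorem isXi_iff (Ξ : BlZ n k →+* AZ n k) :
    IsXi Ξ ↔ ∀ x y p, Ξ (blArrow x y p) = aArrow x y p := by
  constructor
  · intro h x y p
    by_cases hxy : TooFar y x
    · rw [aArrow_of_tooFar hxy]
      exact (h p x y).1 hxy
    · obtain ⟨φ, hφ, h⟩ := (h p x y).2 hxy
      rw [aArrow_apply, ← sMod_hom_ext (hφ.trans (cHom_one y x).symm)]
      exact h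
  · intro h p x y
    refine ⟨fun hxy => ?_, fun _ => ⟨cHom y x, cHom_one y x, ?_⟩⟩
    · exact (h x y p).trans (aArrow_of_tooFar hxy p)
    · exact (h x y p).trans (aArrow_apply x y p)

theorem existsUnique_isXi (n k : ℕ) : ∃! Ξ : BlZ n k →+* AZ n k, IsXi Ξ := by
  refine ⟨xi n k, (isXi_iff _).mpr xi_blArrow, fun Ξ hΞ => RingHom.ext fun b => ?_⟩
  obtain ⟨p, rfl⟩ := blArrow_arrowFamily.span b
  simp only [map_sum, xi_blArrow, (isXi_iff Ξ).mp hΞ]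

/-- The characters of `A_{n,k}`, pulled back along `Ξ`, witness that the relations of `B(n,k)` do
not kill the idempotents. -/
theorem blGr_isBasicGr (𝕜 : Type u) [Field 𝕜] (n k : ℕ) :
    IsBasicGr 𝕜 (blGr 𝕜 n k) (fun x : LState n k => (1 : 𝕜) ⊗ₜ[ℤ] fl 1 x x)
      (fun x => baseAug 𝕜 ((aZ_aug x).comp (xi n k))) :=
  blArrow_arrowFamily.isBasicGr 𝕜 toI_injective blArrow_isInternal _ fun l x y p => by
    rw [RingHom.comp_apply, xi_blArrow, aZ_aug_aArrow]

theorem xiBase_mem (𝕜 : Type u) [Field 𝕜] {Ξ : BlZ n k →+* AZ n k} (hΞ : IsXi Ξ) (d : ℤ)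
    (b : Bl 𝕜 n k) (hb : b ∈ blGr 𝕜 n k d) : xiBase 𝕜 Ξ b ∈ sarGr 𝕜 n k d := by
  have h1 : ∀ s ∈ blZGr n k d, Ξ s ∈ aZGr n k d := by
    intro s hs
    rw [aZGr_eq_arrowGr]
    refine AddSubgroup.closure_induction ?_ (by rw [map_zero]; exact zero_mem _) ?_ ?_ hs
    · rintro _ ⟨x, y, p, m, hp, hd, rfl⟩
      exact AddSubgroup.subset_closure ⟨x, y, p, m, hp, hd, (isXi_iff Ξ).mp hΞ x y p⟩
    · intro s t _ _ hs ht; rw [map_add]; exact add_mem hs ht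
    · intro s _ hs; rw [map_neg]; exact neg_mem hs
  refine AddSubgroup.closure_induction ?_ (by rw [map_zero]; exact zero_mem _) ?_ ?_ hb
  · rintro _ ⟨c, s, hs, rfl⟩
    exact AddSubgroup.subset_closure ⟨c, Ξ s, h1 s hs, rfl⟩
  · intro s t _ _ hs ht; rw [map_add]; exact add_mem hs ht
  · intro s _ hs
    have : xiBase 𝕜 Ξ (-s) = -xiBase 𝕜 Ξ s := (xiBase 𝕜 Ξ).toAddMonoidHom.map_neg s
    rw [this]
    exact neg_mem hs

theorem xiBase_idem (𝕜 : Type u) [Field 𝕜] {Ξ : BlZ n k →+* AZ n k} (hΞ : IsXi Ξ)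
    (l : LState n k) : xiBase 𝕜 Ξ (1 ⊗ₜ fl 1 l l) = 1 ⊗ₜ aCls l l LinearMap.id := by
  rw [← aArrow_one, ← (isXi_iff Ξ).mp hΞ l l 1]
  rfl

end Xi

end

end OSzSar

namespace OSzSar

noncomputable section

/-! ### The canonical basis of the weight space -/

section WeightSpace

variable {n k : ℕ}

/-- Subsets and their characteristic functions. -/
def indicatorEquiv (n : ℕ) : (Fin n → Fin 2) ≃ Finset (Fin n) where
  toFun f := Finset.univ.filter fun i => f i = 0
  invFun s i := if i ∈ s then 0 else 1
  left_inv f := by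
    funext i
    simp only [Finset.mem_filter, Finset.mem_univ, true_and]
    split_ifs with h <;> omega
  right_inv s := by
    ext i
    simp

/-- The standard basis of `V^{⊗n}`. -/
def stdBasis (n : ℕ) : Module.Basis (Finset (Fin n)) Cq (VTensor n) :=
  (Basis.piTensorProduct fun _ : Fin n => Pi.basisFun Cq (Fin 2)).reindex (indicatorEquiv n)

theorem stdBasis_apply (s : Finset (Fin n)) : stdBasis n s = stdVec s := by
  rw [stdBasis, Module.Basis.reindex_apply, Basis.piTensorProduct_apply, stdVec]
  congr 1
  funext i
  change Pi.basisFun Cq (Fin 2) (if i ∈ s then 0 else 1) = _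
  split_ifs <;> simp [vBasis]

theorem Kact_vBasis (i j : Fin 2) :
    Kact i (vBasis j) = (if j = i then (RatFunc.X : Cq) else 1) • vBasis j := by
  funext l
  change (if l = i then (RatFunc.X : Cq) else 1) • vBasis j l =
    (if j = i then (RatFunc.X : Cq) else 1) • vBasis j l
  by_cases h : l = j
  · rw [h]
  · rw [vBasis, Pi.single_eq_of_ne h, smul_zero, smul_zero]

theorem KactTensor_stdVec (i : Fin 2) (s : Finset (Fin n)) : KactTensor n i (stdVec s) =
    (∏ j : Fin n, if (if j ∈ s then (0 : Fin 2) else 1) = i then (RatFunc.X : Cq) else 1) •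
      stdVec s := by
  have h : (fun j => Kact i (if j ∈ s then vBasis 0 else vBasis 1)) = fun j =>
      (if (if j ∈ s then (0 : Fin 2) else 1) = i then (RatFunc.X : Cq) else 1) •
        (if j ∈ s then vBasis 0 else vBasis 1) := by
    funext j
    split_ifs <;> rw [Kact_vBasis] <;> simp_all
  rw [stdVec, KactTensor, PiTensorProduct.map_tprod, h, MultilinearMap.map_smul_univ]

theorem KactTensor_zero_stdVec (s : Finset (Fin n)) :
    KactTensor n 0 (stdVec s) = (RatFunc.X : Cq) ^ s.card • stdVec s := by
  rw [KactTensor_stdVec]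
  congr 1
  have : ∀ j, ((if j ∈ s then (0 : Fin 2) else 1) = 0) ↔ j ∈ s := fun j => by split_ifs <;> simp_all
  simp only [this]
  rw [Finset.prod_ite_mem, Finset.univ_inter, Finset.prod_const]

theorem KactTensor_one_stdVec (s : Finset (Fin n)) :
    KactTensor n 1 (stdVec s) = (RatFunc.X : Cq) ^ ((n : ℤ) - s.card) • stdVec s := by
  rw [KactTensor_stdVec]
  congr 1
  have : ∀ j, ((if j ∈ s then (0 : Fin 2) else 1) = 1) ↔ j ∈ sᶜ := fun j => by
    rw [Finset.mem_compl]; split_ifs <;> simp_all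
  simp only [this]
  have hs : s.card ≤ n := by simpa using Finset.card_le_univ s
  rw [Finset.prod_ite_mem, Finset.univ_inter, Finset.prod_const, Finset.card_compl, Fintype.card_fin,
    ← Nat.cast_sub hs, zpow_natCast]

theorem stdVec_mem_weightSpace (x : LState n k) : stdVec x.1 ∈ weightSpace n k :=
  ⟨by rw [KactTensor_zero_stdVec, x.2], by rw [KactTensor_one_stdVec, x.2]⟩

theorem ratFuncX_pow_injective : Function.Injective fun m : ℕ => (RatFunc.X : Cq) ^ m := by
  intro a b h
  have h1 : algebraMap (Polynomial ℂ) (RatFunc ℂ) (Polynomial.X ^ a) =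
      algebraMap (Polynomial ℂ) (RatFunc ℂ) (Polynomial.X ^ b) := by
    rw [map_pow, map_pow, RatFunc.algebraMap_X]
    exact h
  have h2 := RatFunc.algebraMap_injective ℂ h1
  have h3 := congrArg Polynomial.natDegree h2
  rwa [Polynomial.natDegree_X_pow, Polynomial.natDegree_X_pow] at h3

/-- Standard vectors are eigenvectors of `K₁` with eigenvalue `q` to the number of `v₀`, and the
powers of `q` are distinct. So the condition on `K₁` alone already excludes coefficients at subsets
of another size. -/
theorem weightSpace_eq_span :
    weightSpace n k = Submodule.span Cq (Set.range fun x : LState n k => stdVec x.1) := by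
  refine le_antisymm ?_ (Submodule.span_le.mpr ?_)
  · intro v hv
    have h1 : ∀ s, s.card ≠ k → (stdBasis n).repr v s = 0 := by
      intro s hs
      have h2 : (stdBasis n).repr (KactTensor n 0 v) s =
          (RatFunc.X : Cq) ^ s.card * (stdBasis n).repr v s := by
        have h3 : (Finsupp.lapply s ∘ₗ (stdBasis n).repr.toLinearMap) ∘ₗ KactTensor n 0 =
            (RatFunc.X : Cq) ^ s.card • (Finsupp.lapply s ∘ₗ (stdBasis n).repr.toLinearMap) := by
          refine (stdBasis n).ext fun t => ?_
          change (stdBasis n).repr (KactTensor n 0 (stdBasis n t)) s =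
            (RatFunc.X : Cq) ^ s.card * (stdBasis n).repr (stdBasis n t) s
          rw [stdBasis_apply, KactTensor_zero_stdVec, ← stdBasis_apply, map_smul,
            Finsupp.smul_apply, Module.Basis.repr_self, smul_eq_mul]
          by_cases h : t = s
          · rw [h]
          · rw [Finsupp.single_eq_of_ne (Ne.symm h), mul_zero, mul_zero]
        exact LinearMap.congr_fun h3 v
      rw [hv.1, map_smul, Finsupp.smul_apply, smul_eq_mul] at h2
      have h3 : ((RatFunc.X : Cq) ^ k - RatFunc.X ^ s.card) * (stdBasis n).repr v s = 0 := by
        rw [sub_mul, h2, sub_self]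
      rcases mul_eq_zero.mp h3 with h4 | h4
      · exact absurd (ratFuncX_pow_injective (sub_eq_zero.mp h4)).symm hs
      · exact h4
    rw [← (stdBasis n).sum_repr v]
    refine sum_mem fun s _ => ?_
    by_cases hs : s.card = k
    · refine Submodule.smul_mem _ _ (Submodule.subset_span ⟨⟨s, hs⟩, ?_⟩)
      exact (stdBasis_apply s).symm
    · rw [h1 s hs, zero_smul]; exact zero_mem _
  · rintro _ ⟨x, rfl⟩
    exact stdVec_mem_weightSpace x

theorem finrank_weightSpace : Module.finrank Cq (weightSpace n k) = Fintype.card (LState n k) := by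
  have hli : LinearIndependent Cq fun x : LState n k => stdVec x.1 := by
    have := (stdBasis n).linearIndependent.comp (fun x : LState n k => x.1) Subtype.val_injective
    convert this using 1
    funext x
    exact (stdBasis_apply x.1).symm
  rw [weightSpace_eq_span]
  exact finrank_span_eq_card hli

/-- The summands of a canonical basis element other than the leading one have smaller index. -/
theorem wedge_mem (x : LState n k) (t : Finset (Fin n))
    (ht : t ⊆ x.1.filter fun i : Fin n => 0 < (i : ℕ)) (K : Submodule Cq (VTensor n))
    (hK : ∀ y : LState n k, ∑ i ∈ y.1, (i : ℕ) + t.card ≤ ∑ i ∈ x.1, (i : ℕ) → stdVec y.1 ∈ K) :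
    wedge x.1 (fun i => if i ∈ t then ⟨(i : ℕ) - 1, (Nat.sub_le _ _).trans_lt i.isLt⟩ else i) ∈ K := by
  rw [wedge]
  split_ifs with h
  · refine hK ⟨_, (Finset.card_image_of_injOn h).trans x.2⟩ ?_
    have htx : t ⊆ x.1 := ht.trans (Finset.filter_subset _ _)
    have h1 : t.card = ∑ i ∈ x.1, if i ∈ t then 1 else 0 := by
      rw [Finset.sum_ite_mem, Finset.inter_eq_right.mpr htx]; simp
    rw [Finset.sum_image h, h1, ← Finset.sum_add_distrib]
    refine Finset.sum_le_sum fun i _ => ?_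
    by_cases hi : i ∈ t
    · rw [if_pos hi, if_pos hi]
      have := (Finset.mem_filter.mp (ht hi)).2
      change (i : ℕ) - 1 + 1 ≤ i
      omega
    · rw [if_neg hi, if_neg hi, add_zero]
  · exact zero_mem _

theorem canon_mem_weightSpace (x : LState n k) : canon x ∈ weightSpace n k :=
  sum_mem fun t ht => Submodule.smul_mem _ _ <|
    wedge_mem x t (Finset.mem_powerset.mp ht) _ fun y _ => stdVec_mem_weightSpace y

/-- Unitriangularity: the summand for `t = ∅` is the standard vector with coefficient `1`, and every
other nonzero summand moves some positions to the left, which lowers their sum. -/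
theorem stdVec_mem_span_canon (N : ℕ) : ∀ x : LState n k, ∑ i ∈ x.1, (i : ℕ) < N →
    stdVec x.1 ∈ Submodule.span Cq (Set.range (canon : LState n k → VTensor n)) := by
  induction N with
  | zero => intro x hx; omega
  | succ N ih =>
    intro x hx
    have hx' : canon x ∈ Submodule.span Cq (Set.range (canon : LState n k → VTensor n)) :=
      Submodule.subset_span ⟨x, rfl⟩
    have h0 := hx'
    rw [canon, ← Finset.sum_erase_add _ _ (Finset.empty_mem_powerset _)] at h0
    have h1 : wedge x.1 (fun i => if i ∈ (∅ : Finset (Fin n)) then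
        ⟨(i : ℕ) - 1, (Nat.sub_le _ _).trans_lt i.isLt⟩ else i) = stdVec x.1 := by
      simp only [Finset.notMem_empty, if_false, wedge]
      rw [if_pos (show Set.InjOn (fun i => i) (x.1 : Set (Fin n)) from fun a _ b _ h => h), Finset.image_id']
    rw [h1, Finset.card_empty, pow_zero, one_smul] at h0
    refine (Submodule.add_mem_iff_right _ (sum_mem fun t ht => ?_)).mp h0
    rw [Finset.mem_erase, Finset.mem_powerset] at ht
    refine Submodule.smul_mem _ _ (wedge_mem x t ht.2 _ fun y hy => ih y ?_)
    have := Finset.card_pos.mpr (Finset.nonempty_iff_ne_empty.mpr ht.1)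
    omega

/-- The canonical basis of the weight space. -/
def canonBasis (n k : ℕ) : Module.Basis (LState n k) Cq (weightSpace n k) :=
  basisOfTopLeSpanOfCardEqFinrank
    (fun x : LState n k => (⟨canon x, canon_mem_weightSpace x⟩ : weightSpace n k))
    (by
      rintro ⟨v, hv⟩ -
      have h1 : weightSpace n k ≤ Submodule.span Cq (Set.range (canon : LState n k → VTensor n)) := by
        rw [weightSpace_eq_span, Submodule.span_le]
        rintro _ ⟨x, rfl⟩
        exact stdVec_mem_span_canon _ x (Nat.lt_succ_self _)
      have h2 := h1 hv
      have h3 : Set.range (canon : LState n k → VTensor n) = (weightSpace n k).subtype ''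
          Set.range fun x : LState n k => (⟨canon x, canon_mem_weightSpace x⟩ : weightSpace n k) := by
        rw [← Set.range_comp]; rfl
      rw [h3, Submodule.span_image] at h2
      obtain ⟨w, hw, hwv⟩ := h2
      rwa [show (⟨v, hv⟩ : weightSpace n k) = w from Subtype.ext hwv.symm])
    finrank_weightSpace.symm

theorem canonBasis_apply (x : LState n k) : (canonBasis n k x : VTensor n) = canon x := by
  rw [canonBasis, coe_basisOfTopLeSpanOfCardEqFinrank]

end WeightSpace

/-- A module over `ℤ[q,q⁻¹]` with a basis indexed by the left I-states is identified with the weight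
space in a unique way after extension of scalars. -/
theorem existsUnique_equiv_weightSpace {n k : ℕ} {M : Type*} [AddCommGroup M] [Module ℤ[T;T⁻¹] M]
    (b : Module.Basis (LState n k) ℤ[T;T⁻¹] M) :
    ∃! β : (Cq ⊗[ℤ[T;T⁻¹]] M) ≃ₗ[Cq] weightSpace n k,
      ∀ x : LState n k, (β (1 ⊗ₜ b x) : VTensor n) = canon x := by
  refine ⟨(b.baseChange Cq).equiv (canonBasis n k) (Equiv.refl _), fun x => ?_, fun β hβ => ?_⟩
  · rw [← Module.Basis.baseChange_apply, Module.Basis.equiv_apply, Equiv.refl_apply,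
      canonBasis_apply]
  · refine LinearEquiv.toLinearMap_injective ((b.baseChange Cq).ext fun x => Subtype.ext ?_)
    change (β (b.baseChange Cq x) : VTensor n) =
      ((b.baseChange Cq).equiv (canonBasis n k) (Equiv.refl _) (b.baseChange Cq x) : _)
    rw [Module.Basis.equiv_apply, Equiv.refl_apply, canonBasis_apply, Module.Basis.baseChange_apply,
      hβ]

end

end OSzSar

/-! ### The theorem -/

theorem mainTheorem5 (𝕜 : Type*) [Field 𝕜] (n k : ℕ) (hk : k ≤ n) :
    -- the quotient map exists and is determined by its values on the arrows
    (∃! Ξ : BlZ n k →+* AZ n k, IsXi Ξ) ∧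
    ∀ Ξ : BlZ n k →+* AZ n k, IsXi Ξ →
      -- the modules concerned are finitely generated projective graded modules
      ∃ (hB : ∀ x : LState n k, (PB 𝕜 x).IsProj (blGr 𝕜 n k))
        (hA : ∀ l : LState n k, (PA 𝕜 l).IsProj (sarGr 𝕜 n k))
        (hpr : ∀ P : GrMod (Bl 𝕜 n k), P.IsProj (blGr 𝕜 n k) → (pr 𝕜 Ξ P).IsProj (sarGr 𝕜 n k)),
      -- projection induces an isomorphism of Grothendieck groups
      ∃ Φ : K0 (blGr 𝕜 n k) ≃ₗ[ℤ[T;T⁻¹]] K0 (sarGr 𝕜 n k),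
        (∀ P : GrProj (blGr 𝕜 n k), Φ (K0.cls P) = K0.cls ⟨pr 𝕜 Ξ P.1, hpr P.1 P.2⟩) ∧
        -- both Grothendieck groups over `ℂ(q)` are identified with the weight space
        (∃! β : (Cq ⊗[ℤ[T;T⁻¹]] K0 (blGr 𝕜 n k)) ≃ₗ[Cq] weightSpace n k,
          ∀ x : LState n k, (β (1 ⊗ₜ K0.cls ⟨PB 𝕜 x, hB x⟩) : VTensor n) = canon x) ∧
        (∃! α : (Cq ⊗[ℤ[T;T⁻¹]] K0 (sarGr 𝕜 n k)) ≃ₗ[Cq] weightSpace n k,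
          ∀ l : LState n k, (α (1 ⊗ₜ K0.cls ⟨PA 𝕜 l, hA l⟩) : VTensor n) = canon l) ∧
        -- and the isomorphism is compatible with these identifications
        ∀ (β : (Cq ⊗[ℤ[T;T⁻¹]] K0 (blGr 𝕜 n k)) ≃ₗ[Cq] weightSpace n k)
          (α : (Cq ⊗[ℤ[T;T⁻¹]] K0 (sarGr 𝕜 n k)) ≃ₗ[Cq] weightSpace n k),
          (∀ x : LState n k, (β (1 ⊗ₜ K0.cls ⟨PB 𝕜 x, hB x⟩) : VTensor n) = canon x) →
          (∀ l : LState n k, (α (1 ⊗ₜ K0.cls ⟨PA 𝕜 l, hA l⟩) : VTensor n) = canon l) →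
          ∀ z, α (Φ.toLinearMap.baseChange Cq z) = β z := by
  refine ⟨existsUnique_isXi n k, fun Ξ hΞ => ?_⟩
  have hB := blGr_isBasicGr 𝕜 n k
  have hA := sarGr_isBasicGr 𝕜 n k
  have hdeg := xiBase_mem 𝕜 hΞ
  have hidem := xiBase_idem 𝕜 hΞ
  have hΦ : ∀ x : LState n k, K0.basisEquiv hB hA (K0.basis hB x) = K0.basis hA x := fun x => by
    rw [K0.basisEquiv, Module.Basis.equiv_apply, Equiv.refl_apply]
  refine ⟨leftIdealMod_isProj hB, leftIdealMod_isProj hA,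
    fun P hP => induced_isProj hB hA (xiBase 𝕜 Ξ) hdeg hidem P hP, K0.basisEquiv hB hA,
    fun P => K0.basisEquiv_apply hB hA (xiBase 𝕜 Ξ) hdeg hidem P, ?_, ?_, ?_⟩
  · have h := existsUnique_equiv_weightSpace (K0.basis hB)
    simp only [K0.basis_apply] at h
    exact h
  · have h := existsUnique_equiv_weightSpace (K0.basis hA)
    simp only [K0.basis_apply] at h
    exact h
  · intro β α hβ hα
    -- Compatibility is linear in `z`, so it is enough to check it on the classes of the `P(x)`,
    -- which form a basis after extension of scalars; both sides there give the canonical basis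
    -- element.
    refine LinearMap.congr_fun (f := α.toLinearMap ∘ₗ
      (K0.basisEquiv hB hA).toLinearMap.baseChange Cq) (g := β.toLinearMap)
      (((K0.basis hB).baseChange Cq).ext fun x => Subtype.ext ?_)
    rw [Module.Basis.baseChange_apply]
    change (α (1 ⊗ₜ K0.basisEquiv hB hA (K0.basis hB x)) : VTensor n) =
      (β (1 ⊗ₜ K0.basis hB x) : VTensor n)
    rw [hΦ, K0.basis_apply, K0.basis_apply]
    exact (hα x).trans (hβ x).symm
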